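/- In Monopolar Recognition, an instance is a pair $(G,k)$ of a finite simple graph $G$ and an integer $k\ge 0$; it is a yes-instance if $V(G)$ can be partitioned into two (possibly empty) sets $A,B$ such that $G[A]$ is a cluster graph (every connected component is a clique) with at most $k$ connected components and $B$ is an independent set. Theorem. Monopolar Recognition, parameterized by $k$, has a polynomial kernel with at most $9k^4+9k+1$ vertices (at most $2$ vertices if $k=0$) that can be computed in $O(n^2m)$ time, where $n=|V(G)|$ and $m=|E(G)|$. That is, there are a constant $C$ and an algorithm which, given an instance $(G,k)$ (as $n$, $k$, $m$ and a list of the $m$ edges), computes in at most $C\,(n^2m+1)$ steps an instance $(G',k')$ of Monopolar Recognition such that 1. $(G,k)$ is a yes-instance if and only if $(G',k')$ is a yes-instance; 2. $k'\le k$; 3. $|V(G')|\le 9k^4+9k+1$ if $k\ge 1$, and $|V(G')|\le 2$ if $k=0$; 4. the number of bits of the encoding of $(G',k')$ is bounded by a polynomial in $k$. Here the algorithm is a program for a word RAM with words of $O(\log(n+k))$ bits, in which arithmetic operations, comparisons and memory accesses on words take unit time. -/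

import Mathlib

/-! ### Monopolar partitions -/

/-- A cluster graph: a disjoint union of cliques, i.e. every connected component is a clique. -/
def IsClusterGraph {V : Type*} (H : SimpleGraph V) : Prop :=
  ∀ c : H.ConnectedComponent, H.IsClique c.supp

/-- `(A, B)` is a partition of the vertices (parts may be empty) such that `G[A]` is a cluster graph
and `B` is an independent set. -/
structure IsMonopolarPartition {V : Type*} (G : SimpleGraph V) (A B : Set V) : Prop where
  isCompl : IsCompl A B
  cluster : IsClusterGraph (G.induce A)
  indep : G.IsIndepSet B

/-- Yes-instances `(G, k)` of Monopolar Recognition: there is a monopolar partition `(A, B)` in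
which `G[A]` has at most `k` clusters (connected components). -/
def MonopolarYes {V : Type*} (G : SimpleGraph V) (k : ℕ) : Prop :=
  ∃ A B : Set V, IsMonopolarPartition G A B ∧
    Nat.card (G.induce A).ConnectedComponent ≤ k

/-! ### Encoding of instances -/

/-- `es` lists every edge of `G` exactly once, in any order and with any orientation. -/
def IsEdgeList {n : ℕ} (G : SimpleGraph (Fin n)) (es : List (Fin n × Fin n)) : Prop :=
  (es.map fun p => s(p.1, p.2)).Nodup ∧
    ∀ e : Sym2 (Fin n), e ∈ (es.map fun p => s(p.1, p.2)) ↔ e ∈ G.edgeSet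

/-- The word sequence `n, k, m, u₁, v₁, …, uₘ, vₘ` encoding an instance `(G, k)`, where `G` has
vertices `0, …, n - 1` and edges `u₁v₁, …, uₘvₘ`. -/
def encodeInstance (n k : ℕ) (es : List (Fin n × Fin n)) : List ℕ :=
  n :: k :: es.length :: es.flatMap fun p => [(p.1 : ℕ), (p.2 : ℕ)]

/-- Length in bits of a sequence of words (each in binary, with one separator per word). -/
def bitLength (x : List ℕ) : ℕ := (x.map fun w => Nat.size w + 1).sum

/-! ### Word RAM

Structured programs over registers `0, 1, 2, …` and arrays `0, 1, 2, …` (a program mentions only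
finitely many of either), each array being addressed by computed indices. Every register access,
array access, constant, arithmetic operation, assignment and comparison costs one step. The
machine has a word bound `W`: an operation that needs a value exceeding `W` cannot be executed. -/

namespace WordRAM

/-- Contents of the registers and of the arrays. -/
structure State where
  var : ℕ → ℕ
  arr : ℕ → ℕ → ℕ

inductive Expr where
  | const (c : ℕ)
  | var (x : ℕ)
  | get (a : ℕ) (i : Expr)
  | add (e f : Expr)
  | sub (e f : Expr)
  | mul (e f : Expr)

namespace Expr

/-- The value of an expression (`sub` is truncated subtraction). -/
def eval (s : State) : Expr → ℕ
  | const c => c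
  | var x => s.var x
  | get a i => s.arr a (i.eval s)
  | add e f => e.eval s + f.eval s
  | sub e f => e.eval s - f.eval s
  | mul e f => e.eval s * f.eval s

/-- The number of operations in an expression. -/
def cost : Expr → ℕ
  | const _ => 1
  | var _ => 1
  | get _ i => i.cost + 1
  | add e f => e.cost + f.cost + 1
  | sub e f => e.cost + f.cost + 1
  | mul e f => e.cost + f.cost + 1

/-- All intermediate values, addresses included, and the final value are at most `W`. -/
def Fits (W : ℕ) (s : State) : Expr → Prop
  | const c => c ≤ W
  | var x => s.var x ≤ W
  | get a i => i.Fits W s ∧ s.arr a (i.eval s) ≤ W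
  | add e f => e.Fits W s ∧ f.Fits W s ∧ e.eval s + f.eval s ≤ W
  | sub e f => e.Fits W s ∧ f.Fits W s
  | mul e f => e.Fits W s ∧ f.Fits W s ∧ e.eval s * f.eval s ≤ W

end Expr

inductive Prog where
  | skip
  | set (x : ℕ) (e : Expr)
  | put (a : ℕ) (i e : Expr)
  | seq (p q : Prog)
  | ifLt (e f : Expr) (p q : Prog)
  | whileLt (e f : Expr) (p : Prog)

/-- Assign `v` to register `x`. -/
def State.setVar (s : State) (x v : ℕ) : State :=
  { s with var := Function.update s.var x v }

/-- Assign `v` to cell `i` of array `a`. -/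
def State.setArr (s : State) (a i v : ℕ) : State :=
  { s with arr := Function.update s.arr a (Function.update (s.arr a) i v) }

/-- `Exec W p s s' t`: with word bound `W`, program `p` started in state `s` halts in state `s'`
after exactly `t` steps. -/
inductive Exec (W : ℕ) : Prog → State → State → ℕ → Prop where
  | skip (s : State) : Exec W .skip s s 1
  | set (x : ℕ) (e : Expr) (s : State) (he : e.Fits W s) :
      Exec W (.set x e) s (s.setVar x (e.eval s)) (e.cost + 1)
  | put (a : ℕ) (i e : Expr) (s : State) (hi : i.Fits W s) (he : e.Fits W s) :
      Exec W (.put a i e) s (s.setArr a (i.eval s) (e.eval s)) (i.cost + e.cost + 1)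
  | seq {p q : Prog} {s₁ s₂ s₃ : State} {t₁ t₂ : ℕ} (hp : Exec W p s₁ s₂ t₁)
      (hq : Exec W q s₂ s₃ t₂) : Exec W (.seq p q) s₁ s₃ (t₁ + t₂)
  | ifTrue {e f : Expr} {p q : Prog} {s s' : State} {t : ℕ} (he : e.Fits W s) (hf : f.Fits W s)
      (h : e.eval s < f.eval s) (hp : Exec W p s s' t) :
      Exec W (.ifLt e f p q) s s' (e.cost + f.cost + 1 + t)
  | ifFalse {e f : Expr} {p q : Prog} {s s' : State} {t : ℕ} (he : e.Fits W s) (hf : f.Fits W s)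
      (h : ¬ e.eval s < f.eval s) (hq : Exec W q s s' t) :
      Exec W (.ifLt e f p q) s s' (e.cost + f.cost + 1 + t)
  | whileTrue {e f : Expr} {p : Prog} {s₁ s₂ s₃ : State} {t₁ t₂ : ℕ} (he : e.Fits W s₁)
      (hf : f.Fits W s₁) (h : e.eval s₁ < f.eval s₁) (hp : Exec W p s₁ s₂ t₁)
      (hw : Exec W (.whileLt e f p) s₂ s₃ t₂) :
      Exec W (.whileLt e f p) s₁ s₃ (e.cost + f.cost + 1 + t₁ + t₂)
  | whileFalse {e f : Expr} {p : Prog} {s : State} (he : e.Fits W s) (hf : f.Fits W s)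
      (h : ¬ e.eval s < f.eval s) :
      Exec W (.whileLt e f p) s s (e.cost + f.cost + 1)

/-- Initial state on input `x`: the words of `x` at the beginning of array `0`, zero elsewhere. -/
def State.input (x : List ℕ) : State where
  var := fun _ => 0
  arr := fun a i => if a = 0 then x.getD i 0 else 0

/-- The output is read from the beginning of array `1`. -/
def State.Outputs (s : State) (x : List ℕ) : Prop :=
  ∀ (i : ℕ) (h : i < x.length), s.arr 1 i = x[i]

end WordRAM

/-!
The kernel is built from a description of all solutions. A monopolar partition with at most `k`
clusters is the same as a colouring `f : V → {0, …, k}` (`IsClusterColouring`): colour `0` is the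
independent side, and each other colour is one cluster.

Local structure decides much of `f`. A vertex whose neighbourhood contains an induced path on
three vertices, or consists of more than `k` cliques, is never in the independent side (`Core`). A
vertex on the cluster side shares its cluster with all core vertices adjacent to it, and with a
vertex of each triangle that it lies in. Where two of these requirements conflict, the vertex is
forced to the independent side (`Outer`). The other vertices to which they apply fall into classes
with names `label u`: each class owns one cluster, different classes own different clusters, and
this cluster holds exactly the members of the class that are on the cluster side. A solution
therefore consists of an injective assignment of colours to the classes, of the decision for each
vertex whether it is on the cluster side, and of the small clusters outside of the classes, which
contain no triangle.

The remaining decisions have a default: vertices with a neighbour in their own class, core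
vertices being left aside, go to the cluster side (`Dense`), the others to the independent side.
At most `2 * k` vertices deviate from it (`IsPartialSolution.card_flip_le`). An edge outside of the
core, unless it joins two dense vertices of one class, is a constraint on the deviations of its
ends: they deviate together (`Tied`), or at least one of them deviates (`Clash`). In a
yes-instance there are at most `2 * k * (k + 1)` ends of clashes
(`IsPartialSolution.card_clashing_le`). Starting from such an end `w`, a set of at most
`2 * k + 1` vertices connected by ties is collected (`IsTiedPart`); if `w` deviates, then so does
all of this set, hence it is smaller than `2 * k + 1` and closed under ties. So vertices outside
of these sets can return to the default (`IsPartialSolution.extend`), and it is enough to keep the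
union of the sets, and a gadget on four vertices for each of the at most `k` nonempty classes
(`exists_colouring_iff_kernelGraph`). This leaves at most
`4 * k + 2 * k * (k + 1) * (2 * k + 1)` vertices.

The program computes the tables that define this kernel by nested counting loops. Each nest has at
most two loops with `O(n)` rounds and one loop over the edges, which gives the time bound. For
such loop programs (`LProg`) the steps are counted and the word bound is checked once and for all
(`exec_run`, `time_le`): a stored value exceeds the values stored before by at most one, so that
all values are bounded by the initial ones plus the running time.
-/

/-! ### Cluster colourings -/

/-- A monopolar partition of the subgraph induced by `S`, written as a labelling: the label `0`
stands for the independent side, and each nonzero label is the name of one of at most `k`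
clusters. -/
structure IsClusterColouring {V : Type*} (G : SimpleGraph V) (k : ℕ) (S : Set V) (f : V → ℕ) :
    Prop where
  le : ∀ u ∈ S, f u ≤ k
  indep : ∀ u ∈ S, ∀ v ∈ S, G.Adj u v → f u = 0 → f v ≠ 0
  adj_iff : ∀ u ∈ S, ∀ v ∈ S, u ≠ v → f u ≠ 0 → f v ≠ 0 → (G.Adj u v ↔ f u = f v)

theorem IsClusterColouring.mono {V : Type*} {G : SimpleGraph V} {k : ℕ} {S T : Set V} {f : V → ℕ}
    (h : IsClusterColouring G k T f) (hST : S ⊆ T) : IsClusterColouring G k S f where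
  le u hu := h.le u (hST hu)
  indep u hu v hv := h.indep u (hST hu) v (hST hv)
  adj_iff u hu v hv := h.adj_iff u (hST hu) v (hST hv)

theorem monopolarYes_iff_exists_colouring {V : Type*} [Finite V] (G : SimpleGraph V) (k : ℕ) :
    MonopolarYes G k ↔ ∃ f : V → ℕ, IsClusterColouring G k Set.univ f := by
  classical
  constructor
  · rintro ⟨A, B, hp, hcard⟩
    let e := Finite.equivFin (G.induce A).ConnectedComponent
    refine ⟨fun v => if h : v ∈ A then
      (e ((G.induce A).connectedComponentMk ⟨v, h⟩) : ℕ) + 1 else 0, ⟨?_, ?_, ?_⟩⟩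
    · intro u _
      by_cases h : u ∈ A
      · simp only [h, dif_pos]
        have := (e ((G.induce A).connectedComponentMk ⟨u, h⟩)).2
        omega
      · simp [h]
    · intro u _ v _ huv hu hv
      have hB : ∀ w, w ∉ A → w ∈ B := by
        intro w hw
        have := hp.isCompl.codisjoint
        rw [codisjoint_iff] at this
        have hw' : w ∈ A ⊔ B := by rw [this]; trivial
        exact hw'.resolve_left hw
      have hu' : u ∉ A := by
        intro h; simp [h] at hu
      have hv' : v ∉ A := by
        intro h; simp [h] at hv
      exact hp.indep (hB u hu') (hB v hv') huv.ne huv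
    · intro u _ v _ huv hu hv
      have hu' : u ∈ A := by
        by_contra h; simp [h] at hu
      have hv' : v ∈ A := by
        by_contra h; simp [h] at hv
      simp only [hu', hv', dif_pos, Nat.add_right_cancel_iff, Fin.val_inj, e.injective.eq_iff]
      constructor
      · intro h
        exact SimpleGraph.ConnectedComponent.sound
          (SimpleGraph.Adj.reachable (by simpa using h))
      · intro h
        have hc := hp.cluster ((G.induce A).connectedComponentMk ⟨u, hu'⟩)
        have h1 : (⟨u, hu'⟩ : A) ∈ ((G.induce A).connectedComponentMk ⟨u, hu'⟩).supp := rfl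
        have h2 : (⟨v, hv'⟩ : A) ∈ ((G.induce A).connectedComponentMk ⟨u, hu'⟩).supp := by
          rw [h]; rfl
        have := hc h1 h2 (by simpa using huv)
        simpa using this
  · rintro ⟨f, hf⟩
    have hreach : ∀ (u v : {v | f v ≠ 0}), (G.induce {v | f v ≠ 0}).Reachable u v →
        f u = f v := by
      rintro u v ⟨p⟩
      induction p with
      | nil => rfl
      | @cons a b c hab _ ih =>
        rw [← ih]
        have hab' : G.Adj a b := by simpa using hab
        exact (hf.adj_iff a trivial b trivial hab'.ne a.2 b.2).1 hab'
    refine ⟨{v | f v ≠ 0}, {v | f v = 0}, ⟨?_, ?_, ?_⟩, ?_⟩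
    · rw [isCompl_comm]
      exact isCompl_compl (x := {v | f v = 0})
    · intro c u hu v hv huv
      have hne : (u : V) ≠ v := fun h => huv (Subtype.ext h)
      have : (G.induce {v | f v ≠ 0}).Reachable u v :=
        SimpleGraph.ConnectedComponent.exact (hu.trans hv.symm)
      simpa using (hf.adj_iff u trivial v trivial hne u.2 v.2).2 (hreach u v this)
    · intro u hu v hv _ huv
      exact hf.indep u trivial v trivial huv hu hv
    · let ψ : (G.induce {v | f v ≠ 0}).ConnectedComponent → Fin k :=
        fun c => ⟨f c.out - 1, by
          have h1 := hf.le c.out trivial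
          have h2 : f c.out ≠ 0 := c.out.2
          omega⟩
      have hψ : Function.Injective ψ := by
        intro c d h
        have h1 : f c.out ≠ 0 := c.out.2
        have h2 : f d.out ≠ 0 := d.out.2
        have h3 : f c.out - 1 = f d.out - 1 := by simpa [ψ] using h
        have h4 : f c.out = f d.out := by omega
        by_cases he : (c.out : V) = d.out
        · have : c.out = d.out := Subtype.ext he
          rw [← Quot.out_eq c, ← Quot.out_eq d, this]
        · have hadj := (hf.adj_iff c.out trivial d.out trivial he h1 h2).2 h4
          rw [← Quot.out_eq c, ← Quot.out_eq d]
          exact SimpleGraph.ConnectedComponent.sound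
            (SimpleGraph.Adj.reachable (by simpa using hadj))
      have := Nat.card_le_card_of_injective ψ hψ
      simpa using this

/-! ### Forced vertices -/

/-- An instance on the vertex set `{0, …, n - 1}`, as a graph on `ℕ` in which all other vertices
are isolated. -/
structure Instance where
  n : ℕ
  k : ℕ
  G : SimpleGraph ℕ
  lt_of_adj : ∀ x y, G.Adj x y → x < n

namespace Instance

variable (I : Instance)

theorem lt_of_adj' {x y : ℕ} (h : I.G.Adj x y) : y < I.n := I.lt_of_adj y x h.symm

/-- `x` is a neighbour of `u` with no smaller neighbour inside the neighbourhood of `u`. If this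
neighbourhood is a cluster graph, then it has one such vertex in each cluster. -/
def LocalMin (u x : ℕ) : Prop :=
  I.G.Adj u x ∧ ∀ y, I.G.Adj u y → I.G.Adj y x → ¬ y < x

/-- The neighbourhood of `u` contains an induced path on three vertices. -/
def HasInducedPath (u : ℕ) : Prop :=
  ∃ x y z, I.G.Adj u x ∧ I.G.Adj u y ∧ I.G.Adj u z ∧ I.G.Adj x y ∧ I.G.Adj y z ∧ x ≠ z ∧
    ¬ I.G.Adj x z

open Classical in
/-- Core vertices: their neighbourhood is visibly not a cluster graph with at most `k` clusters,
so they cannot be on the independent side. -/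
def Core (u : ℕ) : Prop :=
  I.HasInducedPath u ∨ I.k < ((Finset.range I.n).filter fun x => I.LocalMin u x).card

/-- `u` is not a core vertex and lies in a triangle, of which `p` is a vertex. -/
def Tri (u p : ℕ) : Prop :=
  ¬ I.Core u ∧ ∃ y z, I.G.Adj u y ∧ I.G.Adj u z ∧ I.G.Adj y z ∧ (p = u ∨ p = y)

/-- The edge `pz` lies in a triangle whose vertices other than `p` are not core vertices. -/
def FreeTri (p z : ℕ) : Prop :=
  I.G.Adj p z ∧ ¬ I.Core z ∧ ∃ y, ¬ I.Core y ∧ I.G.Adj y p ∧ I.G.Adj y z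

/-- Neighbours `p` of `u` for which `u`, once on the cluster side, has a member of its cluster
among `p` and the common neighbours of `p` and `u`. -/
def Strong (u p : ℕ) : Prop := I.Core p ∨ I.Tri u p

/-- Vertices that cannot be on the cluster side because they would have to belong to two different
clusters, or to a cluster with a vertex they are not adjacent to. -/
def Outer (u : ℕ) : Prop :=
  ∃ p z, z ≠ u ∧ z ≠ p ∧ I.G.Adj u p ∧
    ((I.G.Adj u z ∧ ¬ I.G.Adj p z ∧ I.Strong u p ∧ I.Strong u z) ∨
      (I.Core p ∧ I.G.Adj p z ∧ ¬ I.G.Adj u z ∧ (I.Core z ∨ I.FreeTri p z)))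

variable {I}

theorem adj_of_not_core {u x y z : ℕ} (hu : ¬ I.Core u) (hx : I.G.Adj u x) (hy : I.G.Adj u y)
    (hz : I.G.Adj u z) (hxy : I.G.Adj x y) (hyz : I.G.Adj y z) (hxz : x ≠ z) : I.G.Adj x z := by
  by_contra h
  exact hu (Or.inl ⟨x, y, z, hx, hy, hz, hxy, hyz, hxz, h⟩)

/-- An independent set in the neighbourhood of a vertex that is not a core vertex has at most `k`
elements: the least vertices of the clusters that it meets are distinct local minima. -/
theorem card_le_of_indep {u : ℕ} (hu : ¬ I.Core u) (S : Finset ℕ) (hS : ∀ x ∈ S, I.G.Adj u x)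
    (hind : ∀ x ∈ S, ∀ y ∈ S, ¬ I.G.Adj x y) : S.card ≤ I.k := by
  classical
  have hex : ∀ x, ∃ y, I.G.Adj u x → (I.G.Adj u y ∧ (y = x ∨ I.G.Adj y x) ∧
      ∀ z, I.G.Adj u z → (z = x ∨ I.G.Adj z x) → y ≤ z) := by
    intro x
    by_cases hx : I.G.Adj u x
    · have h : ∃ y, I.G.Adj u y ∧ (y = x ∨ I.G.Adj y x) := ⟨x, hx, Or.inl rfl⟩
      exact ⟨Nat.find h, fun _ => ⟨(Nat.find_spec h).1, (Nat.find_spec h).2,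
        fun z hz hzx => Nat.find_min' h ⟨hz, hzx⟩⟩⟩
    · exact ⟨0, fun h => absurd h hx⟩
  choose m hm using hex
  have hcard : ((Finset.range I.n).filter fun x => I.LocalMin u x).card ≤ I.k := by
    by_contra h
    exact hu (Or.inr (by omega))
  refine le_trans (Finset.card_le_card_of_injOn m ?_ ?_) hcard
  · intro x hx
    obtain ⟨h1, h2, h3⟩ := hm x (hS x hx)
    simp only [Finset.coe_filter, Finset.mem_range, Set.mem_ofPred_eq]
    refine ⟨I.lt_of_adj' h1, h1, fun y hy hym hlt => ?_⟩
    have := h3 y hy (by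
      rcases h2 with h2 | h2
      · rw [h2] at hym; exact Or.inr hym
      · by_cases hyx : y = x
        · exact Or.inl hyx
        · exact Or.inr (adj_of_not_core hu hy h1 (hS x hx) hym h2 hyx))
    omega
  · intro x hx y hy hxy
    have hx' := hS x hx
    have hy' := hS y hy
    obtain ⟨h1, h2, -⟩ := hm x hx'
    obtain ⟨h3, h4, -⟩ := hm y hy'
    rw [← hxy] at h4
    by_contra hne
    refine hind x hx y hy ?_
    rcases h2 with h2 | h2
    · rcases h4 with h4 | h4
      · exact absurd (h2.symm.trans h4) hne
      · rwa [h2] at h4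
    · rcases h4 with h4 | h4
      · rw [h4] at h2; exact h2.symm
      · exact adj_of_not_core hu hx' h1 hy' h2.symm h4 hne

/-- Of two adjacent vertices, a common neighbour with a nonzero colour shares its colour with at
least one. -/
theorem exists_eq_of_adj {f : ℕ → ℕ} (hf : IsClusterColouring I.G I.k Set.univ f) {u y z : ℕ}
    (hu : f u ≠ 0) (hy : I.G.Adj u y) (hz : I.G.Adj u z) (hyz : I.G.Adj y z) :
    f y = f u ∨ f z = f u := by
  by_cases h : f y = 0
  · exact Or.inr ((hf.adj_iff u trivial z trivial hz.ne hu
      (hf.indep y trivial z trivial hyz h)).1 hz).symm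
  · exact Or.inl ((hf.adj_iff u trivial y trivial hy.ne hu h).1 hy).symm

theorem Core.ne_zero {f : ℕ → ℕ} (hf : IsClusterColouring I.G I.k Set.univ f) {u : ℕ}
    (hu : I.Core u) : f u ≠ 0 := by
  classical
  intro h0
  have hn : ∀ v, I.G.Adj u v → f v ≠ 0 := fun v hv => hf.indep u trivial v trivial hv h0
  rcases hu with ⟨x, y, z, hx, hy, hz, hxy, hyz, hxz, hnxz⟩ | hu
  · refine hnxz ((hf.adj_iff x trivial z trivial hxz (hn x hx) (hn z hz)).2 ?_)
    exact ((hf.adj_iff x trivial y trivial hxy.ne (hn x hx) (hn y hy)).1 hxy).trans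
      ((hf.adj_iff y trivial z trivial hyz.ne (hn y hy) (hn z hz)).1 hyz)
  · have : ((Finset.range I.n).filter fun x => I.LocalMin u x).card ≤
        (Finset.Icc 1 I.k).card := by
      refine Finset.card_le_card_of_injOn f ?_ ?_
      · intro x hx
        simp only [Finset.coe_filter, Finset.mem_range, Set.mem_ofPred_eq] at hx
        have := hn x hx.2.1
        have := hf.le x trivial
        simp only [Finset.coe_Icc, Set.mem_Icc]
        omega
      · intro x hx y hy hxy
        simp only [Finset.coe_filter, Finset.mem_range, Set.mem_ofPred_eq] at hx hy
        by_contra hne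
        have hadj := (hf.adj_iff x trivial y trivial hne (hn x hx.2.1) (hn y hy.2.1)).2 hxy
        rcases lt_or_gt_of_ne hne with h | h
        · exact hy.2.2 x hx.2.1 hadj h
        · exact hx.2.2 y hy.2.1 hadj.symm h
    rw [Nat.card_Icc] at this
    omega

/-- The defining property of `Strong`. -/
theorem Strong.exists_eq {f : ℕ → ℕ} (hf : IsClusterColouring I.G I.k Set.univ f) {u p : ℕ}
    (h : I.Strong u p) (hp : I.G.Adj u p) (hu : f u ≠ 0) :
    ∃ q, I.G.Adj u q ∧ (q = p ∨ I.G.Adj p q) ∧ f q = f u := by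
  rcases h with h | ⟨-, y, z, hy, hz, hyz, hpy⟩
  · exact ⟨p, hp, Or.inl rfl,
      ((hf.adj_iff u trivial p trivial hp.ne hu (h.ne_zero hf)).1 hp).symm⟩
  · rcases hpy with rfl | rfl
    · exact absurd hp (I.G.loopless.irrefl _)
    · rcases exists_eq_of_adj hf hu hy hz hyz with h | h
      · exact ⟨p, hp, Or.inl rfl, h⟩
      · exact ⟨z, hz, Or.inr hyz, h⟩

theorem Outer.eq_zero {f : ℕ → ℕ} (hf : IsClusterColouring I.G I.k Set.univ f) {u : ℕ}
    (hu : I.Outer u) : f u = 0 := by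
  by_contra h0
  have hsame : ∀ v, v ≠ u → f v = f u → I.G.Adj u v := fun v hv h =>
    (hf.adj_iff u trivial v trivial (Ne.symm hv) h0 (by rw [h]; exact h0)).2 h.symm
  obtain ⟨p, z, hzu, hzp, hup, ⟨huz, hpz, hsp, hsz⟩ | ⟨hp, hpz, huz, hz⟩⟩ := hu
  · obtain ⟨p', hup', hpp', hfp⟩ := hsp.exists_eq hf hup h0
    obtain ⟨z', huz', hzz', hfz⟩ := hsz.exists_eq hf huz h0
    by_cases hcu : I.Core u
    · -- a core vertex is never `Tri`, so both witnesses are core vertices in the cluster of `u`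
      have hcp : I.Core p := hsp.resolve_right fun h => h.1 hcu
      have hcz : I.Core z := hsz.resolve_right fun h => h.1 hcu
      have h1 := (hf.adj_iff u trivial p trivial hup.ne h0 (hcp.ne_zero hf)).1 hup
      have h2 := (hf.adj_iff u trivial z trivial huz.ne h0 (hcz.ne_zero hf)).1 huz
      exact hpz ((hf.adj_iff p trivial z trivial (Ne.symm hzp) (hcp.ne_zero hf)
        (hcz.ne_zero hf)).2 (h1.symm.trans h2))
    · have h1 : p' = z' ∨ I.G.Adj p' z' := by
        by_cases h : p' = z'
        · exact Or.inl h
        · exact Or.inr ((hf.adj_iff p' trivial z' trivial h (by rw [hfp]; exact h0)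
            (by rw [hfz]; exact h0)).2 (hfp.trans hfz.symm))
      have h2 : p = z' ∨ I.G.Adj p z' := by
        rcases hpp' with rfl | hpp'
        · exact h1
        · rcases h1 with rfl | h1
          · exact Or.inr hpp'
          · by_cases h : p = z'
            · exact Or.inl h
            · exact Or.inr (adj_of_not_core hcu hup hup' huz' hpp' h1 h)
      refine hpz ?_
      rcases hzz' with rfl | hzz'
      · exact h2.resolve_left (Ne.symm hzp)
      · rcases h2 with rfl | h2
        · exact hzz'.symm
        · exact adj_of_not_core hcu hup huz' huz h2 hzz'.symm (Ne.symm hzp)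
  · have hfp : f p = f u :=
      ((hf.adj_iff u trivial p trivial hup.ne h0 (hp.ne_zero hf)).1 hup).symm
    rcases hz with hz | ⟨-, hzc, y, hyc, hyp, hyz⟩
    · refine huz (hsame z hzu ?_)
      rw [← hfp]
      exact ((hf.adj_iff p trivial z trivial (Ne.symm hzp) (hp.ne_zero hf) (hz.ne_zero hf)).1
        hpz).symm
    · rcases exists_eq_of_adj hf (hp.ne_zero hf) hpz hyp.symm hyz.symm with h | h
      · exact huz (hsame z hzu (h.trans hfp))
      · by_cases hyu : y = u
        · exact huz (hyu ▸ hyz)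
        · have huy := hsame y hyu (h.trans hfp)
          exact huz (adj_of_not_core hyc huy.symm hyp hyz hup hpz (Ne.symm hzu))

end Instance

/-! ### Classes -/

open Classical in
/-- The largest `p < m` with `P p`, or `d` if there is none. -/
noncomputable def lastSat (P : ℕ → Prop) (d : ℕ) : ℕ → ℕ
  | 0 => d
  | m + 1 => if P m then m else lastSat P d m

theorem lastSat_spec (P : ℕ → Prop) (d m : ℕ) :
    (lastSat P d m < m ∧ P (lastSat P d m)) ∨ (lastSat P d m = d ∧ ∀ p < m, ¬ P p) := by
  induction m with
  | zero => exact Or.inr ⟨rfl, fun p hp => absurd hp (Nat.not_lt_zero p)⟩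
  | succ m ih =>
    by_cases h : P m
    · simp [lastSat, h]
    · simp only [lastSat, h, if_false]
      rcases ih with ih | ih
      · exact Or.inl ⟨by omega, ih.2⟩
      · refine Or.inr ⟨ih.1, fun p hp => ?_⟩
        rcases Nat.lt_succ_iff_lt_or_eq.1 hp with h' | rfl
        · exact ih.2 p h'
        · exact h

namespace Instance

variable (I : Instance)

/-- `p` is a core vertex equal or adjacent to `u`. -/
def Att (u p : ℕ) : Prop := I.Core p ∧ (p = u ∨ I.G.Adj u p)

/-- `p` may serve as the name of the class of `u`: it is a core vertex next to `u` or, if there is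
none, a vertex of the maximal clique of size at least three around `u`. -/
def Cand (u p : ℕ) : Prop :=
  ¬ I.Outer u ∧ (((∃ a, I.Att u a) ∧ I.Att u p) ∨
    ((¬ ∃ a, I.Att u a) ∧ I.Tri u p ∧ ¬ I.Outer p))

/-- The name of the class of `u`, or `n` if `u` belongs to no class. The members of a class that
are on the cluster side all belong to the same cluster, and this cluster contains no other
vertex. -/
noncomputable def label (u : ℕ) : ℕ := lastSat (I.Cand u) I.n I.n

/-- `p` is the name of a nonempty class. -/
def Used (p : ℕ) : Prop := p < I.n ∧ ∃ u, I.label u = p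

/-- Vertices with a neighbour in their class. They are on the cluster side by default, all others
on the independent side. -/
def Dense (u : ℕ) : Prop :=
  ¬ I.Core u ∧ ∃ v, I.G.Adj u v ∧ ¬ I.Core v ∧ I.label u = I.label v ∧ I.label u < I.n

/-- No vertex is forced to both sides. -/
def Consistent : Prop := ∀ u, I.Core u → ¬ I.Outer u

variable {I}

theorem Core.lt {u : ℕ} (h : I.Core u) : u < I.n := by
  classical
  rcases h with ⟨x, y, z, hx, -⟩ | h
  · exact I.lt_of_adj _ _ hx
  · have h0 : 0 < ((Finset.range I.n).filter fun x => I.LocalMin u x).card := by omega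
    obtain ⟨x, hx⟩ := Finset.card_pos.1 h0
    simp only [Finset.mem_filter] at hx
    exact I.lt_of_adj _ _ hx.2.1

theorem Tri.lt {u p : ℕ} (h : I.Tri u p) : u < I.n ∧ p < I.n := by
  obtain ⟨-, y, z, hy, hz, -, rfl | rfl⟩ := h
  · exact ⟨I.lt_of_adj _ _ hy, I.lt_of_adj _ _ hy⟩
  · exact ⟨I.lt_of_adj _ _ hy, I.lt_of_adj' hy⟩

theorem Cand.lt {u p : ℕ} (h : I.Cand u p) : p < I.n := by
  obtain ⟨-, ⟨-, h, -⟩ | ⟨-, h, -⟩⟩ := h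
  · exact h.lt
  · exact h.lt.2

theorem Att.lt {u p : ℕ} (h : I.Att u p) : u < I.n := by
  obtain ⟨h, rfl | h'⟩ := h
  · exact h.lt
  · exact I.lt_of_adj _ _ h'

theorem Cand.label_lt {u p : ℕ} (h : I.Cand u p) : I.label u < I.n := by
  rcases lastSat_spec (I.Cand u) I.n I.n with h' | h'
  · exact h'.1
  · exact absurd h (h'.2 p h.lt)

theorem cand_label {u : ℕ} (h : I.label u < I.n) : I.Cand u (I.label u) := by
  rcases lastSat_spec (I.Cand u) I.n I.n with h' | h'
  · exact h'.2
  · exact absurd h'.1 h.ne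

theorem not_outer_of_label_lt {u : ℕ} (h : I.label u < I.n) : ¬ I.Outer u := (cand_label h).1

theorem label_congr {u v : ℕ} (h : ∀ p, I.Cand u p ↔ I.Cand v p) : I.label u = I.label v := by
  have : I.Cand u = I.Cand v := funext fun p => propext (h p)
  rw [label, label, this]

theorem Tri.adj_or_eq {u p : ℕ} (h : I.Tri u p) : p = u ∨ I.G.Adj u p := by
  obtain ⟨-, y, z, hy, hz, -, rfl | rfl⟩ := h
  · exact Or.inl rfl
  · exact Or.inr hy

theorem Tri.refl_of {u p : ℕ} (h : I.Tri u p) : I.Tri u u := by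
  obtain ⟨hu, y, z, hy, hz, hyz, -⟩ := h
  exact ⟨hu, y, z, hy, hz, hyz, Or.inl rfl⟩

theorem Tri.exists_common {u p : ℕ} (h : I.Tri u p) (hne : p ≠ u) :
    ∃ z, I.G.Adj u p ∧ I.G.Adj u z ∧ I.G.Adj p z := by
  obtain ⟨hu, y, z, hy, hz, hyz, rfl | rfl⟩ := h
  · exact absurd rfl hne
  · exact ⟨z, hy, hz, hyz⟩

theorem Tri.symm {u p : ℕ} (h : I.Tri u p) (hp : ¬ I.Core p) : I.Tri p u := by
  by_cases hne : p = u
  · subst hne; exact h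
  · obtain ⟨z, h1, h2, h3⟩ := h.exists_common hne
    exact ⟨hp, u, z, h1.symm, h3, h2, Or.inr rfl⟩

/-- Two vertices strongly linked to a vertex that is not outer are adjacent. -/
theorem adj_of_strong {u p z : ℕ} (hu : ¬ I.Outer u) (hp : I.G.Adj u p) (hz : I.G.Adj u z)
    (hsp : I.Strong u p) (hsz : I.Strong u z) (hne : p ≠ z) : I.G.Adj p z := by
  by_contra h
  exact hu ⟨p, z, hz.ne', hne.symm, hp, Or.inl ⟨hz, h, hsp, hsz⟩⟩

/-- Neighbours of a core neighbour `p` that certainly have the cluster of `p` nearby. -/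
theorem adj_of_core {u p z : ℕ} (hu : ¬ I.Outer u) (hp : I.G.Adj u p) (hc : I.Core p)
    (hpz : I.G.Adj p z) (hz : I.Core z ∨ I.FreeTri p z) (hne : z ≠ u) : I.G.Adj u z := by
  by_contra h
  exact hu ⟨p, z, hne, hpz.ne', hp, Or.inr ⟨hc, hpz, h, hz⟩⟩

theorem att_iff {u a : ℕ} (hu : ¬ I.Outer u) (ha : I.Att u a) (b : ℕ) :
    I.Att u b ↔ I.Att a b := by
  obtain ⟨hca, rfl | hua⟩ := ha
  · rfl
  constructor
  · rintro ⟨hcb, rfl | hub⟩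
    · exact ⟨hcb, Or.inr hua.symm⟩
    · refine ⟨hcb, ?_⟩
      by_cases h : b = a
      · exact Or.inl h
      · exact Or.inr (adj_of_strong hu hua hub (Or.inl hca) (Or.inl hcb) (Ne.symm h))
  · rintro ⟨hcb, rfl | hab⟩
    · exact ⟨hcb, Or.inr hua⟩
    · refine ⟨hcb, ?_⟩
      by_cases h : b = u
      · exact Or.inl h
      · exact Or.inr (adj_of_core hu hua hca hab (Or.inl hcb) h)

theorem label_eq_of_att {u v a : ℕ} (hu : ¬ I.Outer u) (hv : ¬ I.Outer v) (hua : I.Att u a)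
    (hva : I.Att v a) : I.label u = I.label v := by
  refine label_congr fun p => ?_
  have h1 : ∃ a, I.Att u a := ⟨a, hua⟩
  have h2 : ∃ a, I.Att v a := ⟨a, hva⟩
  simp only [Cand, hu, hv, h1, h2, not_false_eq_true, true_and, not_true_eq_false, false_and,
    or_false]
  rw [att_iff hu hua, att_iff hv hva]

theorem att_label_lt {u a : ℕ} (hu : ¬ I.Outer u) (h : I.Att u a) : I.label u < I.n :=
  Cand.label_lt (p := a) ⟨hu, Or.inl ⟨⟨a, h⟩, h⟩⟩

theorem tri_label_lt {u p : ℕ} (hu : ¬ I.Outer u) (h : I.Tri u p) : I.label u < I.n := by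
  by_cases ha : ∃ a, I.Att u a
  · exact att_label_lt hu ha.choose_spec
  · exact Cand.label_lt (p := u) ⟨hu, Or.inr ⟨ha, h.refl_of, hu⟩⟩

theorem not_core_of_not_att {u p : ℕ} (hatt : ¬ ∃ a, I.Att u a) (h : I.Tri u p) : ¬ I.Core p :=
  fun hc => hatt ⟨p, hc, h.adj_or_eq⟩

theorem not_att_of_tri {u p : ℕ} (hatt : ¬ ∃ a, I.Att u a) (h : I.Tri u p)
    (hp : ¬ I.Outer p) : ¬ ∃ a, I.Att p a := by
  by_cases hne : p = u
  · rwa [hne]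
  rintro ⟨a, hca, rfl | hpa⟩
  · exact hatt ⟨a, hca, h.adj_or_eq⟩
  · have hpu : I.Tri p u := h.symm (not_core_of_not_att hatt h)
    have hup := h.adj_or_eq.resolve_left hne
    have hau : a ≠ u := by
      rintro rfl
      exact hatt ⟨a, hca, Or.inl rfl⟩
    exact hatt ⟨a, hca, Or.inr
      (adj_of_strong hp hpa hup.symm (Or.inl hca) (Or.inr hpu) hau).symm⟩

theorem tri_trans {u p q : ℕ} (hu : ¬ I.Outer u) (h : I.Tri u p) (hp : ¬ I.Core p)
    (hq : I.Tri u q) : I.Tri p q := by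
  by_cases hpq : p = q
  · subst hpq
    exact (h.symm hp).refl_of
  by_cases hpu : p = u
  · subst hpu; exact hq
  by_cases hqu : q = u
  · subst hqu; exact h.symm hp
  have hup := h.adj_or_eq.resolve_left hpu
  have huq := hq.adj_or_eq.resolve_left hqu
  have hadj := adj_of_strong hu hup huq (Or.inr h) (Or.inr hq) hpq
  exact ⟨hp, q, u, hadj, hup.symm, huq.symm, Or.inr rfl⟩

theorem tri_iff {u p : ℕ} (hu : ¬ I.Outer u) (hatt : ¬ ∃ a, I.Att u a) (h : I.Tri u p)
    (hp : ¬ I.Outer p) (q : ℕ) : I.Tri u q ↔ I.Tri p q := by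
  have hc := not_core_of_not_att hatt h
  exact ⟨fun hq => tri_trans hu h hc hq, fun hq => tri_trans hp (h.symm hc) h.1 hq⟩

/-- A vertex that is neither core nor outer shares its class with all such vertices of the
triangles around it. -/
theorem label_eq_of_tri {u v : ℕ} (hu : ¬ I.Outer u) (hv : ¬ I.Outer v) (hcv : ¬ I.Core v)
    (h : I.Tri u v) : I.label u = I.label v := by
  by_cases hatt : ∃ a, I.Att u a
  · obtain ⟨a, ha⟩ := hatt
    refine label_eq_of_att hu hv ha ⟨ha.1, ?_⟩
    by_cases hne : v = u
    · rw [hne]; exact ha.2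
    have hau := ha.2.resolve_left (by rintro rfl; exact h.1 ha.1)
    have hvu := h.adj_or_eq.resolve_left hne
    refine Or.inr (adj_of_strong hu hau hvu (Or.inl ha.1) (Or.inr h) ?_).symm
    rintro rfl
    exact hcv ha.1
  · refine label_congr fun p => ?_
    simp only [Cand, hu, hv, hatt, not_att_of_tri hatt h hv, not_false_eq_true, true_and,
      false_and, false_or, tri_iff hu hatt h hv]

theorem label_eq_iff_of_core (hI : I.Consistent) {a u : ℕ} (ha : I.Core a) (hu : ¬ I.Outer u)
    (hne : u ≠ a) : I.G.Adj u a ↔ I.label u = I.label a := by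
  have haa : I.Att a a := ⟨ha, Or.inl rfl⟩
  constructor
  · intro h
    exact label_eq_of_att hu (hI a ha) ⟨ha, Or.inr h⟩ haa
  · intro h
    have hlt := att_label_lt (hI a ha) haa
    have h1 := cand_label hlt
    have h2 := cand_label (h.trans_lt hlt)
    rw [← h] at h1
    have hatt : I.Att a (I.label u) := by
      rcases h1.2 with h1 | h1
      · exact h1.2
      · exact absurd ⟨a, haa⟩ h1.1
    have hatt' : I.Att u (I.label u) := by
      rcases h2.2 with h2 | h2
      · exact h2.2
      · exact absurd hatt.1 (not_core_of_not_att h2.1 h2.2.1)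
    have := (att_iff hu hatt' a).2 ((att_iff (hI a ha) hatt a).1 haa)
    exact this.2.resolve_left (Ne.symm hne)

theorem core_label_lt (hI : I.Consistent) {a : ℕ} (ha : I.Core a) : I.label a < I.n :=
  att_label_lt (hI a ha) ⟨ha, Or.inl rfl⟩

/-- A class with an edge between two vertices outside the core is a clique. -/
theorem Dense.adj {u v : ℕ} (hu : I.Dense u) (hl : I.label v = I.label u)
    (hv : ¬ I.Core v) (hne : u ≠ v) : I.G.Adj u v := by
  obtain ⟨hcu, w, huw, hcw, hlw, hlt⟩ := hu
  have hCu := cand_label hlt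
  have hCv : I.Cand v (I.label u) := by rw [← hl]; exact cand_label (hl.trans_lt hlt)
  have hCw : I.Cand w (I.label u) := by rw [hlw]; exact cand_label (hlw ▸ hlt)
  by_cases hcp : I.Core (I.label u)
  · have hadj : ∀ x, ¬ I.Core x → I.Cand x (I.label u) → I.G.Adj x (I.label u) := by
      rintro x hx ⟨-, ⟨-, -, h | h⟩ | ⟨h1, h2, -⟩⟩
      · exact absurd (h ▸ hcp) hx
      · exact h
      · exact absurd hcp (not_core_of_not_att h1 h2)
    have hup := hadj u hcu hCu
    have hvp := hadj v hv hCv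
    have hwp := hadj w hcw hCw
    exact (adj_of_core hCv.1 hvp hcp hup.symm
      (Or.inr ⟨hup.symm, hcu, w, hcw, hwp, huw.symm⟩) hne).symm
  · have htri : ∀ x, I.Cand x (I.label u) → (¬ ∃ a, I.Att x a) ∧ I.Tri x (I.label u) ∧
        ¬ I.Outer (I.label u) := by
      rintro x ⟨-, ⟨-, h, -⟩ | h⟩
      · exact absurd h hcp
      · exact h
    obtain ⟨h1, h2, h3⟩ := htri u hCu
    obtain ⟨h4, h5, -⟩ := htri v hCv
    have := (tri_iff hCu.1 h1 h2 h3 v).2 ((tri_iff hCv.1 h4 h5 h3 v).1 h5.refl_of)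
    exact this.adj_or_eq.resolve_left (Ne.symm hne)

theorem Dense.of_label_eq {u v : ℕ} (hu : I.Dense u) (hl : I.label v = I.label u)
    (hv : ¬ I.Core v) : I.Dense v := by
  by_cases hne : u = v
  · rwa [← hne]
  · exact ⟨hv, u, (hu.adj hl hv hne).symm, hu.1, hl, by rw [hl]; exact hu.2.choose_spec.2.2.2⟩

theorem Dense.label_lt {u : ℕ} (hu : I.Dense u) : I.label u < I.n := hu.2.choose_spec.2.2.2

theorem Dense.not_outer {u : ℕ} (hu : I.Dense u) : ¬ I.Outer u := not_outer_of_label_lt hu.label_lt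

/-- In a solution, the members of a class on the cluster side make up a whole cluster. -/
theorem exists_class_colour (hI : I.Consistent) {f : ℕ → ℕ}
    (hf : IsClusterColouring I.G I.k Set.univ f) {p : ℕ} (hp : I.Used p) :
    ∃ c, c ≠ 0 ∧ c ≤ I.k ∧ ∀ u, f u = c ↔ f u ≠ 0 ∧ I.label u = p := by
  obtain ⟨hpn, u₀, hu₀⟩ := hp
  have hC : I.Cand u₀ p := by
    have := cand_label (I := I) (u := u₀) (by omega)
    rwa [hu₀] at this
  have hout : ∀ v, f v ≠ 0 → ¬ I.Outer v := fun v hv h => hv (h.eq_zero hf)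
  rcases hC with ⟨ho, ⟨-, hatt⟩ | ⟨hna, htri, hop⟩⟩
  · have hp0 := hatt.1.ne_zero hf
    have hlp : I.label p = p := by
      exact (label_eq_of_att ho (hI p hatt.1) hatt ⟨hatt.1, Or.inl rfl⟩).symm.trans hu₀
    refine ⟨f p, hp0, hf.le p trivial, fun u => ?_⟩
    by_cases hup : u = p
    · subst hup; simp [hp0, hlp]
    constructor
    · intro h
      have h0 : f u ≠ 0 := by rw [h]; exact hp0
      refine ⟨h0, ?_⟩
      have := (hf.adj_iff u trivial p trivial hup h0 hp0).2 h
      rw [(label_eq_iff_of_core hI hatt.1 (hout u h0) hup).1 this, hlp]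
    · rintro ⟨h0, hl⟩
      refine (hf.adj_iff u trivial p trivial hup h0 hp0).1 ?_
      rw [label_eq_iff_of_core hI hatt.1 (hout u h0) hup, hl, hlp]
  · -- two vertices of a triangle at `u₀` are on the cluster side
    obtain ⟨m₁, m₂, h1, h2, ht1, ht2, h12⟩ : ∃ m₁ m₂, f m₁ ≠ 0 ∧ f m₂ ≠ 0 ∧ I.Tri u₀ m₁ ∧
        I.Tri u₀ m₂ ∧ I.G.Adj m₁ m₂ := by
      obtain ⟨hc, y, z, hy, hz, hyz, -⟩ := htri
      have hTy : I.Tri u₀ y := ⟨hc, y, z, hy, hz, hyz, Or.inr rfl⟩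
      have hTz : I.Tri u₀ z := ⟨hc, z, y, hz, hy, hyz.symm, Or.inr rfl⟩
      by_cases h0 : f u₀ = 0
      · exact ⟨y, z, hf.indep u₀ trivial y trivial hy h0, hf.indep u₀ trivial z trivial hz h0,
          hTy, hTz, hyz⟩
      · by_cases hy0 : f y = 0
        · exact ⟨u₀, z, h0, hf.indep y trivial z trivial hyz hy0, hTy.refl_of, hTz, hz⟩
        · exact ⟨u₀, y, h0, hy0, hTy.refl_of, hTy, hy⟩
    have hcol : f m₁ = f m₂ := (hf.adj_iff m₁ trivial m₂ trivial h12.ne h1 h2).1 h12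
    have hc1 := not_core_of_not_att hna ht1
    have hc2 := not_core_of_not_att hna ht2
    have hna1 := not_att_of_tri hna ht1 (hout m₁ h1)
    have hlm1 : I.label m₁ = p := (label_eq_of_tri ho (hout m₁ h1) hc1 ht1).symm.trans hu₀
    have ht12 : I.Tri m₁ m₂ := (tri_iff ho hna ht1 (hout m₁ h1) m₂).1 ht2
    refine ⟨f m₁, h1, hf.le _ trivial, fun u => ?_⟩
    constructor
    · intro h
      have h0 : f u ≠ 0 := by rw [h]; exact h1
      refine ⟨h0, ?_⟩
      by_cases hu1 : u = m₁
      · rw [hu1, hlm1]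
      by_cases hu2 : u = m₂
      · rw [hu2, ← label_eq_of_tri (hout m₁ h1) (hout m₂ h2) hc2 ht12, hlm1]
      have a1 := (hf.adj_iff u trivial m₁ trivial hu1 h0 h1).2 h
      have a2 := (hf.adj_iff u trivial m₂ trivial hu2 h0 h2).2 (h.trans hcol)
      have ht : I.Tri m₁ u := ⟨hc1, u, m₂, a1.symm, h12, a2, Or.inr rfl⟩
      rw [← label_eq_of_tri (hout m₁ h1) (hout u h0) (not_core_of_not_att hna1 ht) ht, hlm1]
    · rintro ⟨h0, hl⟩
      have hCu : I.Cand u p := by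
        have := cand_label (I := I) (u := u) (by omega)
        rwa [hl] at this
      have hcp := not_core_of_not_att hna htri
      obtain ⟨hou, ⟨-, hA⟩ | ⟨hnau, htu, -⟩⟩ := hCu
      · exact absurd hA.1 hcp
      have htm : ∀ m, I.Tri u₀ m → m = u ∨ I.G.Adj u m := fun m hm =>
        ((tri_iff hou hnau htu hop m).2 ((tri_iff ho hna htri hop m).1 hm)).adj_or_eq
      rcases htm m₁ ht1 with h | h
      · rw [h]
      · exact (hf.adj_iff u trivial m₁ trivial h.ne h0 h1).1 h

/-- If there are outer vertices but no classes, then the instance has no solution. -/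
theorem exists_used_of_outer {f : ℕ → ℕ} (hf : IsClusterColouring I.G I.k Set.univ f)
    (hI : I.Consistent) {u : ℕ} (hu : I.Outer u) : ∃ p, I.Used p := by
  have key : ∀ v, I.label v < I.n → ∃ p, I.Used p := fun v hv => ⟨_, hv, v, rfl⟩
  by_cases hcore : ∃ a, I.Core a
  · exact key _ (core_label_lt hI hcore.choose_spec)
  have hnc : ∀ a, ¬ I.Core a := fun a ha => hcore ⟨a, ha⟩
  obtain ⟨p, z, -, -, -, ⟨-, -, hsp, -⟩ | ⟨hp, -⟩⟩ := id hu
  · obtain ⟨-, y, w, hy, hw, hyw, -⟩ := hsp.resolve_left (hnc p)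
    have h0 := hu.eq_zero hf
    have hy0 := hf.indep u trivial y trivial hy h0
    exact key y (tri_label_lt (fun h => hy0 (h.eq_zero hf))
      ⟨hnc y, u, w, hy.symm, hyw, hw, Or.inl rfl⟩)
  · exact absurd hp (hnc p)

end Instance

/-! ### Partial solutions and deviations from the default -/

namespace Instance

variable (I : Instance)

/-- A solution on a set `K` of vertices outside the core: a cluster colouring `h` of `K` in which
the members of a class on the cluster side make up a whole cluster of `K`, of colour `c p` for the
class named `p`, while outer vertices are on the independent side. -/
structure IsPartialSolution (K : Set ℕ) (h c : ℕ → ℕ) : Prop where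
  colouring : IsClusterColouring I.G I.k K h
  pos : ∀ p, I.Used p → c p ≠ 0
  le : ∀ p, I.Used p → c p ≤ I.k
  inj : ∀ p q, I.Used p → I.Used q → c p = c q → p = q
  eq_iff : ∀ u ∈ K, ∀ p, I.Used p → (h u = c p ↔ h u ≠ 0 ∧ I.label u = p)
  outer : ∀ u ∈ K, I.Outer u → h u = 0

/-- `u` is not on its default side. -/
def Flip (h : ℕ → ℕ) (u : ℕ) : Prop := ¬ (h u ≠ 0 ↔ I.Dense u)

/-- Edges between vertices of different default: both or neither of them deviate. -/
def Tied (u v : ℕ) : Prop :=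
  I.G.Adj u v ∧ ¬ I.Core u ∧ ¬ I.Core v ∧ ¬ (I.Dense u ↔ I.Dense v)

/-- Edges that contradict the defaults: at least one end has to deviate. -/
def Clash (u v : ℕ) : Prop :=
  I.G.Adj u v ∧ ¬ I.Core u ∧ ¬ I.Core v ∧ (I.Dense u ↔ I.Dense v) ∧
    ¬ (I.Dense u ∧ I.label u = I.label v)

/-- `u` is an end of an edge that contradicts the defaults. -/
def Clashing (u : ℕ) : Prop := ∃ v, I.Clash u v

variable {I}

theorem Clash.symm {u v : ℕ} (h : I.Clash u v) : I.Clash v u := by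
  obtain ⟨h1, h2, h3, h4, h5⟩ := h
  exact ⟨h1.symm, h3, h2, h4.symm, fun h => h5 ⟨h4.2 h.1, h.2.symm⟩⟩

theorem Tied.symm {u v : ℕ} (h : I.Tied u v) : I.Tied v u :=
  ⟨h.1.symm, h.2.2.1, h.2.1, fun h' => h.2.2.2 h'.symm⟩

theorem used_label {u : ℕ} (h : I.label u < I.n) : I.Used (I.label u) := ⟨h, u, rfl⟩

theorem Flip.ne_zero {h : ℕ → ℕ} {u : ℕ} (hf : I.Flip h u) (hd : ¬ I.Dense u) : h u ≠ 0 :=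
  fun h1 => hf ⟨fun h => absurd h1 h, fun h => absurd h hd⟩

namespace IsPartialSolution

variable {K : Set ℕ} {h c : ℕ → ℕ}

theorem eq_colour (P : I.IsPartialSolution K h c) {u : ℕ} (hu : u ∈ K) (h0 : h u ≠ 0)
    (hl : I.label u < I.n) : h u = c (I.label u) :=
  (P.eq_iff u hu _ (used_label hl)).2 ⟨h0, rfl⟩

theorem label_eq (P : I.IsPartialSolution K h c) {u v : ℕ} (hu : u ∈ K) (hv : v ∈ K)
    (hl : I.label u < I.n) (h0 : h u ≠ 0) (huv : h v = h u) : I.label v = I.label u := by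
  rw [P.eq_colour hu h0 hl] at huv
  exact ((P.eq_iff v hv _ (used_label hl)).1 huv).2

theorem mono {L : Set ℕ} (P : I.IsPartialSolution L h c) (hKL : K ⊆ L) :
    I.IsPartialSolution K h c where
  colouring := P.colouring.mono hKL
  pos := P.pos
  le := P.le
  inj := P.inj
  eq_iff u hu := P.eq_iff u (hKL hu)
  outer u hu := P.outer u (hKL hu)

theorem flip_of_clash (P : I.IsPartialSolution K h c) {u v : ℕ} (hu : u ∈ K) (hv : v ∈ K)
    (huv : I.Clash u v) : I.Flip h u ∨ I.Flip h v := by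
  obtain ⟨hadj, hcu, hcv, hd, hl⟩ := huv
  by_contra hcon
  simp only [Flip, not_or, not_not] at hcon
  by_cases hdu : I.Dense u
  · have h1 := hcon.1.2 hdu
    have h2 := hcon.2.2 (hd.1 hdu)
    have heq := (P.colouring.adj_iff u hu v hv hadj.ne h1 h2).1 hadj
    exact hl ⟨hdu, (P.label_eq hu hv hdu.label_lt h1 heq.symm).symm⟩
  · have h1 : h u = 0 := by
      by_contra h1; exact hdu (hcon.1.1 h1)
    have h2 := P.colouring.indep u hu v hv hadj h1
    exact hdu (hd.2 (hcon.2.1 h2))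

theorem eq_zero_iff_of_tied (P : I.IsPartialSolution K h c) {u v : ℕ} (hu : u ∈ K) (hv : v ∈ K)
    (huv : I.Tied u v) : h u = 0 ↔ h v ≠ 0 := by
  have key : ∀ u ∈ K, ∀ v ∈ K, I.Tied u v → I.Dense u → h u ≠ 0 → h v = 0 := by
    intro u hu v hv huv hdu h0
    by_contra h1
    have heq := (P.colouring.adj_iff u hu v hv huv.1.ne h0 h1).1 huv.1
    have hl := P.label_eq hu hv hdu.label_lt h0 heq.symm
    exact huv.2.2.2 ⟨fun _ => hdu.of_label_eq hl huv.2.2.1, fun _ => hdu⟩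
  refine ⟨P.colouring.indep u hu v hv huv.1, fun h1 => ?_⟩
  by_contra h0
  by_cases hdu : I.Dense u
  · exact h1 (key u hu v hv huv hdu h0)
  · have hdv : I.Dense v := by
      by_contra hdv; exact huv.2.2.2 ⟨fun h => absurd h hdu, fun h => absurd h hdv⟩
    exact h0 (key v hv u hu huv.symm hdv h1)

theorem flip_of_tied (P : I.IsPartialSolution K h c) {u v : ℕ} (hu : u ∈ K) (hv : v ∈ K)
    (huv : I.Tied u v) (hf : I.Flip h u) : I.Flip h v := by
  have := P.eq_zero_iff_of_tied hu hv huv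
  have h2 := huv.2.2.2
  unfold Flip at *
  tauto

/-- In each class at most one vertex deviates. -/
theorem eq_of_flip (P : I.IsPartialSolution K h c) (hK : ∀ u ∈ K, ¬ I.Core u) {u v : ℕ}
    (hu : u ∈ K) (hv : v ∈ K) (hfu : I.Flip h u) (hfv : I.Flip h v) (hlt : I.label u < I.n)
    (hl : I.label v = I.label u) : u = v := by
  by_contra hne
  by_cases hd : I.Dense u
  · have hdv := hd.of_label_eq hl (hK v hv)
    have h1 : h u = 0 := by
      by_contra h1; exact hfu ⟨fun _ => hd, fun _ => h1⟩
    have h2 : h v = 0 := by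
      by_contra h2; exact hfv ⟨fun _ => hdv, fun _ => h2⟩
    exact P.colouring.indep u hu v hv (hd.adj hl (hK v hv) hne) h1 h2
  · have hdv : ¬ I.Dense v := fun hdv => hd (hdv.of_label_eq hl.symm (hK u hu))
    have h1 : h u ≠ 0 := fun h1 => hfu ⟨fun h => absurd h1 h, fun h => absurd h hd⟩
    have h2 : h v ≠ 0 := fun h2 => hfv ⟨fun h => absurd h2 h, fun h => absurd h hdv⟩
    have heq : h u = h v := by
      rw [P.eq_colour hu h1 hlt, P.eq_colour hv h2 (hl ▸ hlt), hl]
    exact hd ⟨hK u hu, v, (P.colouring.adj_iff u hu v hv hne h1 h2).2 heq, hK v hv, hl.symm, hlt⟩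

/-- At most `2 * k` vertices deviate: at most one in each class, and at most two in each cluster
that does not come from a class, since there is no triangle outside the classes. -/
theorem card_flip_le (P : I.IsPartialSolution K h c) (hK : ∀ u ∈ K, ¬ I.Core u) (S : Finset ℕ)
    (hS : ∀ u ∈ S, u ∈ K ∧ I.Flip h u) : S.card ≤ 2 * I.k := by
  classical
  let κ : ℕ → ℕ := fun u => if I.label u < I.n then c (I.label u) else h u
  have hfree : ∀ u ∈ S, ¬ I.label u < I.n → h u ≠ 0 := fun u hu hl =>
    (hS u hu).2.ne_zero fun hd => hl hd.label_lt
  have hclass : ∀ u ∈ S, ∀ v ∈ S, I.label u < I.n → κ u = κ v → u = v := by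
    intro u hu v hv hl heq
    refine P.eq_of_flip hK (hS u hu).1 (hS v hv).1 (hS u hu).2 (hS v hv).2 hl ?_
    simp only [κ, hl, if_true] at heq
    split_ifs at heq with hlv
    · exact (P.inj _ _ (used_label hl) (used_label hlv) heq).symm
    · exact ((P.eq_iff v (hS v hv).1 _ (used_label hl)).1 heq.symm).2
  have hfib : ∀ a ∈ S.image κ, (S.filter fun x => κ x = a).card ≤ 2 := by
    intro a _
    by_contra hlt
    obtain ⟨x, hx, y, hy, z, hz, hxy, hxz, hyz⟩ := Finset.two_lt_card.1 (not_le.1 hlt)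
    simp only [Finset.mem_filter] at hx hy hz
    have hlx : ¬ I.label x < I.n := fun hl => hxy (hclass x hx.1 y hy.1 hl (hx.2.trans hy.2.symm))
    have hly : ¬ I.label y < I.n := fun hl => hyz (hclass y hy.1 z hz.1 hl (hy.2.trans hz.2.symm))
    have hlz : ¬ I.label z < I.n := fun hl =>
      hyz (hclass z hz.1 y hy.1 hl (hz.2.trans hy.2.symm)).symm
    have hx0 := hfree x hx.1 hlx
    have hy0 := hfree y hy.1 hly
    have hz0 := hfree z hz.1 hlz
    have ex := hx.2
    have ey := hy.2
    have ez := hz.2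
    simp only [κ, hlx, hly, hlz, if_false] at ex ey ez
    have axy := (P.colouring.adj_iff x (hS x hx.1).1 y (hS y hy.1).1 hxy hx0 hy0).2
      (ex.trans ey.symm)
    have axz := (P.colouring.adj_iff x (hS x hx.1).1 z (hS z hz.1).1 hxz hx0 hz0).2
      (ex.trans ez.symm)
    have ayz := (P.colouring.adj_iff y (hS y hy.1).1 z (hS z hz.1).1 hyz hy0 hz0).2
      (ey.trans ez.symm)
    exact hlx (tri_label_lt (fun ho => hx0 (P.outer x (hS x hx.1).1 ho))
      ⟨hK x (hS x hx.1).1, y, z, axy, axz, ayz, Or.inl rfl⟩)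
  have himg : (S.image κ).card ≤ I.k := by
    have : S.image κ ⊆ Finset.Icc 1 I.k := by
      intro a ha
      obtain ⟨u, hu, rfl⟩ := Finset.mem_image.1 ha
      simp only [κ, Finset.mem_Icc]
      split_ifs with hl
      · exact ⟨Nat.one_le_iff_ne_zero.2 (P.pos _ (used_label hl)), P.le _ (used_label hl)⟩
      · exact ⟨Nat.one_le_iff_ne_zero.2 (hfree u hu hl), P.colouring.le u (hS u hu).1⟩
    simpa using Finset.card_le_card this
  calc S.card ≤ 2 * (S.image κ).card := Finset.card_le_mul_card_image S 2 hfib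
    _ ≤ 2 * I.k := Nat.mul_le_mul_left 2 himg

open Classical in
theorem card_used_le (P : I.IsPartialSolution K h c) :
    ((Finset.range I.n).filter I.Used).card ≤ I.k := by
  have : ((Finset.range I.n).filter I.Used).card ≤ (Finset.Icc 1 I.k).card := by
    refine Finset.card_le_card_of_injOn c ?_ ?_
    · intro p hp
      simp only [Finset.coe_filter, Finset.mem_range, Set.mem_ofPred_eq] at hp
      simpa using ⟨Nat.one_le_iff_ne_zero.2 (P.pos _ hp.2), P.le _ hp.2⟩
    · intro p hp q hq hpq
      simp only [Finset.coe_filter, Finset.mem_range, Set.mem_ofPred_eq] at hp hq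
      exact P.inj p q hp.2 hq.2 hpq
  simpa using this

open Classical in
/-- Every clash has an end that deviates, and such an end has at most `k` other clashes with
vertices that do not: two of these would be independent of each other in its neighbourhood. -/
theorem card_clashing_le (P : I.IsPartialSolution {u | ¬ I.Core u} h c) :
    ((Finset.range I.n).filter I.Clashing).card ≤ 2 * I.k * (I.k + 1) := by
  let S := (Finset.range I.n).filter fun u => ¬ I.Core u ∧ I.Flip h u
  let N : ℕ → Finset ℕ := fun u => (Finset.range I.n).filter fun w => I.Clash u w ∧ ¬ I.Flip h w
  have hS : S.card ≤ 2 * I.k := P.card_flip_le (fun u hu => hu) S (by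
    intro u hu
    exact (Finset.mem_filter.1 hu).2)
  have hN : ∀ u ∈ S, (N u).card ≤ I.k := by
    intro u hu
    have hcu : ¬ I.Core u := (Finset.mem_filter.1 hu).2.1
    have hfu : I.Flip h u := (Finset.mem_filter.1 hu).2.2
    refine card_le_of_indep hcu _ (fun x hx => (Finset.mem_filter.1 hx).2.1.1) ?_
    intro x hx y hy hxy
    obtain ⟨-, hx, hfx⟩ := Finset.mem_filter.1 hx
    obtain ⟨-, hy, hfy⟩ := Finset.mem_filter.1 hy
    have hcx := hx.2.2.1
    have hcy := hy.2.2.1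
    by_cases hd : I.Dense u
    · have hdx := hx.2.2.2.1.1 hd
      exact hx.2.2.2.2 ⟨hd, label_eq_of_tri hd.not_outer hdx.not_outer hcx
        ⟨hcu, x, y, hx.1, hy.1, hxy, Or.inr rfl⟩⟩
    · have hdx : ¬ I.Dense x := fun h => hd (hx.2.2.2.1.2 h)
      have hdy : ¬ I.Dense y := fun h => hd (hy.2.2.2.1.2 h)
      simp only [Flip, hdx, hdy, iff_false, not_not] at hfx hfy
      exact P.colouring.indep x hcx y hcy hxy hfx hfy
  have hsub : (Finset.range I.n).filter I.Clashing ⊆ S ∪ S.biUnion N := by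
    intro u hu
    obtain ⟨hun, v, hv⟩ := Finset.mem_filter.1 hu
    by_cases hf : I.Flip h u
    · exact Finset.mem_union_left _ (Finset.mem_filter.2 ⟨hun, hv.2.1, hf⟩)
    · refine Finset.mem_union_right _ (Finset.mem_biUnion.2 ⟨v, ?_, ?_⟩)
      · exact Finset.mem_filter.2 ⟨Finset.mem_range.2 (I.lt_of_adj' hv.1), hv.2.2.1,
          (P.flip_of_clash hv.2.1 hv.2.2.1 hv).resolve_left hf⟩
      · exact Finset.mem_filter.2 ⟨hun, hv.symm, hf⟩
  calc _ ≤ (S ∪ S.biUnion N).card := Finset.card_le_card hsub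
    _ ≤ S.card + (S.biUnion N).card := Finset.card_union_le _ _
    _ ≤ S.card + S.card * I.k := by
        gcongr
        exact Finset.card_biUnion_le_card_mul _ _ _ hN
    _ = S.card * (I.k + 1) := by ring
    _ ≤ 2 * I.k * (I.k + 1) := Nat.mul_le_mul_right _ hS

end IsPartialSolution

/-- Solutions of a consistent instance correspond to solutions outside the core. -/
theorem exists_colouring_iff (hI : I.Consistent) :
    (∃ f, IsClusterColouring I.G I.k Set.univ f) ↔
      ∃ h c, I.IsPartialSolution {u | ¬ I.Core u} h c := by
  classical
  constructor
  · rintro ⟨f, hf⟩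
    have hex : ∀ p, ∃ c, I.Used p → c ≠ 0 ∧ c ≤ I.k ∧ ∀ u, f u = c ↔ f u ≠ 0 ∧ I.label u = p := by
      intro p
      by_cases hp : I.Used p
      · obtain ⟨c, hc⟩ := exists_class_colour hI hf hp
        exact ⟨c, fun _ => hc⟩
      · exact ⟨0, fun h => absurd h hp⟩
    choose c hc using hex
    refine ⟨f, c, hf.mono (Set.subset_univ _), fun p hp => (hc p hp).1, fun p hp => (hc p hp).2.1,
      ?_, fun u _ p hp => (hc p hp).2.2 u, fun u _ hu => hu.eq_zero hf⟩
    intro p q hp hq hpq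
    by_contra hne
    -- the colour of a class occurs: its cluster contains a vertex
    have hocc : ∃ u, f u = c p := by
      have hp' := hp
      obtain ⟨hpn, u, hu⟩ := hp'
      have hC : I.Cand u p := by
        have := cand_label (I := I) (u := u) (by omega)
        rwa [hu] at this
      rcases hC with ⟨ho, ⟨-, hatt⟩ | ⟨hna, htri, hop⟩⟩
      · refine ⟨p, ((hc p hp).2.2 p).2 ⟨hatt.1.ne_zero hf, ?_⟩⟩
        exact (label_eq_of_att ho (hI p hatt.1) hatt ⟨hatt.1, Or.inl rfl⟩).symm.trans hu
      · by_cases h0 : f u = 0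
        · obtain ⟨hcu, y, z, hy, hz, hyz, -⟩ := htri
          have hy0 := hf.indep u trivial y trivial hy h0
          have hT : I.Tri u y := ⟨hcu, y, z, hy, hz, hyz, Or.inr rfl⟩
          exact ⟨y, ((hc p hp).2.2 y).2 ⟨hy0, (label_eq_of_tri ho
            (fun h => hy0 (h.eq_zero hf)) (not_core_of_not_att hna hT) hT).symm.trans hu⟩⟩
        · exact ⟨u, ((hc p hp).2.2 u).2 ⟨h0, hu⟩⟩
    obtain ⟨u, hu⟩ := hocc
    exact hne ((((hc p hp).2.2 u).1 hu).2.symm.trans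
      (((hc q hq).2.2 u).1 (hu.trans hpq)).2)
  · rintro ⟨h, c, P⟩
    have hcl : ∀ a, I.Core a → I.Used (I.label a) := fun a ha => used_label (core_label_lt hI ha)
    -- a core vertex takes the colour of its class
    have hmix : ∀ a u, I.Core a → ¬ I.Core u → h u ≠ 0 →
        (I.G.Adj u a ↔ h u = c (I.label a)) := by
      intro a u ha hu h0
      have hne : u ≠ a := by rintro rfl; exact hu ha
      rw [label_eq_iff_of_core hI ha (fun ho => h0 (P.outer u hu ho)) hne,
        P.eq_iff u hu _ (hcl a ha)]
      simp [h0]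
    refine ⟨fun u => if I.Core u then c (I.label u) else h u, ?_, ?_, ?_⟩
    · intro u _
      by_cases hu : I.Core u
      · simpa [hu] using P.le _ (hcl u hu)
      · simpa [hu] using P.colouring.le u hu
    · intro u _ v _ huv h0
      by_cases hv : I.Core v
      · simpa [hv] using P.pos _ (hcl v hv)
      · by_cases hu : I.Core u
        · simp only [hu, if_true] at h0
          exact absurd h0 (P.pos _ (hcl u hu))
        · simp only [hu, if_false] at h0
          simpa [hv] using P.colouring.indep u hu v hv huv h0
    · intro u _ v _ hne hu0 hv0
      by_cases hu : I.Core u <;> by_cases hv : I.Core v <;>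
        simp only [hu, hv, if_true, if_false] at hu0 hv0 ⊢
      · rw [label_eq_iff_of_core hI hv (hI u hu) hne]
        exact ⟨fun h => by rw [h], fun h => P.inj _ _ (hcl u hu) (hcl v hv) h⟩
      · rw [I.G.adj_comm, hmix u v hu hv hv0, eq_comm]
      · exact hmix v u hv hu hu0
      · exact P.colouring.adj_iff u hu v hv hne hu0 hv0

/-! ### Extending a partial solution by the defaults -/

variable (I) in
/-- `S` is connected through tied edges, contains `w`, and either is closed under tied edges or has
`2 * k + 1` elements, too many for all of them to deviate. -/
structure IsTiedPart (w : ℕ) (S : Finset ℕ) : Prop where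
  mem : w ∈ S
  connected : ∀ P : ℕ → Prop, P w → (∀ x ∈ S, ∀ y ∈ S, I.Tied x y → P x → P y) → ∀ v ∈ S, P v
  card_le : S.card ≤ 2 * I.k + 1
  closed : S.card = 2 * I.k + 1 ∨ ∀ x ∈ S, ∀ y, I.Tied x y → y ∈ S

variable (I) in
/-- The vertices kept, given a tied part for each end of a clash. -/
def kept (S : ℕ → Finset ℕ) : Set ℕ := {v | ∃ w, I.Clashing w ∧ v ∈ S w}

theorem not_core_of_mem_kept {S : ℕ → Finset ℕ} (hS : ∀ w, I.Clashing w → I.IsTiedPart w (S w))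
    {v : ℕ} (hv : v ∈ I.kept S) : ¬ I.Core v := by
  obtain ⟨w, hw, hvw⟩ := hv
  exact (hS w hw).connected (fun x => ¬ I.Core x) hw.choose_spec.2.1
    (fun x _ y _ hxy _ => hxy.2.2.1) v hvw

/-- All solutions that agree on the clashing vertices can be made to agree with the default
elsewhere: a deviation matters only where it is tied to a clashing vertex, and then the whole
tied part of that vertex deviates, hence is small and therefore closed. -/
theorem IsPartialSolution.extend {S : ℕ → Finset ℕ}
    (hS : ∀ w, I.Clashing w → I.IsTiedPart w (S w)) {h c : ℕ → ℕ}
    (P : I.IsPartialSolution (I.kept S) h c) :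
    ∃ f, I.IsPartialSolution {u | ¬ I.Core u} f c := by
  classical
  have hK : ∀ u ∈ I.kept S, ¬ I.Core u := fun u => not_core_of_mem_kept hS
  have hW : ∀ w, I.Clashing w → w ∈ I.kept S := fun w hw => ⟨w, hw, (hS w hw).mem⟩
  have hxor : ∀ {a b c : Prop}, ¬ (a ↔ b) → ((a ↔ c) ↔ ¬ (b ↔ c)) := by tauto
  let Φ : ℕ → Prop := fun u => ∃ w, I.Clashing w ∧ u ∈ S w ∧ I.Flip h w
  have hflipS : ∀ w, I.Clashing w → I.Flip h w → ∀ v ∈ S w, I.Flip h v := fun w hw hf =>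
    (hS w hw).connected (I.Flip h) hf fun x hx y hy hxy hfx =>
      P.flip_of_tied ⟨w, hw, hx⟩ ⟨w, hw, hy⟩ hxy hfx
  have hΦK : ∀ u, Φ u → u ∈ I.kept S := fun u ⟨w, hw, hu, _⟩ => ⟨w, hw, hu⟩
  have hΦF : ∀ u, Φ u → I.Flip h u := fun u ⟨w, hw, hu, hf⟩ => hflipS w hw hf u hu
  have hΦT : ∀ u v, I.Tied u v → Φ u → Φ v := by
    rintro u v huv ⟨w, hw, hu, hf⟩
    refine ⟨w, hw, ?_, hf⟩
    rcases (hS w hw).closed with h1 | h1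
    · have := P.card_flip_le hK (S w) fun x hx => ⟨⟨w, hw, hx⟩, hflipS w hw hf x hx⟩
      omega
    · exact h1 u hu v huv
  have hΦW : ∀ w, I.Clashing w → (Φ w ↔ I.Flip h w) := fun w hw =>
    ⟨hΦF w, fun hf => ⟨w, hw, (hS w hw).mem, hf⟩⟩
  let f : ℕ → ℕ := fun u => if (I.Dense u ↔ Φ u) then 0 else
    if I.label u < I.n then c (I.label u) else h u
  have hf0 : ∀ u, f u ≠ 0 ↔ ¬ (I.Dense u ↔ Φ u) := by
    intro u
    simp only [f]
    split_ifs with h1 h2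
    · simp [h1]
    · simpa [h1] using P.pos _ (used_label h2)
    · have hd : ¬ I.Dense u := fun hd => h2 hd.label_lt
      have hΦ : Φ u := by
        by_contra hΦ; exact h1 ⟨fun h => absurd h hd, fun h => absurd h hΦ⟩
      simpa [h1] using (hΦF u hΦ).ne_zero hd
  have hfc : ∀ u, f u ≠ 0 → I.label u < I.n → f u = c (I.label u) := by
    intro u h0 hl
    have := (hf0 u).1 h0
    simp [f, this, hl]
  have hff : ∀ u, f u ≠ 0 → ¬ I.label u < I.n → f u = h u ∧ Φ u := by
    intro u h0 hl
    have h1 := (hf0 u).1 h0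
    refine ⟨by simp [f, h1, hl], ?_⟩
    by_contra hΦ
    exact h1 ⟨fun hd => absurd hd.label_lt hl, fun h => absurd h hΦ⟩
  -- on vertices where the two deviate alike, `f` is `h`
  have hagree : ∀ u ∈ I.kept S, (Φ u ↔ I.Flip h u) → f u = h u := by
    intro u hu hiff
    have hzero : f u ≠ 0 ↔ h u ≠ 0 := by
      rw [hf0, hiff, Flip]
      tauto
    by_cases h0 : f u = 0
    · rw [h0]
      by_contra h1
      exact hzero.2 (Ne.symm h1) h0
    · by_cases hl : I.label u < I.n
      · rw [hfc u h0 hl, P.eq_colour hu (hzero.1 h0) hl]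
      · exact (hff u h0 hl).1
  have hagW : ∀ w, I.Clashing w → f w = h w := fun w hw => hagree w (hW w hw) (hΦW w hw)
  have hagΦ : ∀ u, Φ u → f u = h u := fun u hu =>
    hagree u (hΦK u hu) ⟨fun _ => hΦF u hu, fun _ => hu⟩
  have hfle : ∀ u, f u ≤ I.k := by
    intro u
    by_cases h0 : f u = 0
    · omega
    by_cases hl : I.label u < I.n
    · rw [hfc u h0 hl]; exact P.le _ (used_label hl)
    · rw [(hff u h0 hl).1]; exact P.colouring.le u (hΦK u (hff u h0 hl).2)
  have heqlab : ∀ u v, f u ≠ 0 → f v ≠ 0 → I.label u < I.n → f u = f v →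
      I.label v = I.label u := by
    intro u v hu hv hl heq
    rw [hfc u hu hl] at heq
    by_cases hlv : I.label v < I.n
    · rw [hfc v hv hlv] at heq
      exact (P.inj _ _ (used_label hl) (used_label hlv) heq).symm
    · obtain ⟨h1, h2⟩ := hff v hv hlv
      rw [h1] at heq
      exact ((P.eq_iff v (hΦK v h2) _ (used_label hl)).1 heq.symm).2
  have hnd : ∀ u, f u ≠ 0 → ¬ I.Dense u → Φ u := by
    intro u h0 hd
    by_contra hΦ
    exact (hf0 u).1 h0 ⟨fun h => absurd h hd, fun h => absurd h hΦ⟩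
  have hcases : ∀ u v, I.G.Adj u v → ¬ I.Core u → ¬ I.Core v →
      I.Tied u v ∨ (I.Clashing u ∧ I.Clashing v) ∨
        (I.Dense u ∧ I.Dense v ∧ I.label v = I.label u) := by
    intro u v huv hu hv
    by_cases h1 : I.Dense u ↔ I.Dense v
    · by_cases h2 : I.Dense u ∧ I.label u = I.label v
      · exact Or.inr (Or.inr ⟨h2.1, h1.1 h2.1, h2.2.symm⟩)
      · have : I.Clash u v := ⟨huv, hu, hv, h1, h2⟩
        exact Or.inr (Or.inl ⟨⟨v, this⟩, ⟨u, this.symm⟩⟩)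
    · exact Or.inl ⟨huv, hu, hv, h1⟩
  have htied : ∀ u v, I.Tied u v → (f u = 0 ↔ f v ≠ 0) := by
    intro u v huv
    have h1 : f u = 0 ↔ (I.Dense u ↔ Φ u) := not_iff_not.1 (hf0 u)
    have h3 : Φ u ↔ Φ v := ⟨hΦT u v huv, hΦT v u huv.symm⟩
    rw [h1, hf0 v, h3]
    exact hxor huv.2.2.2
  refine ⟨f, ⟨fun u _ => hfle u, ?_, ?_⟩, P.pos, P.le, P.inj, ?_, ?_⟩
  · intro u hu v hv huv h0
    rcases hcases u v huv hu hv with h1 | ⟨h1, h2⟩ | ⟨h1, h2, h3⟩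
    · exact (htied u v h1).1 h0
    · rw [hagW u h1] at h0
      rw [hagW v h2]
      exact P.colouring.indep u (hW u h1) v (hW v h2) huv h0
    · intro h0'
      have hΦu : Φ u := by
        by_contra hΦ; exact (hf0 u).2 (fun h => hΦ (h.1 h1)) h0
      have hΦv : Φ v := by
        by_contra hΦ; exact (hf0 v).2 (fun h => hΦ (h.1 h2)) h0'
      rw [hagΦ u hΦu] at h0
      rw [hagΦ v hΦv] at h0'
      exact P.colouring.indep u (hΦK u hΦu) v (hΦK v hΦv) huv h0 h0'
  · intro u hu v hv hne hu0 hv0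
    constructor
    · intro huv
      rcases hcases u v huv hu hv with h1 | ⟨h1, h2⟩ | ⟨h1, h2, h3⟩
      · exact absurd ((htied u v h1).2 hv0) hu0
      · rw [hagW u h1] at hu0 ⊢
        rw [hagW v h2] at hv0 ⊢
        exact (P.colouring.adj_iff u (hW u h1) v (hW v h2) hne hu0 hv0).1 huv
      · rw [hfc u hu0 h1.label_lt, hfc v hv0 h2.label_lt, h3]
    · intro heq
      by_cases hdu : I.Dense u
      · exact hdu.adj (heqlab u v hu0 hv0 hdu.label_lt heq) hv hne
      by_cases hdv : I.Dense v
      · exact (hdv.adj (heqlab v u hv0 hu0 hdv.label_lt heq.symm) hu hne.symm).symm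
      have hΦu := hnd u hu0 hdu
      have hΦv := hnd v hv0 hdv
      rw [hagΦ u hΦu] at hu0 heq
      rw [hagΦ v hΦv] at hv0 heq
      exact (P.colouring.adj_iff u (hΦK u hΦu) v (hΦK v hΦv) hne hu0 hv0).2 heq
  · intro u _ p hp
    constructor
    · intro heq
      have h0 : f u ≠ 0 := by rw [heq]; exact P.pos p hp
      refine ⟨h0, ?_⟩
      by_cases hl : I.label u < I.n
      · rw [hfc u h0 hl] at heq
        exact P.inj _ _ (used_label hl) hp heq
      · obtain ⟨h1, h2⟩ := hff u h0 hl
        rw [h1] at heq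
        exact ((P.eq_iff u (hΦK u h2) p hp).1 heq).2
    · rintro ⟨h0, rfl⟩
      exact hfc u h0 hp.1
  · intro u _ ho
    by_contra h0
    have hd : ¬ I.Dense u := fun hd => hd.not_outer ho
    have hΦ := hnd u h0 hd
    rw [hagΦ u hΦ] at h0
    exact h0 (P.outer u (hΦK u hΦ) ho)

end Instance

/-! ### The kernel graph -/

namespace Instance

variable (I : Instance)

/-- The edges of the kernel, from a smaller to a larger vertex. A vertex is a pair `(t, i)`: with
`t = 0`, a vertex `i` of the instance; with `t = 1, 2, 3, 4`, a vertex of a gadget for the class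
`i`, a complete graph on four vertices without the edge between those with `t = 3` and `t = 4`.
In every solution its vertices with `t = 1` and `t = 2` are in the same cluster. The class is
joined to both, which ties its members to that cluster, and outer vertices are joined to the first
only, which bars them from the cluster side. -/
def KernelRel (a b : ℕ × ℕ) : Prop :=
  (a.1 = 0 ∧ b.1 = 0 ∧ I.G.Adj a.2 b.2) ∨
    (a.1 = 0 ∧ b.1 = 1 ∧ (I.label a.2 = b.2 ∨ I.Outer a.2)) ∨
    (a.1 = 0 ∧ b.1 = 2 ∧ I.label a.2 = b.2) ∨
    (1 ≤ a.1 ∧ a.1 ≤ 2 ∧ a.1 < b.1 ∧ b.1 ≤ 4 ∧ a.2 = b.2)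

/-- The kernel before removal of the vertices that are not selected. -/
def kernelGraph : SimpleGraph (ℕ × ℕ) := SimpleGraph.fromRel I.KernelRel

/-- The vertices of the kernel: the set `K` and the gadgets of the nonempty classes. -/
def Selected (K : Set ℕ) : Set (ℕ × ℕ) :=
  {a | (a.1 = 0 ∧ a.2 ∈ K) ∨ (1 ≤ a.1 ∧ a.1 ≤ 4 ∧ I.Used a.2)}

variable {I}

theorem kernelGraph_adj_orig {u v : ℕ} : I.kernelGraph.Adj (0, u) (0, v) ↔ I.G.Adj u v := by
  simp only [kernelGraph, SimpleGraph.fromRel_adj, KernelRel]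
  constructor
  · rintro ⟨-, h | h⟩
    · simpa using h
    · simpa [I.G.adj_comm] using h
  · intro h
    exact ⟨by simpa using h.ne, Or.inl (Or.inl ⟨trivial, trivial, h⟩)⟩

theorem kernelGraph_adj_hub {u p : ℕ} :
    I.kernelGraph.Adj (0, u) (1, p) ↔ I.label u = p ∨ I.Outer u := by
  simp [kernelGraph, SimpleGraph.fromRel_adj, KernelRel]

theorem kernelGraph_adj_twin {u p : ℕ} : I.kernelGraph.Adj (0, u) (2, p) ↔ I.label u = p := by
  simp [kernelGraph, SimpleGraph.fromRel_adj, KernelRel]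

theorem kernelGraph_adj_wing {u p t : ℕ} (ht : 3 ≤ t) : ¬ I.kernelGraph.Adj (0, u) (t, p) := by
  simp only [kernelGraph, SimpleGraph.fromRel_adj, KernelRel]
  omega

theorem kernelGraph_adj_gadget {s t p q : ℕ} (hs : 1 ≤ s) (ht : 1 ≤ t) :
    I.kernelGraph.Adj (s, p) (t, q) ↔
      p = q ∧ s ≠ t ∧ s ≤ 4 ∧ t ≤ 4 ∧ ¬ (3 ≤ s ∧ 3 ≤ t) := by
  simp only [kernelGraph, SimpleGraph.fromRel_adj, KernelRel, ne_eq, Prod.mk.injEq]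
  omega

/-- Solutions of the kernel correspond to partial solutions on its original vertices. -/
theorem exists_colouring_kernelGraph_iff {K : Set ℕ}
    (hout : ∀ u, I.Outer u → ∃ p, I.Used p) :
    (∃ g, IsClusterColouring I.kernelGraph I.k (I.Selected K) g) ↔
      ∃ h c, I.IsPartialSolution K h c := by
  constructor
  · rintro ⟨g, hg⟩
    have hsel : ∀ p, I.Used p → ∀ t, 1 ≤ t → t ≤ 4 → (t, p) ∈ I.Selected K :=
      fun p hp t h1 h4 => Or.inr ⟨h1, h4, hp⟩
    have hselK : ∀ u ∈ K, (0, u) ∈ I.Selected K := fun u hu => Or.inl ⟨rfl, hu⟩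
    -- the ends of the chord of a gadget cannot be independent
    have hchord : ∀ p, I.Used p → ∀ s t, 1 ≤ s → s ≤ 2 → 1 ≤ t → t ≤ 2 → s ≠ t →
        g (s, p) ≠ 0 := by
      intro p hp s t hs1 hs2 ht1 ht2 hst h0
      have hadj : ∀ a b, 1 ≤ a → 1 ≤ b → a ≠ b → a ≤ 4 → b ≤ 4 → ¬ (3 ≤ a ∧ 3 ≤ b) →
          I.kernelGraph.Adj (a, p) (b, p) := fun a b h1 h2 h3 h4 h5 h6 =>
        (kernelGraph_adj_gadget h1 h2).2 ⟨rfl, h3, h4, h5, h6⟩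
      have hne : ∀ b, 1 ≤ b → b ≤ 4 → s ≠ b → g (b, p) ≠ 0 := fun b h1 h4 hb =>
        hg.indep _ (hsel p hp s hs1 (by omega)) _ (hsel p hp b h1 h4)
          (hadj s b hs1 h1 hb (by omega) h4 (by omega)) h0
      have heq : ∀ b, 3 ≤ b → b ≤ 4 → g (t, p) = g (b, p) := fun b h3 h4 =>
        (hg.adj_iff _ (hsel p hp t ht1 (by omega)) _ (hsel p hp b (by omega) h4)
          (by simp; omega) (hne t ht1 (by omega) hst) (hne b (by omega) h4 (by omega))).1
          (hadj t b ht1 (by omega) (by omega) (by omega) h4 (by omega))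
      have h34 := (hg.adj_iff _ (hsel p hp 3 (by omega) (by omega)) _
        (hsel p hp 4 (by omega) (by omega)) (by simp) (hne 3 (by omega) (by omega) (by omega))
        (hne 4 (by omega) (by omega) (by omega))).2
        ((heq 3 (by omega) (by omega)).symm.trans (heq 4 (by omega) (by omega)))
      have := ((kernelGraph_adj_gadget (by omega) (by omega)).1 h34).2.2.2.2
      omega
    have h1 : ∀ p, I.Used p → g (1, p) ≠ 0 := fun p hp =>
      hchord p hp 1 2 (by omega) (by omega) (by omega) (by omega) (by omega)
    have h2 : ∀ p, I.Used p → g (2, p) ≠ 0 := fun p hp =>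
      hchord p hp 2 1 (by omega) (by omega) (by omega) (by omega) (by omega)
    have h12 : ∀ p, I.Used p → g (1, p) = g (2, p) := fun p hp =>
      (hg.adj_iff _ (hsel p hp 1 (by omega) (by omega)) _ (hsel p hp 2 (by omega) (by omega))
        (by simp) (h1 p hp) (h2 p hp)).1
        ((kernelGraph_adj_gadget (by omega) (by omega)).2 ⟨rfl, by omega⟩)
    have htwin : ∀ u ∈ K, ∀ p, I.Used p → g (0, u) = g (1, p) → I.label u = p := by
      intro u hu p hp h
      refine kernelGraph_adj_twin.1 ((hg.adj_iff _ (hselK u hu) _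
        (hsel p hp 2 (by omega) (by omega)) (by simp) ?_ (h2 p hp)).2 (h.trans (h12 p hp)))
      rw [h]; exact h1 p hp
    have hhub : ∀ u ∈ K, ∀ p, I.Used p → g (0, u) ≠ 0 → (I.label u = p ∨ I.Outer u) →
        g (0, u) = g (1, p) := fun u hu p hp h0 h =>
      (hg.adj_iff _ (hselK u hu) _ (hsel p hp 1 (by omega) (by omega)) (by simp) h0
        (h1 p hp)).1 (kernelGraph_adj_hub.2 h)
    refine ⟨fun u => g (0, u), fun p => g (1, p), ⟨fun u hu => hg.le _ (hselK u hu), ?_, ?_⟩,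
      h1, fun p hp => hg.le _ (hsel p hp 1 (by omega) (by omega)), ?_, ?_, ?_⟩
    · intro u hu v hv huv
      exact hg.indep _ (hselK u hu) _ (hselK v hv) (kernelGraph_adj_orig.2 huv)
    · intro u hu v hv hne hu0 hv0
      rw [← kernelGraph_adj_orig]
      exact hg.adj_iff _ (hselK u hu) _ (hselK v hv) (by simpa using hne) hu0 hv0
    · intro p q hp hq hpq
      by_contra hne
      have := (hg.adj_iff _ (hsel p hp 1 (by omega) (by omega)) _
        (hsel q hq 1 (by omega) (by omega)) (by simpa using hne) (h1 p hp) (h1 q hq)).2 hpq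
      exact hne ((kernelGraph_adj_gadget (by omega) (by omega)).1 this).1
    · intro u hu p hp
      constructor
      · intro h
        exact ⟨by rw [h]; exact h1 p hp, htwin u hu p hp h⟩
      · rintro ⟨h0, hl⟩
        exact hhub u hu p hp h0 (Or.inl hl)
    · intro u hu ho
      by_contra h0
      obtain ⟨p, hp⟩ := hout u ho
      have := htwin u hu p hp (hhub u hu p hp h0 (Or.inr ho))
      exact not_outer_of_label_lt (this.trans_lt hp.1) ho
  · rintro ⟨h, c, P⟩
    let g : ℕ × ℕ → ℕ := fun a => if a.1 = 0 then h a.2 else if a.1 ≤ 2 then c a.2 else 0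
    have g0 : ∀ u, g (0, u) = h u := fun u => by simp [g]
    have g1 : ∀ t p, 1 ≤ t → t ≤ 2 → g (t, p) = c p := fun t p h1 h2 => by
      have : t ≠ 0 := by omega
      simp [g, this, h2]
    have g3 : ∀ t p, 3 ≤ t → g (t, p) = 0 := fun t p h3 => by
      have h1 : t ≠ 0 := by omega
      have h2 : ¬ t ≤ 2 := by omega
      simp [g, h1, h2]
    have hgt : ∀ t p, 1 ≤ t → g (t, p) ≠ 0 → t ≤ 2 := fun t p h1 h0 => by
      by_contra h2
      exact h0 (g3 t p (by omega))
    -- members of a class on the cluster side have the colour of its gadget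
    have hmix : ∀ u ∈ K, ∀ t p, I.Used p → 1 ≤ t → t ≤ 2 → h u ≠ 0 →
        (I.kernelGraph.Adj (0, u) (t, p) ↔ h u = c p) := by
      intro u hu t p hp ht1 ht2 h0
      have ho : ¬ I.Outer u := fun ho => h0 (P.outer u hu ho)
      rw [P.eq_iff u hu p hp]
      have : t = 1 ∨ t = 2 := by omega
      rcases this with rfl | rfl
      · rw [kernelGraph_adj_hub]; simp [ho, h0]
      · rw [kernelGraph_adj_twin]; simp [h0]
    refine ⟨g, ?_, ?_, ?_⟩
    · rintro ⟨t, i⟩ (⟨h0, hi⟩ | ⟨h1, h4, hp⟩)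
      · simp only at h0 hi; subst h0
        rw [g0]; exact P.colouring.le i hi
      · simp only at h1 h4 hp
        by_cases h2 : t ≤ 2
        · rw [g1 t i h1 h2]; exact P.le i hp
        · rw [g3 t i (by omega)]; omega
    · rintro ⟨s, i⟩ hs ⟨t, j⟩ ht hadj h0
      rcases hs with ⟨rfl, hi⟩ | ⟨hs1, hs4, hp⟩ <;> rcases ht with ⟨rfl, hj⟩ | ⟨ht1, ht4, hq⟩ <;>
        simp only at *
      · rw [g0] at h0 ⊢
        exact P.colouring.indep i hi j hj (kernelGraph_adj_orig.1 hadj) h0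
      · by_cases h2 : t ≤ 2
        · rw [g1 t j ht1 h2]; exact P.pos j hq
        · exact absurd hadj (kernelGraph_adj_wing (by omega))
      · by_cases h2 : s ≤ 2
        · rw [g1 s i hs1 h2] at h0; exact absurd h0 (P.pos i hp)
        · exact absurd hadj.symm (kernelGraph_adj_wing (by omega))
      · have := (kernelGraph_adj_gadget hs1 ht1).1 hadj
        by_cases h2 : t ≤ 2
        · rw [g1 t j ht1 h2]; exact P.pos j hq
        · rw [g1 s i hs1 (by omega)] at h0; exact absurd h0 (P.pos i hp)
    · rintro ⟨s, i⟩ hs ⟨t, j⟩ ht hne hs0 ht0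
      rcases hs with ⟨rfl, hi⟩ | ⟨hs1, hs4, hp⟩ <;> rcases ht with ⟨rfl, hj⟩ | ⟨ht1, ht4, hq⟩ <;>
        simp only at *
      · rw [g0] at hs0 ht0 ⊢
        rw [g0, kernelGraph_adj_orig]
        exact P.colouring.adj_iff i hi j hj (by rintro rfl; exact hne rfl) hs0 ht0
      · have h2 := hgt t j ht1 ht0
        rw [g0] at hs0 ⊢
        rw [g1 t j ht1 h2]
        exact hmix i hi t j hq ht1 h2 hs0
      · have h2 := hgt s i hs1 hs0
        rw [g0] at ht0 ⊢
        rw [g1 s i hs1 h2, SimpleGraph.adj_comm, hmix j hj s i hp hs1 h2 ht0, eq_comm]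
      · have h2 := hgt s i hs1 hs0
        have h2' := hgt t j ht1 ht0
        rw [g1 s i hs1 h2, g1 t j ht1 h2', kernelGraph_adj_gadget hs1 ht1]
        constructor
        · rintro ⟨rfl, -⟩; rfl
        · intro heq
          have hij := P.inj i j hp hq heq
          subst hij
          refine ⟨rfl, ?_, hs4, ht4, by omega⟩
          rintro rfl
          exact hne rfl

/-- The kernel is equivalent to the instance. -/
theorem exists_colouring_iff_kernelGraph (hI : I.Consistent)
    (hout : ∀ u, I.Outer u → ∃ p, I.Used p) {S : ℕ → Finset ℕ}
    (hS : ∀ w, I.Clashing w → I.IsTiedPart w (S w)) :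
    (∃ f, IsClusterColouring I.G I.k Set.univ f) ↔
      ∃ g, IsClusterColouring I.kernelGraph I.k (I.Selected (I.kept S)) g := by
  rw [exists_colouring_iff hI, exists_colouring_kernelGraph_iff hout]
  constructor
  · rintro ⟨h, c, P⟩
    exact ⟨h, c, P.mono fun u hu => not_core_of_mem_kept hS hu⟩
  · rintro ⟨h, c, P⟩
    obtain ⟨f, hf⟩ := P.extend hS
    exact ⟨f, c, hf⟩

end Instance

/-! ### Loop programs -/

namespace WordRAM

namespace Expr

/-- An exponent `d` such that all values that occur in the evaluation are at most `B ^ d`, if all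
registers and array cells hold values at most `B`. -/
def deg : Expr → ℕ
  | const c => c
  | var _ => 1
  | get _ i => i.deg + 1
  | add e f => e.deg + f.deg + 1
  | sub e f => e.deg + f.deg + 1
  | mul e f => e.deg + f.deg + 1

/-- The expression does not read array `a`. -/
def NoRead (a : ℕ) : Expr → Prop
  | const _ => True
  | var _ => True
  | get b i => b ≠ a ∧ i.NoRead a
  | add e f => e.NoRead a ∧ f.NoRead a
  | sub e f => e.NoRead a ∧ f.NoRead a
  | mul e f => e.NoRead a ∧ f.NoRead a

/-- Expressions whose value never exceeds `2` or a value already stored. -/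
def Atomic : Expr → Prop
  | const c => c ≤ 2
  | var _ => True
  | get _ _ => True
  | _ => False

/-- Expressions whose value exceeds the values already stored by at most one. -/
def Slow : Expr → Prop
  | add e (const 1) => e.Atomic
  | e => e.Atomic

end Expr

/-- All registers and all array cells hold values at most `B`. -/
def State.BoundedBy (B : ℕ) (s : State) : Prop := (∀ x, s.var x ≤ B) ∧ ∀ a i, s.arr a i ≤ B

theorem State.BoundedBy.mono {B B' : ℕ} {s : State} (h : s.BoundedBy B) (hB : B ≤ B') :
    s.BoundedBy B' := ⟨fun x => (h.1 x).trans hB, fun a i => (h.2 a i).trans hB⟩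

theorem Expr.fits_and_le {B W : ℕ} {s : State} (hs : s.BoundedBy B) (hB : 2 ≤ B) (e : Expr)
    (hW : B ^ e.deg ≤ W) : e.Fits W s ∧ e.eval s ≤ B ^ e.deg := by
  have hone : ∀ d, 1 ≤ B ^ d := fun d => Nat.one_le_pow _ _ (by omega)
  induction e with
  | const c =>
    have : c ≤ B ^ c := (Nat.lt_two_pow_self).le.trans (Nat.pow_le_pow_left hB c)
    exact ⟨this.trans hW, this⟩
  | var x =>
    have : s.var x ≤ B ^ 1 := by simpa using hs.1 x
    exact ⟨this.trans hW, this⟩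
  | get a i ih =>
    simp only [deg, pow_succ] at hW ⊢
    have h1 : B ^ i.deg ≤ W := le_trans (Nat.le_mul_of_pos_right _ (by omega)) hW
    have h2 : s.arr a (i.eval s) ≤ B ^ i.deg * B :=
      (hs.2 _ _).trans (Nat.le_mul_of_pos_left _ (hone _))
    exact ⟨⟨(ih h1).1, h2.trans hW⟩, h2⟩
  | add e f ihe ihf =>
    simp only [deg, pow_succ, pow_add] at hW ⊢
    have h1 := hone e.deg
    have h2 := hone f.deg
    have h3 : B ^ e.deg * B ^ f.deg ≤ W := le_trans (Nat.le_mul_of_pos_right _ (by omega)) hW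
    obtain ⟨he, he'⟩ := ihe (le_trans (Nat.le_mul_of_pos_right _ h2) h3)
    obtain ⟨hf, hf'⟩ := ihf (le_trans (Nat.le_mul_of_pos_left _ h1) h3)
    have h4 : e.eval s + f.eval s ≤ B ^ e.deg * B ^ f.deg * B :=
      calc e.eval s + f.eval s ≤ B ^ e.deg + B ^ f.deg := Nat.add_le_add he' hf'
        _ ≤ B ^ e.deg * B ^ f.deg * 2 := by nlinarith
        _ ≤ _ := Nat.mul_le_mul_left _ hB
    exact ⟨⟨he, hf, h4.trans hW⟩, h4⟩
  | sub e f ihe ihf =>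
    simp only [deg, pow_succ, pow_add] at hW ⊢
    have h1 := hone e.deg
    have h2 := hone f.deg
    have h3 : B ^ e.deg * B ^ f.deg ≤ W := le_trans (Nat.le_mul_of_pos_right _ (by omega)) hW
    obtain ⟨he, he'⟩ := ihe (le_trans (Nat.le_mul_of_pos_right _ h2) h3)
    obtain ⟨hf, hf'⟩ := ihf (le_trans (Nat.le_mul_of_pos_left _ h1) h3)
    refine ⟨⟨he, hf⟩, ?_⟩
    calc e.eval s - f.eval s ≤ B ^ e.deg := (Nat.sub_le _ _).trans he'
      _ ≤ B ^ e.deg * B ^ f.deg := Nat.le_mul_of_pos_right _ h2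
      _ ≤ _ := Nat.le_mul_of_pos_right _ (by omega)
  | mul e f ihe ihf =>
    simp only [deg, pow_succ, pow_add] at hW ⊢
    have h1 := hone e.deg
    have h2 := hone f.deg
    have h3 : B ^ e.deg * B ^ f.deg ≤ W := le_trans (Nat.le_mul_of_pos_right _ (by omega)) hW
    obtain ⟨he, he'⟩ := ihe (le_trans (Nat.le_mul_of_pos_right _ h2) h3)
    obtain ⟨hf, hf'⟩ := ihf (le_trans (Nat.le_mul_of_pos_left _ h1) h3)
    have h4 : e.eval s * f.eval s ≤ B ^ e.deg * B ^ f.deg * B :=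
      (Nat.mul_le_mul he' hf').trans (Nat.le_mul_of_pos_right _ (by omega))
    exact ⟨⟨he, hf, h4.trans hW⟩, h4⟩

theorem Expr.Atomic.eval_le {B : ℕ} {s : State} (hs : s.BoundedBy B) (hB : 2 ≤ B) {e : Expr}
    (he : e.Atomic) : e.eval s ≤ B := by
  cases e with
  | const c => exact le_trans (show c ≤ 2 from he) hB
  | var x => exact hs.1 x
  | get a i => exact hs.2 _ _
  | _ => exact he.elim

theorem Expr.Slow.eval_le {B : ℕ} {s : State} (hs : s.BoundedBy B) (hB : 2 ≤ B) {e : Expr}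
    (he : e.Slow) : e.eval s ≤ B + 1 := by
  unfold Expr.Slow at he
  split at he
  · exact Nat.add_le_add_right (he.eval_le hs hB) 1
  · exact (he.eval_le hs hB).trans (Nat.le_succ B)

/-- Programs in which all loops are counting loops. The bound of a loop is kept in a register
below `8`, and programs write registers from `8` on only. -/
inductive LProg where
  | skip
  | set (x : ℕ) (e : Expr)
  | put (a : ℕ) (i e : Expr)
  | seq (p q : LProg)
  | ifPos (c : Expr) (p q : LProg)
  | loop (x b : ℕ) (p : LProg)

namespace LProg

/-- Translation into programs of the word RAM. -/
def toProg : LProg → Prog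
  | skip => .skip
  | set x e => .set x e
  | put a i e => .put a i e
  | seq p q => .seq p.toProg q.toProg
  | ifPos c p q => .ifLt (.const 0) c p.toProg q.toProg
  | loop x b p => .seq (.set x (.const 0))
      (.whileLt (.var x) (.var b) (.seq p.toProg (.set x (.add (.var x) (.const 1)))))

/-- The state after `i` rounds of a loop with counter `x` and body `f`. -/
def iter (f : State → State) (x : ℕ) : ℕ → State → State
  | 0, s => s.setVar x 0
  | i + 1, s => (f (iter f x i s)).setVar x (i + 1)

/-- The state in which a program halts. -/
def run : LProg → State → State
  | skip, s => s
  | set x e, s => s.setVar x (e.eval s)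
  | put a i e, s => s.setArr a (i.eval s) (e.eval s)
  | seq p q, s => q.run (p.run s)
  | ifPos c p q, s => if 0 < c.eval s then p.run s else q.run s
  | loop x b p, s => iter p.run x (s.var b) s

/-- The program does not write register `x`. -/
def NoWrite (x : ℕ) : LProg → Prop
  | skip => True
  | set y _ => y ≠ x
  | put _ _ _ => True
  | seq p q => p.NoWrite x ∧ q.NoWrite x
  | ifPos _ p q => p.NoWrite x ∧ q.NoWrite x
  | loop y _ p => y ≠ x ∧ p.NoWrite x

/-- Well-formed programs: loop counters are written by their loop only, and all values that are
stored grow by at most one in each step. -/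
def WF : LProg → Prop
  | skip => True
  | set x e => 8 ≤ x ∧ e.Slow
  | put _ _ e => e.Slow
  | seq p q => p.WF ∧ q.WF
  | ifPos _ p q => p.WF ∧ q.WF
  | loop x b p => 8 ≤ x ∧ b < 8 ∧ p.NoWrite x ∧ p.WF

/-- A bound on the degrees of the expressions of a program. -/
def deg : LProg → ℕ
  | skip => 0
  | set _ e => e.deg
  | put _ i e => i.deg + e.deg
  | seq p q => p.deg + q.deg
  | ifPos c p q => c.deg + p.deg + q.deg
  | loop _ _ p => p.deg + 3

/-- A bound on the number of steps, in terms of the loop bounds `β`. -/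
def time (β : ℕ → ℕ) : LProg → ℕ
  | skip => 1
  | set _ e => e.cost + 1
  | put _ i e => i.cost + e.cost + 1
  | seq p q => p.time β + q.time β
  | ifPos c p q => c.cost + 2 + p.time β + q.time β
  | loop _ b p => β b * (p.time β + 7) + 5

theorem WF.noWrite {p : LProg} (h : p.WF) {x : ℕ} (hx : x < 8) : p.NoWrite x := by
  induction p with
  | skip => trivial
  | set y e => have := h.1; simp only [NoWrite]; omega
  | put a i e => trivial
  | seq p q ihp ihq => exact ⟨ihp h.1, ihq h.2⟩
  | ifPos c p q ihp ihq => exact ⟨ihp h.1, ihq h.2⟩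
  | loop y b p ih => have := h.1; exact ⟨by omega, ih h.2.2.2⟩

theorem iter_var {f : State → State} {x y : ℕ} (hy : y ≠ x)
    (hf : ∀ s : State, (f s).var y = s.var y) (i : ℕ) (s : State) :
    (iter f x i s).var y = s.var y := by
  induction i with
  | zero => simp [iter, State.setVar, hy]
  | succ i ih => simp [iter, State.setVar, hy, hf, ih]

theorem NoWrite.run_var {p : LProg} {x : ℕ} (h : p.NoWrite x) (s : State) :
    (p.run s).var x = s.var x := by
  induction p generalizing s with
  | skip => rfl
  | set y e => simp [run, State.setVar, Function.update_of_ne (Ne.symm h)]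
  | put a i e => rfl
  | seq p q ihp ihq => rw [run, ihq h.2, ihp h.1]
  | ifPos c p q ihp ihq =>
    rw [run]
    split_ifs
    · exact ihp h.1 s
    · exact ihq h.2 s
  | loop y b p ih => exact iter_var (Ne.symm h.1) (fun s => ih h.2 s) _ s

theorem iter_self (f : State → State) (x i : ℕ) (s : State) : (iter f x i s).var x = i := by
  cases i <;> simp [iter, State.setVar]

theorem time_congr {p : LProg} (h : p.WF) {β γ : ℕ → ℕ} (hβ : ∀ x < 8, β x = γ x) :
    p.time β = p.time γ := by
  induction p with
  | skip => rfl
  | set y e => rfl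
  | put a i e => rfl
  | seq p q ihp ihq => rw [time, time, ihp h.1, ihq h.2]
  | ifPos c p q ihp ihq => rw [time, time, ihp h.1, ihq h.2]
  | loop y b p ih => rw [time, time, ih h.2.2.2, hβ b h.2.1]

theorem boundedBy_setVar {B : ℕ} {s : State} (hs : s.BoundedBy B) {x v : ℕ} (hv : v ≤ B) :
    (s.setVar x v).BoundedBy B := by
  refine ⟨fun y => ?_, hs.2⟩
  simp only [State.setVar, Function.update_apply]
  split_ifs
  · exact hv
  · exact hs.1 y

theorem boundedBy_setArr {B : ℕ} {s : State} (hs : s.BoundedBy B) {a i v : ℕ} (hv : v ≤ B) :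
    (s.setArr a i v).BoundedBy B := by
  refine ⟨hs.1, fun b j => ?_⟩
  by_cases h1 : b = a
  · by_cases h2 : j = i
    · simpa [State.setArr, h1, h2] using hv
    · simpa [State.setArr, h1, h2] using hs.2 a j
  · simpa [State.setArr, h1] using hs.2 b j

/-- A well-formed program halts as described by `run` and `time`. Since the stored values grow by
at most one in each step, the initial values and the running time determine the word bound. -/
theorem exec_run {M W : ℕ} (p : LProg) (hp : p.WF) (hW : M ^ p.deg ≤ W) (s : State) (B : ℕ)
    (hs : s.BoundedBy B) (hB : 2 ≤ B) (hM : B + p.time s.var ≤ M) :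
    (∃ t ≤ p.time s.var, Exec W p.toProg s (p.run s) t) ∧
      (p.run s).BoundedBy (B + p.time s.var) := by
  have hM2 : ∀ d, 1 ≤ M ^ d := fun d => Nat.one_le_pow _ _ (by omega)
  have hsM : s.BoundedBy M := hs.mono (by omega)
  have hfit : ∀ e : Expr, M ^ e.deg ≤ W → e.Fits W s := fun e he =>
    (e.fits_and_le hsM (by omega) he).1
  induction p generalizing s B with
  | skip => exact ⟨⟨1, le_rfl, .skip s⟩, hs.mono (by omega)⟩
  | set x e =>
    refine ⟨⟨_, le_rfl, .set x e s (hfit e hW)⟩, ?_⟩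
    exact boundedBy_setVar (hs.mono (Nat.le_add_right _ _))
      ((hp.2.eval_le hs hB).trans (by simp only [time]; omega))
  | put a i e =>
    simp only [deg, pow_add] at hW
    refine ⟨⟨_, le_rfl, .put a i e s (hfit i ?_) (hfit e ?_)⟩, ?_⟩
    · exact le_trans (Nat.le_mul_of_pos_right _ (hM2 _)) hW
    · exact le_trans (Nat.le_mul_of_pos_left _ (hM2 _)) hW
    · refine boundedBy_setArr (hs.mono (Nat.le_add_right _ _))
        ((Expr.Slow.eval_le hs hB hp).trans (by simp only [time]; omega))
  | seq p q ihp ihq =>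
    simp only [deg, pow_add] at hW
    simp only [time] at hM ⊢
    obtain ⟨⟨t, ht, hex⟩, hb⟩ := ihp hp.1
      (le_trans (Nat.le_mul_of_pos_right _ (hM2 _)) hW) s B hs hB (by omega) hsM hfit
    have hq : q.time (p.run s).var = q.time s.var :=
      time_congr hp.2 fun x hx => (hp.1.noWrite hx).run_var s
    have hbM : (p.run s).BoundedBy M := hb.mono (by omega)
    obtain ⟨⟨t', ht', hex'⟩, hb'⟩ := ihq hp.2
      (le_trans (Nat.le_mul_of_pos_left _ (hM2 _)) hW) (p.run s) _ hb (by omega)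
      (by rw [hq]; omega) hbM (fun e he => (e.fits_and_le hbM (by omega) he).1)
    rw [hq] at ht' hb'
    exact ⟨⟨t + t', by omega, .seq hex hex'⟩, hb'.mono (by omega)⟩
  | ifPos c p q ihp ihq =>
    simp only [deg, pow_add] at hW
    simp only [time] at hM ⊢
    have h1 : M ^ c.deg * M ^ p.deg ≤ W := le_trans (Nat.le_mul_of_pos_right _ (hM2 _)) hW
    have hc := hfit c (le_trans (Nat.le_mul_of_pos_right _ (hM2 _)) h1)
    have h0 : (Expr.const 0).Fits W s := Nat.zero_le _
    by_cases hpos : 0 < c.eval s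
    · obtain ⟨⟨t, ht, hex⟩, hb⟩ := ihp hp.1
        (le_trans (Nat.le_mul_of_pos_left _ (hM2 _)) h1) s B hs hB (by omega) hsM hfit
      rw [run, if_pos hpos]
      exact ⟨⟨_, by simp only [Expr.cost]; omega, .ifTrue h0 hc hpos hex⟩, hb.mono (by omega)⟩
    · obtain ⟨⟨t, ht, hex⟩, hb⟩ := ihq hp.2
        (le_trans (Nat.le_mul_of_pos_left _ (Nat.mul_pos (hM2 _) (hM2 _))) hW) s B hs hB
        (by omega) hsM hfit
      rw [run, if_neg hpos]
      exact ⟨⟨_, by simp only [Expr.cost]; omega, .ifFalse h0 hc hpos hex⟩, hb.mono (by omega)⟩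
  | loop x b p ih =>
    obtain ⟨hx, hb8, hnw, hwf⟩ := hp
    simp only [deg, pow_add] at hW
    have hWp : M ^ p.deg ≤ W := le_trans (Nat.le_mul_of_pos_right _ (hM2 _)) hW
    have hW3 : M ^ 3 ≤ W := le_trans (Nat.le_mul_of_pos_left _ (hM2 _)) hW
    simp only [time] at hM ⊢
    set N := s.var b with hN
    set T := p.time s.var with hT
    have hlow : ∀ i, ∀ y < 8, (iter p.run x i s).var y = s.var y := fun i y hy =>
      iter_var (by omega) (fun s => (hwf.noWrite hy).run_var s) i s
    have htime : ∀ i, p.time (iter p.run x i s).var = T := fun i =>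
      time_congr hwf fun y hy => hlow i y hy
    have hle : ∀ i ≤ N, i * (T + 7) ≤ N * (T + 7) := fun i hi => Nat.mul_le_mul_right _ hi
    have hbd : ∀ i ≤ N, (iter p.run x i s).BoundedBy (B + i * (T + 7)) := by
      intro i
      induction i with
      | zero => exact fun _ => boundedBy_setVar (hs.mono (by omega)) (Nat.zero_le _)
      | succ i ihi =>
        intro hi
        have hb := ihi (by omega)
        have h1 := hle (i + 1) hi
        have h2 : (i + 1) * (T + 7) = i * (T + 7) + (T + 7) := by ring
        have hbM := hb.mono (B' := M) (by omega)
        have := (ih hwf hWp (iter p.run x i s) _ hb (by omega) (by rw [htime]; omega) hbM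
          (fun e he => (e.fits_and_le hbM (by omega) he).1)).2
        rw [htime] at this
        refine boundedBy_setVar (this.mono (by omega)) ?_
        have : i + 1 ≤ (i + 1) * (T + 7) := Nat.le_mul_of_pos_right _ (by omega)
        omega
    have hcond : ∀ i ≤ N, (Expr.var x).Fits W (iter p.run x i s) ∧
        (Expr.var b).Fits W (iter p.run x i s) ∧
        (Expr.add (.var x) (.const 1)).Fits W (iter p.run x i s) := by
      intro i hi
      have hbM := (hbd i hi).mono (B' := M) (by have := hle i hi; omega)
      have h13 : M ^ 1 ≤ M ^ 3 := Nat.pow_le_pow_right (by omega) (by omega)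
      exact ⟨(Expr.fits_and_le hbM (by omega) (.var x) (h13.trans hW3)).1,
        (Expr.fits_and_le hbM (by omega) (.var b) (h13.trans hW3)).1,
        (Expr.fits_and_le hbM (by omega) (.add (.var x) (.const 1)) hW3).1⟩
    have hwhile : ∀ j ≤ N, ∃ t ≤ j * (T + 7) + 3, Exec W
        (.whileLt (.var x) (.var b) (.seq p.toProg (.set x (.add (.var x) (.const 1)))))
        (iter p.run x (N - j) s) (iter p.run x N s) t := by
      intro j
      induction j with
      | zero =>
        intro _
        refine ⟨3, by omega, ?_⟩
        exact .whileFalse (hcond N le_rfl).1 (hcond N le_rfl).2.1 (by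
          simp only [Expr.eval, Nat.sub_zero]
          rw [iter_self, hlow N b hb8]
          omega)
      | succ j ihj =>
        intro hj
        obtain ⟨t, ht, hex⟩ := ihj (by omega)
        set i := N - (j + 1) with hi
        have hij : N - j = i + 1 := by omega
        rw [hij] at hex
        have hc := hcond i (by omega)
        have h1 := hle (i + 1) (by omega)
        have h2 : (i + 1) * (T + 7) = i * (T + 7) + (T + 7) := by ring
        have hb := hbd i (by omega)
        have hbM := hb.mono (B' := M) (by omega)
        obtain ⟨⟨t', ht', hex'⟩, hbb⟩ := ih hwf hWp (iter p.run x i s) _ hb (by omega)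
          (by rw [htime]; omega) hbM (fun e he => (e.fits_and_le hbM (by omega) he).1)
        rw [htime] at ht' hbb
        have hbbM := hbb.mono (B' := M) (by omega)
        have hset : Exec W (.set x (.add (.var x) (.const 1))) (p.run (iter p.run x i s))
            (iter p.run x (i + 1) s) 4 := by
          have hv : (Expr.add (.var x) (.const 1)).eval (p.run (iter p.run x i s)) = i + 1 := by
            simp only [Expr.eval]
            rw [hnw.run_var, iter_self]
          have := Exec.set (W := W) x (.add (.var x) (.const 1)) (p.run (iter p.run x i s))
            (Expr.fits_and_le hbbM (by omega) _ hW3).1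
          rw [hv] at this
          exact this
        refine ⟨_, ?_, .whileTrue hc.1 hc.2.1 ?_ (.seq hex' hset) hex⟩
        · simp only [Expr.cost]
          have : (j + 1) * (T + 7) = j * (T + 7) + (T + 7) := by ring
          omega
        · simp only [Expr.eval]
          rw [iter_self, hlow i b hb8]
          omega
    obtain ⟨t, ht, hex⟩ := hwhile N le_rfl
    rw [Nat.sub_self] at hex
    refine ⟨⟨2 + t, by omega, ?_⟩, (hbd N le_rfl).mono (by omega)⟩
    exact .seq (.set x (.const 0) s (Nat.zero_le _)) hex

/-- Nesting depth of the loops with bound register other than `2`. -/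
def depthN : LProg → ℕ
  | seq p q => max p.depthN q.depthN
  | ifPos _ p q => max p.depthN q.depthN
  | loop _ b p => if b = 2 then p.depthN else p.depthN + 1
  | _ => 0

/-- Nesting depth of the loops with bound register `2`. -/
def depthM : LProg → ℕ
  | seq p q => max p.depthM q.depthM
  | ifPos _ p q => max p.depthM q.depthM
  | loop _ b p => if b = 2 then p.depthM + 1 else p.depthM
  | _ => 0

/-- All loop bounds are in the given registers. -/
def BoundsIn (l : List ℕ) : LProg → Bool
  | seq p q => p.BoundsIn l && q.BoundsIn l
  | ifPos _ p q => p.BoundsIn l && q.BoundsIn l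
  | loop _ b p => decide (b ∈ l) && p.BoundsIn l
  | _ => true

/-- The constant factor in `time_le`. -/
def factor : LProg → ℕ
  | skip => 1
  | set _ e => e.cost + 1
  | put _ i e => i.cost + e.cost + 1
  | seq p q => p.factor + q.factor
  | ifPos c p q => c.cost + 2 + p.factor + q.factor
  | loop _ _ p => 5 * (p.factor + 12)

theorem time_le {n m : ℕ} (hn : 1 ≤ n) (hm : 1 ≤ m) {β : ℕ → ℕ} (h2 : β 2 = m) {l : List ℕ}
    (hβ : ∀ b ∈ l, b ≠ 2 → β b ≤ 5 * n) (p : LProg) (hl : p.BoundsIn l = true) (a b : ℕ)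
    (ha : p.depthN ≤ a) (hb : p.depthM ≤ b) : p.time β ≤ p.factor * (n ^ a * m ^ b) := by
  have hX : ∀ a b, 1 ≤ n ^ a * m ^ b := fun a b =>
    Nat.one_le_iff_ne_zero.2 (Nat.mul_ne_zero (pow_ne_zero _ (by omega)) (pow_ne_zero _ (by omega)))
  have hc : ∀ c, c ≤ c * (n ^ a * m ^ b) := fun c => Nat.le_mul_of_pos_right _ (hX a b)
  induction p generalizing a b with
  | skip => exact hc _
  | set x e => exact hc _
  | put a i e => exact hc _
  | seq p q ihp ihq =>
    simp only [depthN, depthM, max_le_iff, BoundsIn, Bool.and_eq_true] at ha hb hl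
    simp only [time, factor, add_mul]
    exact Nat.add_le_add (ihp hl.1 a b ha.1 hb.1 hc) (ihq hl.2 a b ha.2 hb.2 hc)
  | ifPos c p q ihp ihq =>
    simp only [depthN, depthM, max_le_iff, BoundsIn, Bool.and_eq_true] at ha hb hl
    simp only [time, factor]
    rw [add_mul, add_mul]
    exact Nat.add_le_add (Nat.add_le_add (hc _) (ihp hl.1 a b ha.1 hb.1 hc))
      (ihq hl.2 a b ha.2 hb.2 hc)
  | loop x c p ih =>
    simp only [BoundsIn, Bool.and_eq_true, decide_eq_true_eq] at hl
    simp only [time, factor]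
    have key : ∀ a' b', p.depthN ≤ a' → p.depthM ≤ b' → β c * (n ^ a' * m ^ b') ≤
        5 * (n ^ a * m ^ b) → β c * (p.time β + 7) + 5 ≤ 5 * (p.factor + 12) * (n ^ a * m ^ b) := by
      intro a' b' ha' hb' hle
      have h1 := ih hl.2 a' b' ha' hb' (fun c => Nat.le_mul_of_pos_right _ (hX a' b'))
      have h2 := hX a' b'
      have h3 := hX a b
      calc β c * (p.time β + 7) + 5
          ≤ β c * (p.factor * (n ^ a' * m ^ b') + 7 * (n ^ a' * m ^ b')) + 5 := by
            gcongr; omega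
        _ = (p.factor + 7) * (β c * (n ^ a' * m ^ b')) + 5 := by ring
        _ ≤ (p.factor + 7) * (5 * (n ^ a * m ^ b)) + 5 * (n ^ a * m ^ b) := by
            gcongr; omega
        _ ≤ 5 * (p.factor + 12) * (n ^ a * m ^ b) := by
            have : (p.factor + 7) * (5 * (n ^ a * m ^ b)) + 5 * (n ^ a * m ^ b) =
              5 * (p.factor + 8) * (n ^ a * m ^ b) := by ring
            rw [this]; gcongr; omega
    by_cases hc2 : c = 2
    · simp only [depthN, depthM, hc2, if_true] at ha hb
      obtain ⟨b', rfl⟩ : ∃ b', b = b' + 1 := ⟨b - 1, by omega⟩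
      refine key a b' ha (by omega) ?_
      rw [hc2, h2, pow_succ]
      calc m * (n ^ a * m ^ b') = n ^ a * (m ^ b' * m) := by ring
        _ ≤ 5 * (n ^ a * (m ^ b' * m)) := by omega
    · simp only [depthN, depthM, hc2, if_false] at ha hb
      obtain ⟨a', rfl⟩ : ∃ a', a = a' + 1 := ⟨a - 1, by omega⟩
      refine key a' b (by omega) hb ?_
      calc β c * (n ^ a' * m ^ b) ≤ 5 * n * (n ^ a' * m ^ b) := Nat.mul_le_mul_right _ (hβ c hl.1 hc2)
        _ = 5 * (n ^ (a' + 1) * m ^ b) := by ring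

end LProg

end WordRAM

/-! ### Counting loops -/

namespace WordRAM

namespace Expr

/-! Conditions are expressions, true when positive. -/

def and (e f : Expr) : Expr := mul e f
def or (e f : Expr) : Expr := add e f
def not (e : Expr) : Expr := sub (const 1) e
def lt (e f : Expr) : Expr := sub f e
def ne (e f : Expr) : Expr := or (lt e f) (lt f e)
def eq (e f : Expr) : Expr := not (ne e f)

@[simp] theorem pos_and (s : State) (e f : Expr) :
    0 < (and e f).eval s ↔ 0 < e.eval s ∧ 0 < f.eval s := by
  simp only [and, eval, Nat.pos_iff_ne_zero, ne_eq, Nat.mul_eq_zero, not_or]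

@[simp] theorem pos_or (s : State) (e f : Expr) :
    0 < (or e f).eval s ↔ 0 < e.eval s ∨ 0 < f.eval s := by
  simp only [or, eval]; omega

@[simp] theorem pos_not (s : State) (e : Expr) : 0 < (not e).eval s ↔ ¬ 0 < e.eval s := by
  simp only [not, eval]; omega

@[simp] theorem pos_lt (s : State) (e f : Expr) :
    0 < (lt e f).eval s ↔ e.eval s < f.eval s := by
  simp only [lt, eval]; omega

@[simp] theorem pos_ne (s : State) (e f : Expr) :
    0 < (ne e f).eval s ↔ e.eval s ≠ f.eval s := by
  simp only [ne, pos_or, pos_lt]; omega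

@[simp] theorem pos_eq (s : State) (e f : Expr) :
    0 < (eq e f).eval s ↔ e.eval s = f.eval s := by
  simp only [eq, pos_not, pos_ne]; omega

theorem eval_congr {a : ℕ} {s s' : State} (hv : ∀ x, s.var x = s'.var x)
    (ha : ∀ b, b ≠ a → s.arr b = s'.arr b) {e : Expr} (he : e.NoRead a) :
    e.eval s = e.eval s' := by
  induction e with
  | const c => rfl
  | var x => exact hv x
  | get b i ih => simp only [eval]; rw [ih he.2, ha b he.1]
  | add e f ihe ihf => simp only [eval]; rw [ihe he.1, ihf he.2]
  | sub e f ihe ihf => simp only [eval]; rw [ihe he.1, ihf he.2]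
  | mul e f ihe ihf => simp only [eval]; rw [ihe he.1, ihf he.2]

instance decidableNoRead (a : ℕ) : (e : Expr) → Decidable (e.NoRead a)
  | const _ => inferInstanceAs (Decidable True)
  | var _ => inferInstanceAs (Decidable True)
  | get b i =>
    have := decidableNoRead a i
    inferInstanceAs (Decidable (b ≠ a ∧ i.NoRead a))
  | add e f =>
    have := decidableNoRead a e
    have := decidableNoRead a f
    inferInstanceAs (Decidable (e.NoRead a ∧ f.NoRead a))
  | sub e f =>
    have := decidableNoRead a e
    have := decidableNoRead a f
    inferInstanceAs (Decidable (e.NoRead a ∧ f.NoRead a))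
  | mul e f =>
    have := decidableNoRead a e
    have := decidableNoRead a f
    inferInstanceAs (Decidable (e.NoRead a ∧ f.NoRead a))

end Expr

namespace LProg

/-- For each pair `(c, i)` in the list such that `c` is true, increase cell `i` of array `a`. -/
def countBody (a : ℕ) : List (Expr × Expr) → LProg
  | [] => skip
  | c :: l => seq (ifPos c.1 (put a c.2 (.add (.get a c.2) (.const 1))) skip) (countBody a l)

/-- The program `countBody` inside of nested loops, given by their counters and bounds. -/
def countNest (a : ℕ) (body : List (Expr × Expr)) : List (ℕ × ℕ) → LProg
  | [] => countBody a body
  | xb :: L => loop xb.1 xb.2 (countNest a body L)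

/-- The increase of cell `j` under `countNest`. -/
def count (body : List (Expr × Expr)) : List (ℕ × ℕ) → State → ℕ → ℕ
  | [], s, j => (body.map fun c => if 0 < c.1.eval s ∧ c.2.eval s = j then 1 else 0).sum
  | xb :: L, s, j => ∑ i ∈ Finset.range (s.var xb.2), count body L (s.setVar xb.1 i) j

/-- Cell `j` is increased by `countNest`. -/
def Hits (body : List (Expr × Expr)) : List (ℕ × ℕ) → State → ℕ → Prop
  | [], s, j => ∃ c ∈ body, 0 < c.1.eval s ∧ c.2.eval s = j
  | xb :: L, s, j => ∃ i < s.var xb.2, Hits body L (s.setVar xb.1 i) j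

theorem count_pos_iff (body : List (Expr × Expr)) (L : List (ℕ × ℕ)) (s : State) (j : ℕ) :
    0 < count body L s j ↔ Hits body L s j := by
  induction L generalizing s with
  | nil =>
    simp only [count, Hits, List.sum_pos_iff_exists_pos_nat, List.mem_map]
    constructor
    · rintro ⟨x, ⟨c, hc, rfl⟩, hx⟩
      refine ⟨c, hc, ?_⟩
      by_contra h
      simp [h] at hx
    · rintro ⟨c, hc, h⟩
      exact ⟨_, ⟨c, hc, rfl⟩, by simp [h]⟩
  | cons xb L ih =>
    simp only [count, Hits, Finset.sum_pos_iff, Finset.mem_range, ih]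

theorem count_congr {a : ℕ} {body : List (Expr × Expr)}
    (hbody : ∀ c ∈ body, c.1.NoRead a ∧ c.2.NoRead a) (L : List (ℕ × ℕ))
    (hL : ∀ xb ∈ L, 8 ≤ xb.1 ∧ xb.2 < 8) {s s' : State}
    (hv : ∀ x, (∀ xb ∈ L, xb.1 ≠ x) → s.var x = s'.var x)
    (ha : ∀ b, b ≠ a → s.arr b = s'.arr b) (j : ℕ) : count body L s j = count body L s' j := by
  induction L generalizing s s' with
  | nil =>
    simp only [count]
    congr 1
    refine List.map_congr_left fun c hc => ?_
    have hv' : ∀ x, s.var x = s'.var x := fun x => hv x (by simp)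
    rw [Expr.eval_congr hv' ha (hbody c hc).1, Expr.eval_congr hv' ha (hbody c hc).2]
  | cons xb L ih =>
    simp only [count]
    have hb : s.var xb.2 = s'.var xb.2 := by
      refine hv _ fun yb hyb => ?_
      have h1 := (hL yb hyb).1
      have h2 := (hL xb (by simp)).2
      omega
    rw [hb]
    refine Finset.sum_congr rfl fun i _ => ih (fun yb hyb => hL yb (by simp [hyb])) ?_ ha
    intro x hx
    by_cases h : x = xb.1
    · simp [State.setVar, h]
    · simp only [State.setVar, Function.update_of_ne h]
      refine hv x ?_
      intro yb hyb
      rcases List.mem_cons.1 hyb with rfl | hyb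
      · exact Ne.symm h
      · exact hx yb hyb

theorem run_countBody {a : ℕ} {body : List (Expr × Expr)}
    (hbody : ∀ c ∈ body, c.1.NoRead a ∧ c.2.NoRead a) (s : State) :
    ((countBody a body).run s).var = s.var ∧
      (∀ b, b ≠ a → ((countBody a body).run s).arr b = s.arr b) ∧
      ∀ j, ((countBody a body).run s).arr a j = s.arr a j + count body [] s j := by
  induction body generalizing s with
  | nil => simp [countBody, run, count]
  | cons c l ih =>
    simp only [countBody, run]
    set s' := if 0 < c.1.eval s then
      s.setArr a (c.2.eval s) ((Expr.add (.get a c.2) (.const 1)).eval s) else s with hs'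
    obtain ⟨h1, h2, h3⟩ := ih (fun d hd => hbody d (by simp [hd])) s'
    have hv : s'.var = s.var := by rw [hs']; split_ifs <;> rfl
    have ha : ∀ b, b ≠ a → s'.arr b = s.arr b := by
      intro b hb
      rw [hs']
      split_ifs
      · simp [State.setArr, hb]
      · rfl
    refine ⟨h1.trans hv, fun b hb => (h2 b hb).trans (ha b hb), fun j => ?_⟩
    rw [h3, count_congr (fun d hd => hbody d (by simp [hd])) [] (by simp)
      (fun x _ => congrFun hv x) ha]
    simp only [count, List.map_cons, List.sum_cons, ← add_assoc]
    congr 1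
    rw [hs']
    by_cases hc : 0 < c.1.eval s
    · by_cases hj : c.2.eval s = j
      · simp [hc, hj, State.setArr, Expr.eval]
      · simp [hc, hj, State.setArr, Function.update_of_ne (Ne.symm hj)]
    · simp [hc]

theorem run_countNest {a : ℕ} {body : List (Expr × Expr)}
    (hbody : ∀ c ∈ body, c.1.NoRead a ∧ c.2.NoRead a) (L : List (ℕ × ℕ))
    (hL : ∀ xb ∈ L, 8 ≤ xb.1 ∧ xb.2 < 8) (s : State) :
    (∀ x, (∀ xb ∈ L, xb.1 ≠ x) → ((countNest a body L).run s).var x = s.var x) ∧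
      (∀ b, b ≠ a → ((countNest a body L).run s).arr b = s.arr b) ∧
      ∀ j, ((countNest a body L).run s).arr a j = s.arr a j + count body L s j := by
  induction L generalizing s with
  | nil =>
    obtain ⟨h1, h2, h3⟩ := run_countBody hbody s
    exact ⟨fun x _ => congrFun h1 x, h2, h3⟩
  | cons xb L ih =>
    have hL' : ∀ yb ∈ L, 8 ≤ yb.1 ∧ yb.2 < 8 := fun yb hyb => hL yb (by simp [hyb])
    simp only [countNest, run, count]
    generalize s.var xb.2 = N
    induction N with
    | zero =>
      refine ⟨fun x hx => ?_, fun b _ => rfl, fun j => by simp [iter, State.setVar]⟩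
      have := hx xb (by simp)
      simp [iter, State.setVar, Function.update_of_ne (Ne.symm this)]
    | succ N ihN =>
      obtain ⟨h1, h2, h3⟩ := ihN
      set σ := iter (countNest a body L).run xb.1 N s
      obtain ⟨k1, k2, k3⟩ := ih hL' σ
      refine ⟨fun x hx => ?_, fun b hb => (k2 b hb).trans (h2 b hb), fun j => ?_⟩
      · have hne := hx xb (by simp)
        simp only [iter, State.setVar, Function.update_of_ne (Ne.symm hne)]
        rw [k1 x fun yb hyb => hx yb (by simp [hyb]), h1 x hx]
      · simp only [iter, State.setVar]
        rw [k3 j, h3 j, Finset.sum_range_succ, add_assoc]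
        congr 2
        refine count_congr hbody L hL' (s' := s.setVar xb.1 N) ?_ h2 j
        intro x hx
        by_cases h : x = xb.1
        · subst h
          rw [iter_self]; simp [State.setVar]
        · simp only [State.setVar, Function.update_of_ne h]
          refine h1 x fun yb hyb => ?_
          rcases List.mem_cons.1 hyb with rfl | hyb
          · exact Ne.symm h
          · exact hx yb hyb

theorem wf_countNest {a : ℕ} {body : List (Expr × Expr)} {L : List (ℕ × ℕ)}
    (hL : ∀ xb ∈ L, 8 ≤ xb.1 ∧ xb.2 < 8) (hnd : (L.map Prod.fst).Nodup) :
    (countNest a body L).WF := by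
  have hbody : (countBody a body).WF ∧ ∀ x, (countBody a body).NoWrite x := by
    induction body with
    | nil => exact ⟨trivial, fun _ => trivial⟩
    | cons c l ih =>
      exact ⟨⟨⟨trivial, trivial⟩, ih.1⟩, fun x => ⟨⟨trivial, trivial⟩, ih.2 x⟩⟩
  suffices h : (countNest a body L).WF ∧
      ∀ x, x ∉ L.map Prod.fst → (countNest a body L).NoWrite x from h.1
  induction L with
  | nil => exact ⟨hbody.1, fun x _ => hbody.2 x⟩
  | cons xb L ih =>
    rw [List.map_cons, List.nodup_cons] at hnd
    obtain ⟨h1, h2⟩ := ih (fun yb hyb => hL yb (by simp [hyb])) hnd.2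
    refine ⟨⟨(hL xb (by simp)).1, (hL xb (by simp)).2, h2 _ hnd.1, h1⟩, fun x hx => ?_⟩
    rw [List.map_cons, List.mem_cons, not_or] at hx
    exact ⟨Ne.symm hx.1, h2 x hx.2⟩

end LProg

end WordRAM

/-! ### The kernelization program: tables -/

namespace WordRAM

open LProg

/-- Cell `(e, f)` of the table with rows of length `n` in array `a`. -/
def Expr.get2 (a : ℕ) (e f : Expr) : Expr := .get a (.add (.mul e (.var 0)) f)

/-- Position of `(e, f)` in a table with rows of length `n`. -/
def Expr.idx2 (e f : Expr) : Expr := .add (.mul e (.var 0)) f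

/-- First end of the edge whose number is in register `x`. -/
def edgeFst (x : ℕ) : Expr := .get 0 (.add (.const 3) (.mul (.const 2) (.var x)))

/-- Second end of the edge whose number is in register `x`. -/
def edgeSnd (x : ℕ) : Expr := .get 0 (.add (.const 4) (.mul (.const 2) (.var x)))

/-- The commands `f`, for the edge numbered by register `8` in both orientations. -/
def edgeBody (f : Expr → Expr → List (Expr × Expr)) : List (Expr × Expr) :=
  f (edgeFst 8) (edgeSnd 8) ++ f (edgeSnd 8) (edgeFst 8)

/-- What array `a` holds once its table has been computed. -/
def Fact (I : Instance) (a : ℕ) (f : ℕ → ℕ) : Prop :=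
  match a with
  | 2 => ∀ x < I.n, ∀ y < I.n, 0 < f (x * I.n + y) ↔ I.G.Adj x y
  | 3 => ∀ x < I.n, 0 < f x ↔ I.HasInducedPath x
  | 4 => ∀ u < I.n, ∀ x < I.n, 0 < f (u * I.n + x) ↔
      I.G.Adj u x ∧ ∃ y, I.G.Adj u y ∧ I.G.Adj y x ∧ y < x
  | 5 => ∀ u < I.n, f u = by
      classical exact ((Finset.range I.n).filter fun x => I.LocalMin u x).card
  | 6 => ∀ u < I.n, 0 < f u ↔ I.Core u
  | 7 => ∀ u < I.n, ∀ p < I.n, 0 < f (u * I.n + p) ↔ I.Tri u p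
  | 8 => ∀ p < I.n, ∀ z < I.n, 0 < f (p * I.n + z) ↔ I.FreeTri p z
  | 9 => ∀ u < I.n, 0 < f u ↔ I.Outer u
  | 10 => ∀ u < I.n, 0 < f u ↔ ∃ a, I.Att u a
  | 11 => ∀ u < I.n, f u = I.label u
  | 12 => ∀ u < I.n, 0 < f u ↔ I.Dense u
  | 13 => ∀ p < I.n, 0 < f p ↔ I.Used p
  | 14 => f 0 = by classical exact ((Finset.range I.n).filter I.Used).card
  | 15 => ∀ u < I.n, 0 < f u ↔ I.Clashing u
  | 16 => f 0 = by classical exact ((Finset.range I.n).filter I.Clashing).card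
  | 17 => 0 < f 0 ↔ ¬ I.Consistent
  | 18 => 0 < f 0 ↔ ∃ u, I.Outer u
  | 19 => ∀ w < I.n,
      I.IsTiedPart w ((Finset.range I.n).filter fun v => 0 < f (w * I.n + v))
  | 20 => ∃ S : ℕ → Finset ℕ, (∀ w < I.n, I.IsTiedPart w (S w) ∧ S w ⊆ Finset.range I.n) ∧
      ∀ v < I.n, 0 < f v ↔ v ∈ I.kept S
  | 21 => ∃ S : ℕ → Finset ℕ, (∀ w < I.n, I.IsTiedPart w (S w) ∧ S w ⊆ Finset.range I.n) ∧
      ∀ t < 5, ∀ i < I.n, 0 < f (t * I.n + i) ↔ (t, i) ∈ I.Selected (I.kept S)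
  | 22 => ∀ t < 5, ∀ i < I.n, ∀ t' < 5, ∀ i' < I.n,
      0 < f ((t * I.n + i) * (5 * I.n) + (t' * I.n + i')) ↔ I.KernelRel (t, i) (t', i')
  | _ => True

/-- The input has been read, tables `2, …, a - 1` have been computed, the other arrays are
still empty. Edge number `i` of the `m` edges is `(ex i, ey i)`. -/
structure Ready (I : Instance) (m : ℕ) (ex ey : ℕ → ℕ) (a : ℕ) (s : State) : Prop where
  var_n : s.var 0 = I.n
  var_k : s.var 1 = I.k
  var_m : s.var 2 = m
  var_N : s.var 3 = 5 * I.n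
  fst : ∀ i < m, s.arr 0 (3 + 2 * i) = ex i
  snd : ∀ i < m, s.arr 0 (4 + 2 * i) = ey i
  adj : ∀ x y, I.G.Adj x y ↔ ∃ i < m, (ex i = x ∧ ey i = y) ∨ (ey i = x ∧ ex i = y)
  fact : ∀ b, 2 ≤ b → b < a → Fact I b (s.arr b)
  zero : ∀ b, b = 1 ∨ a ≤ b → ∀ j, s.arr b j = 0

variable {I : Instance} {m : ℕ} {ex ey : ℕ → ℕ} {a : ℕ} {s : State}

theorem Ready.step (h : Ready I m ex ey a s) (ha : 2 ≤ a) {s' : State}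
    (hv : ∀ x < 8, s'.var x = s.var x) (hs : ∀ b, b ≠ a → s'.arr b = s.arr b)
    (hf : Fact I a (s'.arr a)) : Ready I m ex ey (a + 1) s' where
  var_n := by rw [hv 0 (by omega), h.var_n]
  var_k := by rw [hv 1 (by omega), h.var_k]
  var_m := by rw [hv 2 (by omega), h.var_m]
  var_N := by rw [hv 3 (by omega), h.var_N]
  fst i hi := by rw [hs 0 (by omega), h.fst i hi]
  snd i hi := by rw [hs 0 (by omega), h.snd i hi]
  adj := h.adj
  fact b h2 hb := by
    by_cases hba : b = a
    · rw [hba]; exact hf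
    · rw [hs b hba]; exact h.fact b h2 (by omega)
  zero b hb j := by rw [hs b (by omega)]; exact h.zero b (by omega) j

theorem Ready.countNest (h : Ready I m ex ey a s) (ha : 2 ≤ a) {body : List (Expr × Expr)}
    {L : List (ℕ × ℕ)} (hbody : ∀ c ∈ body, c.1.NoRead a ∧ c.2.NoRead a)
    (hL : ∀ xb ∈ L, 8 ≤ xb.1 ∧ xb.2 < 8)
    (hf : ∀ f : ℕ → ℕ, (∀ j, f j = count body L s j) → Fact I a f) :
    Ready I m ex ey (a + 1) ((LProg.countNest a body L).run s) := by
  obtain ⟨h1, h2, h3⟩ := run_countNest hbody L hL s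
  refine h.step ha (fun x hx => h1 x fun xb hxb => ?_) h2 (hf _ fun j => ?_)
  · have := (hL xb hxb).1
    omega
  · rw [h3, h.zero a (Or.inr le_rfl), zero_add]

theorem Ready.lt_fst (h : Ready I m ex ey a s) {i : ℕ} (hi : i < m) :
    ex i < I.n ∧ ey i < I.n := by
  have := (h.adj (ex i) (ey i)).2 ⟨i, hi, Or.inl ⟨rfl, rfl⟩⟩
  exact ⟨I.lt_of_adj _ _ this, I.lt_of_adj' this⟩

theorem Ready.exists_edge (h : Ready I m ex ey a s) (φ : ℕ → ℕ → Prop) :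
    (∃ i < m, φ (ex i) (ey i) ∨ φ (ey i) (ex i)) ↔ ∃ x y, I.G.Adj x y ∧ φ x y := by
  constructor
  · rintro ⟨i, hi, h' | h'⟩
    · exact ⟨_, _, (h.adj _ _).2 ⟨i, hi, Or.inl ⟨rfl, rfl⟩⟩, h'⟩
    · exact ⟨_, _, (h.adj _ _).2 ⟨i, hi, Or.inr ⟨rfl, rfl⟩⟩, h'⟩
  · rintro ⟨x, y, hxy, h'⟩
    obtain ⟨i, hi, ⟨rfl, rfl⟩ | ⟨rfl, rfl⟩⟩ := (h.adj x y).1 hxy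
    · exact ⟨i, hi, Or.inl h'⟩
    · exact ⟨i, hi, Or.inr h'⟩

/-- The states in which the commands inside of loops are executed. -/
structure Inside (I : Instance) (s σ : State) : Prop where
  arr : σ.arr = s.arr
  var_n : σ.var 0 = I.n
  var_k : σ.var 1 = I.k
  var_N : σ.var 3 = 5 * I.n

theorem Ready.inside (h : Ready I m ex ey a s) : Inside I s s :=
  ⟨rfl, h.var_n, h.var_k, h.var_N⟩

theorem Inside.setVar {s σ : State} (h : Inside I s σ) {x : ℕ} (hx : 8 ≤ x) (v : ℕ) :
    Inside I s (σ.setVar x v) := by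
  obtain ⟨h1, h2, h3, h4⟩ := h
  refine ⟨h1, ?_, ?_, ?_⟩ <;> simp only [State.setVar] <;>
    rw [Function.update_of_ne (by omega)] <;> assumption

/-- The commands `f`, applied to any expressions for the ends of an edge, have the effect `φ` on
cell `j`, in terms of these ends and of the loop counters in the registers `R`. -/
def Means (I : Instance) (s : State) (R : List ℕ) (f : Expr → Expr → List (Expr × Expr)) (j : ℕ)
    (φ : ℕ → ℕ → (ℕ → ℕ) → Prop) : Prop :=
  ∀ (X Y : Expr) (σ : State), Inside I s σ → X.eval σ < I.n → Y.eval σ < I.n →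
    (∀ r ∈ R, σ.var r < I.n) →
      ((∃ c ∈ f X Y, 0 < c.1.eval σ ∧ c.2.eval σ = j) ↔ φ (X.eval σ) (Y.eval σ) σ.var)

theorem Ready.edge_or (h : Ready I m ex ey a s) {R : List ℕ}
    {f : Expr → Expr → List (Expr × Expr)} {j : ℕ} {φ : ℕ → ℕ → (ℕ → ℕ) → Prop}
    (hφ : Means I s R f j φ) {i : ℕ} (hi : i < m) {σ : State} (hσ : Inside I s σ)
    (h8 : σ.var 8 = i) (hR : ∀ r ∈ R, σ.var r < I.n) :
    (∃ c ∈ edgeBody f, 0 < c.1.eval σ ∧ c.2.eval σ = j) ↔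
      φ (ex i) (ey i) σ.var ∨ φ (ey i) (ex i) σ.var := by
  have e1 : (edgeFst 8).eval σ = ex i := by
    simp only [edgeFst, Expr.eval, h8, hσ.arr, h.fst i hi]
  have e2 : (edgeSnd 8).eval σ = ey i := by
    simp only [edgeSnd, Expr.eval, h8, hσ.arr, h.snd i hi]
  have hl := h.lt_fst hi
  have k1 := hφ (edgeFst 8) (edgeSnd 8) σ hσ (by rw [e1]; exact hl.1) (by rw [e2]; exact hl.2) hR
  have k2 := hφ (edgeSnd 8) (edgeFst 8) σ hσ (by rw [e2]; exact hl.2) (by rw [e1]; exact hl.1) hR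
  rw [e1, e2] at k1 k2
  rw [← k1, ← k2]
  simp only [edgeBody, List.mem_append]
  constructor
  · rintro ⟨c, hc | hc, h'⟩
    · exact Or.inl ⟨c, hc, h'⟩
    · exact Or.inr ⟨c, hc, h'⟩
  · rintro (⟨c, hc, h'⟩ | ⟨c, hc, h'⟩)
    · exact ⟨c, Or.inl hc, h'⟩
    · exact ⟨c, Or.inr hc, h'⟩

theorem Ready.hits_edge (h : Ready I m ex ey a s) {f : Expr → Expr → List (Expr × Expr)} {j : ℕ}
    {φ : ℕ → ℕ → Prop} (hφ : Means I s [] f j fun x y _ => φ x y) :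
    Hits (edgeBody f) [(8, 2)] s j ↔ ∃ x y, I.G.Adj x y ∧ φ x y := by
  rw [← h.exists_edge φ]
  simp only [Hits, h.var_m]
  exact exists_congr fun i => and_congr_right fun hi =>
    h.edge_or hφ hi (h.inside.setVar (x := 8) le_rfl i) (by simp [State.setVar]) (by simp)

theorem Ready.hits_edge1 (h : Ready I m ex ey a s) {f : Expr → Expr → List (Expr × Expr)} {j : ℕ}
    {φ : ℕ → ℕ → ℕ → Prop} (hφ : Means I s [9] f j fun x y v => φ x y (v 9)) :
    Hits (edgeBody f) [(8, 2), (9, 0)] s j ↔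
      ∃ x y, I.G.Adj x y ∧ ∃ z < I.n, φ x y z := by
  rw [← h.exists_edge fun x y => ∃ z < I.n, φ x y z]
  simp only [Hits, h.var_m]
  refine exists_congr fun i => and_congr_right fun hi => ?_
  have hi8 := h.inside.setVar (x := 8) le_rfl i
  rw [hi8.var_n, ← exists_or]
  refine exists_congr fun z => ?_
  rw [← and_or_left]
  refine and_congr_right fun hz => ?_
  have := h.edge_or hφ hi (hi8.setVar (x := 9) (by omega) z) (by simp [State.setVar])
    (by simpa [State.setVar] using hz)
  simpa [State.setVar] using this

theorem Ready.hits_edge2 (h : Ready I m ex ey a s) {f : Expr → Expr → List (Expr × Expr)} {j : ℕ}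
    {φ : ℕ → ℕ → ℕ → ℕ → Prop} (hφ : Means I s [9, 10] f j fun x y v => φ x y (v 9) (v 10)) :
    Hits (edgeBody f) [(8, 2), (9, 0), (10, 0)] s j ↔
      ∃ x y, I.G.Adj x y ∧ ∃ z < I.n, ∃ w < I.n, φ x y z w := by
  rw [← h.exists_edge fun x y => ∃ z < I.n, ∃ w < I.n, φ x y z w]
  simp only [Hits, h.var_m]
  refine exists_congr fun i => and_congr_right fun hi => ?_
  have hi8 := h.inside.setVar (x := 8) le_rfl i
  rw [hi8.var_n, ← exists_or]
  refine exists_congr fun z => ?_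
  rw [← and_or_left]
  refine and_congr_right fun hz => ?_
  have hi9 := hi8.setVar (x := 9) (by omega) z
  rw [hi9.var_n, ← exists_or]
  refine exists_congr fun w => ?_
  rw [← and_or_left]
  refine and_congr_right fun hw => ?_
  have := h.edge_or hφ hi (hi9.setVar (x := 10) (by omega) w) (by simp [State.setVar])
    (by simpa [State.setVar] using ⟨hz, hw⟩)
  simpa [State.setVar] using this

theorem Ready.hits_one (h : Ready I m ex ey a s) {body : List (Expr × Expr)} {j : ℕ}
    {φ : ℕ → Prop} (hφ : ∀ σ, Inside I s σ → σ.var 8 < I.n →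
      ((∃ c ∈ body, 0 < c.1.eval σ ∧ c.2.eval σ = j) ↔ φ (σ.var 8))) :
    Hits body [(8, 0)] s j ↔ ∃ u < I.n, φ u := by
  simp only [Hits, h.var_n]
  refine exists_congr fun u => and_congr_right fun hu => ?_
  have := hφ _ (h.inside.setVar (x := 8) le_rfl u) (by simpa [State.setVar] using hu)
  simpa [State.setVar] using this

theorem Ready.hits_two (h : Ready I m ex ey a s) {body : List (Expr × Expr)} {j : ℕ}
    {φ : ℕ → ℕ → Prop} (hφ : ∀ σ, Inside I s σ → σ.var 8 < I.n → σ.var 9 < I.n →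
      ((∃ c ∈ body, 0 < c.1.eval σ ∧ c.2.eval σ = j) ↔ φ (σ.var 8) (σ.var 9))) :
    Hits body [(8, 0), (9, 0)] s j ↔ ∃ u < I.n, ∃ v < I.n, φ u v := by
  simp only [Hits, h.var_n]
  refine exists_congr fun u => and_congr_right fun hu => ?_
  have h8 := h.inside.setVar (x := 8) le_rfl u
  rw [h8.var_n]
  refine exists_congr fun v => and_congr_right fun hv => ?_
  have := hφ _ (h8.setVar (x := 9) (by omega) v) (by simpa [State.setVar] using hu)
    (by simpa [State.setVar] using hv)
  simpa [State.setVar] using this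

theorem idx_inj {n x y x' y' : ℕ} (hy : y < n) (hy' : y' < n) :
    x * n + y = x' * n + y' ↔ x = x' ∧ y = y' := by
  constructor
  · intro h
    have h1 : (x * n + y) / n = (x' * n + y') / n := by rw [h]
    have h2 : (x * n + y) % n = (x' * n + y') % n := by rw [h]
    have hn : 0 < n := by omega
    rw [mul_comm x, mul_comm x', Nat.mul_add_div hn, Nat.mul_add_div hn, Nat.div_eq_of_lt hy,
      Nat.div_eq_of_lt hy'] at h1
    rw [mul_comm x, mul_comm x', Nat.mul_add_mod, Nat.mul_add_mod, Nat.mod_eq_of_lt hy,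
      Nat.mod_eq_of_lt hy'] at h2
    exact ⟨by simpa using h1, h2⟩
  · rintro ⟨rfl, rfl⟩; rfl

/-! #### Adjacency and the core -/

/-- Adjacency matrix. -/
def progAdj : LProg := LProg.countNest 2
  (edgeBody fun X Y => [(.const 1, .idx2 X Y)]) [(8, 2)]

/-- Vertices whose neighbourhood contains an induced path, with one edge of the path running over
the edges of the graph, its third vertex in register `9` and the vertex in register `10`. -/
def progPath : LProg := LProg.countNest 3
  (edgeBody fun X Y => [(.and (.get2 2 (.var 10) X) (.and (.get2 2 (.var 10) Y)
    (.and (.get2 2 (.var 10) (.var 9)) (.and (.get2 2 Y (.var 9))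
    (.and (.ne X (.var 9)) (.not (.get2 2 X (.var 9))))))), .var 10)]) [(8, 2), (9, 0), (10, 0)]

/-- Neighbours `x` of `u` that are not local minima: a smaller vertex, in register `9`, is adjacent
to both. -/
def progNonMin : LProg := LProg.countNest 4
  (edgeBody fun X Y => [(.and (.get2 2 X (.var 9)) (.and (.get2 2 (.var 9) Y)
    (.lt (.var 9) Y)), .idx2 X Y)]) [(8, 2), (9, 0)]

def progCountMin : LProg := LProg.countNest 5
  [(.and (.get2 2 (.var 8) (.var 9)) (.not (.get2 4 (.var 8) (.var 9))), .var 8)]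
  [(8, 0), (9, 0)]

def progCore : LProg := LProg.countNest 6
  [(.or (.get 3 (.var 8)) (.lt (.var 1) (.get 5 (.var 8))), .var 8)] [(8, 0)]

theorem Ready.run_progAdj (h : Ready I m ex ey 2 s) : Ready I m ex ey 3 (progAdj.run s) := by
  refine h.countNest le_rfl (by decide) (by decide) fun f hf x hx y hy => ?_
  rw [hf, count_pos_iff, h.hits_edge (φ := fun u v => u * I.n + v = x * I.n + y)]
  · constructor
    · rintro ⟨u, v, huv, h'⟩
      obtain ⟨rfl, rfl⟩ := (idx_inj (I.lt_of_adj' huv) hy).1 h'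
      exact huv
    · exact fun h' => ⟨x, y, h', rfl⟩
  · intro X Y σ hσ _ _ _
    simp [Expr.idx2, Expr.eval, hσ.var_n]

theorem Ready.run_progPath (h : Ready I m ex ey 3 s) : Ready I m ex ey 4 (progPath.run s) := by
  have h2 : ∀ x < I.n, ∀ y < I.n, 0 < s.arr 2 (x * I.n + y) ↔ I.G.Adj x y :=
    h.fact 2 le_rfl (by omega)
  refine h.countNest (by omega) (by decide) (by decide) fun f hf u hu => ?_
  rw [hf, count_pos_iff, h.hits_edge2 (φ := fun x y z w => (I.G.Adj w x ∧ I.G.Adj w y ∧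
    I.G.Adj w z ∧ I.G.Adj y z ∧ x ≠ z ∧ ¬ I.G.Adj x z) ∧ w = u)]
  · constructor
    · rintro ⟨x, y, hxy, z, -, w, -, ⟨h1, h2, h3, h4, h5, h6⟩, rfl⟩
      exact ⟨x, y, z, h1, h2, h3, hxy, h4, h5, h6⟩
    · rintro ⟨x, y, z, h1, h2, h3, h4, h5, h6, h7⟩
      exact ⟨x, y, h4, z, I.lt_of_adj' h5, u, hu, ⟨h1, h2, h3, h5, h6, h7⟩, rfl⟩
  · intro X Y σ hσ hX hY hR
    simp only [List.mem_cons, List.not_mem_nil, or_false, forall_eq_or_imp, forall_eq] at hR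
    simp [Expr.get2, Expr.eval, hσ.var_n, hσ.arr, h2, hX, hY, hR.1, hR.2]

theorem Ready.run_progNonMin (h : Ready I m ex ey 4 s) :
    Ready I m ex ey 5 (progNonMin.run s) := by
  have h2 : ∀ x < I.n, ∀ y < I.n, 0 < s.arr 2 (x * I.n + y) ↔ I.G.Adj x y :=
    h.fact 2 le_rfl (by omega)
  refine h.countNest (by omega) (by decide) (by decide) fun f hf u hu x hx => ?_
  rw [hf, count_pos_iff, h.hits_edge1 (φ := fun v w y => (I.G.Adj v y ∧ I.G.Adj y w ∧ y < w) ∧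
    v * I.n + w = u * I.n + x)]
  · constructor
    · rintro ⟨v, w, hvw, y, -, ⟨h1, h2, h3⟩, h'⟩
      obtain ⟨rfl, rfl⟩ := (idx_inj (I.lt_of_adj' hvw) hx).1 h'
      exact ⟨hvw, y, h1, h2, h3⟩
    · rintro ⟨hux, y, h1, h2, h3⟩
      exact ⟨u, x, hux, y, I.lt_of_adj' h1, ⟨h1, h2, h3⟩, rfl⟩
  · intro X Y σ hσ hX hY hR
    simp only [List.mem_cons, List.not_mem_nil, or_false, forall_eq] at hR
    simp [Expr.get2, Expr.idx2, Expr.eval, hσ.var_n, hσ.arr, h2, hX, hY, hR]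

theorem Ready.run_progCountMin (h : Ready I m ex ey 5 s) :
    Ready I m ex ey 6 (progCountMin.run s) := by
  classical
  have h2 : ∀ x < I.n, ∀ y < I.n, 0 < s.arr 2 (x * I.n + y) ↔ I.G.Adj x y :=
    h.fact 2 le_rfl (by omega)
  have h4 : ∀ u < I.n, ∀ x < I.n, 0 < s.arr 4 (u * I.n + x) ↔
      I.G.Adj u x ∧ ∃ y, I.G.Adj u y ∧ I.G.Adj y x ∧ y < x := h.fact 4 (by omega) (by omega)
  refine h.countNest (by omega) (by decide) (by decide) fun f hf u hu => ?_
  have hcell : ∀ v < I.n, ∀ x < I.n, (if 0 < s.arr 2 (v * I.n + x) ∧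
      ¬ 0 < s.arr 4 (v * I.n + x) ∧ v = u then 1 else 0) =
      if v = u then (if I.LocalMin u x then 1 else 0) else 0 := by
    intro v hv x hx
    by_cases hvu : v = u
    · subst hvu
      have : (0 < s.arr 2 (v * I.n + x) ∧ ¬ 0 < s.arr 4 (v * I.n + x) ∧ v = v) ↔
          I.LocalMin v x := by
        rw [h2 v hv x hx, h4 v hv x hx, Instance.LocalMin]
        constructor
        · rintro ⟨h1, h2, -⟩
          exact ⟨h1, fun y hy hyx hlt => h2 ⟨h1, y, hy, hyx, hlt⟩⟩
        · rintro ⟨h1, h2⟩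
          exact ⟨h1, fun ⟨_, y, hy, hyx, hlt⟩ => h2 y hy hyx hlt, rfl⟩
      rw [if_pos rfl]
      exact if_congr this rfl rfl
    · simp [hvu]
  have hcount : f u = ∑ v ∈ Finset.range I.n, ∑ x ∈ Finset.range I.n,
      if v = u then (if I.LocalMin u x then 1 else 0) else 0 := by
    rw [hf]
    simp only [count, h.var_n, State.setVar]
    refine Finset.sum_congr rfl fun v hv => ?_
    have e0 : Function.update s.var 8 v 0 = I.n := by simp [h.var_n]
    rw [e0]
    refine Finset.sum_congr rfl fun x hx => ?_
    rw [← hcell v (Finset.mem_range.1 hv) x (Finset.mem_range.1 hx)]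
    simp [Expr.get2, Expr.eval, h.var_n, and_assoc]
  show f u = _
  rw [hcount]
  simp only [Finset.card_filter]
  rw [Finset.sum_eq_single u]
  · simp
  · intro v _ hv; simp [hv]
  · intro h'; simp at h'; omega

theorem Ready.run_progCore (h : Ready I m ex ey 6 s) : Ready I m ex ey 7 (progCore.run s) := by
  have h3 : ∀ x < I.n, 0 < s.arr 3 x ↔ I.HasInducedPath x := h.fact 3 (by omega) (by omega)
  have h5 : ∀ u < I.n, s.arr 5 u = _ := h.fact 5 (by omega) (by omega)
  refine h.countNest (by omega) (by decide) (by decide) fun f hf u hu => ?_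
  rw [hf, count_pos_iff, h.hits_one (φ := fun v => I.Core v ∧ v = u)]
  · constructor
    · rintro ⟨v, -, h', rfl⟩; exact h'
    · exact fun h' => ⟨u, hu, h', rfl⟩
  · intro σ hσ hu
    simp [Expr.eval, hσ.arr, hσ.var_k, h3 _ hu, h5 _ hu, Instance.Core]

end WordRAM

namespace WordRAM

open LProg

variable {I : Instance} {m : ℕ} {ex ey : ℕ → ℕ} {a : ℕ} {s : State}

/-! #### Triangles and outer vertices -/

/-- A vertex in register `9` completes the edge to a triangle. -/
def progTri : LProg := LProg.countNest 7
  (edgeBody fun X Y =>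
    [(.and (.not (.get 6 X)) (.and (.get2 2 X (.var 9)) (.get2 2 Y (.var 9))), .idx2 X X),
     (.and (.not (.get 6 X)) (.and (.get2 2 X (.var 9)) (.get2 2 Y (.var 9))), .idx2 X Y)])
  [(8, 2), (9, 0)]

def progFreeTri : LProg := LProg.countNest 8
  (edgeBody fun X Y => [(.and (.not (.get 6 Y)) (.and (.not (.get 6 (.var 9)))
    (.and (.get2 2 (.var 9) X) (.get2 2 (.var 9) Y))), .idx2 X Y)]) [(8, 2), (9, 0)]

/-- The edge is `up` in the definition of `Outer`, and `z` is in register `9`. -/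
def progOuter : LProg := LProg.countNest 9
  (edgeBody fun X Y => [(.and (.ne (.var 9) X) (.and (.ne (.var 9) Y) (.or
    (.and (.get2 2 X (.var 9)) (.and (.not (.get2 2 Y (.var 9)))
      (.and (.or (.get 6 Y) (.get2 7 X Y)) (.or (.get 6 (.var 9)) (.get2 7 X (.var 9))))))
    (.and (.get 6 Y) (.and (.get2 2 Y (.var 9)) (.and (.not (.get2 2 X (.var 9)))
      (.or (.get 6 (.var 9)) (.get2 8 Y (.var 9)))))))), X)]) [(8, 2), (9, 0)]

theorem Ready.adj_iff (h : Ready I m ex ey a s) (ha : 3 ≤ a) :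
    ∀ x < I.n, ∀ y < I.n, 0 < s.arr 2 (x * I.n + y) ↔ I.G.Adj x y :=
  h.fact 2 le_rfl (by omega)

theorem Ready.core_iff (h : Ready I m ex ey a s) (ha : 7 ≤ a) :
    ∀ x < I.n, 0 < s.arr 6 x ↔ I.Core x := h.fact 6 (by omega) (by omega)

theorem Ready.tri_iff (h : Ready I m ex ey a s) (ha : 8 ≤ a) :
    ∀ u < I.n, ∀ p < I.n, 0 < s.arr 7 (u * I.n + p) ↔ I.Tri u p :=
  h.fact 7 (by omega) (by omega)

theorem Ready.outer_iff (h : Ready I m ex ey a s) (ha : 10 ≤ a) :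
    ∀ x < I.n, 0 < s.arr 9 x ↔ I.Outer x := h.fact 9 (by omega) (by omega)

theorem Ready.label_eq (h : Ready I m ex ey a s) (ha : 12 ≤ a) :
    ∀ x < I.n, s.arr 11 x = I.label x := h.fact 11 (by omega) (by omega)

theorem Ready.dense_iff (h : Ready I m ex ey a s) (ha : 13 ≤ a) :
    ∀ x < I.n, 0 < s.arr 12 x ↔ I.Dense x := h.fact 12 (by omega) (by omega)

theorem Ready.used_iff (h : Ready I m ex ey a s) (ha : 14 ≤ a) :
    ∀ x < I.n, 0 < s.arr 13 x ↔ I.Used x := h.fact 13 (by omega) (by omega)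

theorem Ready.clashing_iff (h : Ready I m ex ey a s) (ha : 16 ≤ a) :
    ∀ x < I.n, 0 < s.arr 15 x ↔ I.Clashing x := h.fact 15 (by omega) (by omega)

theorem Ready.run_progTri (h : Ready I m ex ey 7 s) : Ready I m ex ey 8 (progTri.run s) := by
  have h2 := h.adj_iff (by omega)
  have h6 := h.core_iff le_rfl
  refine h.countNest (by omega) (by decide) (by decide) fun f hf u hu p hp => ?_
  rw [hf, count_pos_iff, h.hits_edge1 (φ := fun v y z => (¬ I.Core v ∧ I.G.Adj v z ∧ I.G.Adj y z) ∧
    (v * I.n + v = u * I.n + p ∨ v * I.n + y = u * I.n + p))]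
  · constructor
    · rintro ⟨v, y, hvy, z, -, ⟨h1, h2, h3⟩, h' | h'⟩
      · obtain ⟨rfl, rfl⟩ := (idx_inj (I.lt_of_adj _ _ hvy) hp).1 h'
        exact ⟨h1, y, z, hvy, h2, h3, Or.inl rfl⟩
      · obtain ⟨rfl, rfl⟩ := (idx_inj (I.lt_of_adj' hvy) hp).1 h'
        exact ⟨h1, y, z, hvy, h2, h3, Or.inr rfl⟩
    · rintro ⟨h1, y, z, huy, huz, hyz, rfl | rfl⟩
      · exact ⟨p, y, huy, z, I.lt_of_adj' huz, ⟨h1, huz, hyz⟩, Or.inl rfl⟩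
      · exact ⟨u, p, huy, z, I.lt_of_adj' huz, ⟨h1, huz, hyz⟩, Or.inr rfl⟩
  · intro X Y σ hσ hX hY hR
    simp only [List.mem_cons, List.not_mem_nil, or_false, forall_eq] at hR
    simp [Expr.get2, Expr.idx2, Expr.eval, hσ.var_n, hσ.arr, h2, h6, hX, hY, hR,
      -Nat.add_left_cancel_iff, -Nat.add_right_cancel_iff, and_or_left]

theorem Ready.run_progFreeTri (h : Ready I m ex ey 8 s) :
    Ready I m ex ey 9 (progFreeTri.run s) := by
  have h2 := h.adj_iff (by omega)
  have h6 := h.core_iff (by omega)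
  refine h.countNest (by omega) (by decide) (by decide) fun f hf p hp z hz => ?_
  rw [hf, count_pos_iff, h.hits_edge1 (φ := fun q w y => (¬ I.Core w ∧ ¬ I.Core y ∧ I.G.Adj y q ∧
    I.G.Adj y w) ∧ q * I.n + w = p * I.n + z)]
  · constructor
    · rintro ⟨q, w, hqw, y, -, ⟨h1, h2, h3, h4⟩, h'⟩
      obtain ⟨rfl, rfl⟩ := (idx_inj (I.lt_of_adj' hqw) hz).1 h'
      exact ⟨hqw, h1, y, h2, h3, h4⟩
    · rintro ⟨h0, h1, y, h2, h3, h4⟩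
      exact ⟨p, z, h0, y, I.lt_of_adj _ _ h3, ⟨h1, h2, h3, h4⟩, rfl⟩
  · intro X Y σ hσ hX hY hR
    simp only [List.mem_cons, List.not_mem_nil, or_false, forall_eq] at hR
    simp [Expr.get2, Expr.idx2, Expr.eval, hσ.var_n, hσ.arr, h2, h6, hX, hY, hR]

theorem Ready.run_progOuter (h : Ready I m ex ey 9 s) :
    Ready I m ex ey 10 (progOuter.run s) := by
  have h2 := h.adj_iff (by omega)
  have h6 := h.core_iff (by omega)
  have h7 := h.tri_iff (by omega)
  have h8 : ∀ p < I.n, ∀ z < I.n, 0 < s.arr 8 (p * I.n + z) ↔ I.FreeTri p z :=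
    h.fact 8 (by omega) (by omega)
  refine h.countNest (by omega) (by decide) (by decide) fun f hf u hu => ?_
  rw [hf, count_pos_iff, h.hits_edge1 (φ := fun v p z => (z ≠ v ∧ z ≠ p ∧
    ((I.G.Adj v z ∧ ¬ I.G.Adj p z ∧ I.Strong v p ∧ I.Strong v z) ∨
      (I.Core p ∧ I.G.Adj p z ∧ ¬ I.G.Adj v z ∧ (I.Core z ∨ I.FreeTri p z)))) ∧ v = u)]
  · constructor
    · rintro ⟨v, p, hvp, z, -, ⟨h1, h2, h3⟩, rfl⟩
      exact ⟨p, z, h1, h2, hvp, h3⟩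
    · rintro ⟨p, z, h1, h2, hvp, h3⟩
      refine ⟨u, p, hvp, z, ?_, ⟨h1, h2, h3⟩, rfl⟩
      rcases h3 with h3 | h3
      · exact I.lt_of_adj' h3.1
      · exact I.lt_of_adj' h3.2.1
  · intro X Y σ hσ hX hY hR
    simp only [List.mem_cons, List.not_mem_nil, or_false, forall_eq] at hR
    simp [Expr.get2, Expr.eval, hσ.var_n, hσ.arr, h2, h6, h7, h8, hX, hY, hR, Instance.Strong]

/-! #### Classes -/

def progAtt : LProg := LProg.countNest 10
  [(.and (.get 6 (.var 9)) (.or (.eq (.var 9) (.var 8)) (.get2 2 (.var 8) (.var 9))), .var 8)]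
  [(8, 0), (9, 0)]

/-- The condition that the vertex in register `9` may name the class of that in register `8`. -/
def candExpr : Expr :=
  .and (.not (.get 9 (.var 8))) (.or
    (.and (.get 10 (.var 8)) (.and (.get 6 (.var 9))
      (.or (.eq (.var 9) (.var 8)) (.get2 2 (.var 8) (.var 9)))))
    (.and (.not (.get 10 (.var 8))) (.and (.get2 7 (.var 8) (.var 9)) (.not (.get 9 (.var 9))))))

/-- The name of each class is the last candidate, and `n` if there is none. -/
def progLabel : LProg :=
  .loop 8 0 (.seq (.put 11 (.var 8) (.var 0))
    (.loop 9 0 (.ifPos candExpr (.put 11 (.var 8) (.var 9)) .skip)))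

def progDense : LProg := LProg.countNest 12
  (edgeBody fun X Y => [(.and (.not (.get 6 X)) (.and (.not (.get 6 Y))
    (.and (.eq (.get 11 X) (.get 11 Y)) (.lt (.get 11 X) (.var 0)))), X)]) [(8, 2)]

def progUsed : LProg := LProg.countNest 13
  [(.lt (.get 11 (.var 8)) (.var 0), .get 11 (.var 8))] [(8, 0)]

def progCountUsed : LProg := LProg.countNest 14 [(.get 13 (.var 8), .const 0)] [(8, 0)]

theorem Ready.run_progAtt (h : Ready I m ex ey 10 s) : Ready I m ex ey 11 (progAtt.run s) := by
  have h2 := h.adj_iff (by omega)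
  have h6 := h.core_iff (by omega)
  refine h.countNest (by omega) (by decide) (by decide) fun f hf u hu => ?_
  rw [hf, count_pos_iff, h.hits_two (φ := fun v p => I.Att v p ∧ v = u)]
  · constructor
    · rintro ⟨v, -, p, -, h1, rfl⟩
      exact ⟨p, h1⟩
    · rintro ⟨p, h1⟩
      exact ⟨u, hu, p, h1.1.lt, h1, rfl⟩
  · intro σ hσ h8 h9
    simp [Expr.get2, Expr.eval, hσ.var_n, hσ.arr, h2, h6, h8, h9, Instance.Att]

theorem Ready.run_progLabel (h : Ready I m ex ey 11 s) :
    Ready I m ex ey 12 (progLabel.run s) := by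
  classical
  have h2 := h.adj_iff (by omega)
  have h6 := h.core_iff (by omega)
  have h7 := h.tri_iff (by omega)
  have h9 := h.outer_iff (by omega)
  have h10 : ∀ u < I.n, 0 < s.arr 10 u ↔ ∃ a, I.Att u a := h.fact 10 (by omega) (by omega)
  -- states that differ from `s` in array `11` and registers from `8` on only
  let Q : State → Prop := fun σ => (∀ x < 8, σ.var x = s.var x) ∧ ∀ b, b ≠ 11 → σ.arr b = s.arr b
  have hcand : ∀ σ, Q σ → σ.var 8 < I.n → σ.var 9 < I.n →
      (0 < candExpr.eval σ ↔ I.Cand (σ.var 8) (σ.var 9)) := by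
    intro σ hσ h8 h9'
    have hv : σ.var 0 = I.n := (hσ.1 0 (by omega)).trans h.var_n
    simp only [candExpr, Expr.pos_and, Expr.pos_or, Expr.pos_not, Expr.pos_eq, Expr.get2,
      Expr.eval, hv, hσ.2 2 (by omega), hσ.2 6 (by omega), hσ.2 7 (by omega),
      hσ.2 9 (by omega), hσ.2 10 (by omega), h2 _ h8 _ h9', h6 _ h9', h7 _ h8 _ h9', h9 _ h8,
      h9 _ h9', h10 _ h8, Instance.Cand, Instance.Att]
  let inner : State → State := fun σ =>
    (LProg.ifPos candExpr (.put 11 (.var 8) (.var 9)) .skip).run σ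
  have hinner : ∀ u < I.n, ∀ σ, Q σ → σ.var 8 = u → ∀ i ≤ I.n,
      Q (iter inner 9 i (σ.setArr 11 u I.n)) ∧
      (iter inner 9 i (σ.setArr 11 u I.n)).var 8 = u ∧
      (iter inner 9 i (σ.setArr 11 u I.n)).arr 11 =
        Function.update (σ.arr 11) u (lastSat (I.Cand u) I.n i) := by
    intro u hu σ hσ h8 i
    induction i with
    | zero =>
      refine fun _ => ⟨⟨fun x hx => ?_, fun b hb => ?_⟩, ?_, ?_⟩
      · simp only [iter, State.setVar, State.setArr]
        rw [Function.update_of_ne (by omega)]; exact hσ.1 x hx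
      · simp only [iter, State.setVar, State.setArr]
        rw [Function.update_of_ne hb]; exact hσ.2 b hb
      · simpa [iter, State.setVar, State.setArr] using h8
      · simp [iter, State.setVar, State.setArr, lastSat]
    | succ i ih =>
      intro hi
      obtain ⟨k1, k2, k3⟩ := ih (by omega)
      set τ := iter inner 9 i (σ.setArr 11 u I.n) with hτ
      have k9 : τ.var 9 = i := iter_self _ _ _ _
      have hc := hcand τ k1 (by omega) (by omega)
      rw [k2, k9] at hc
      have hrun : inner τ = if I.Cand u i then τ.setArr 11 u i else τ := by
        simp only [inner, LProg.run, Expr.eval, k2, k9]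
        exact if_congr hc rfl rfl
      have hvar : (inner τ).var = τ.var := by rw [hrun]; split_ifs <;> rfl
      refine ⟨⟨fun x hx => ?_, fun b hb => ?_⟩, ?_, ?_⟩
      · simp only [iter, State.setVar]
        rw [Function.update_of_ne (by omega), ← hτ, hvar]; exact k1.1 x hx
      · simp only [iter, State.setVar]
        rw [← hτ, hrun]
        split_ifs
        · simp only [State.setArr]
          rw [Function.update_of_ne hb]; exact k1.2 b hb
        · exact k1.2 b hb
      · simp only [iter, State.setVar]
        rw [Function.update_of_ne (by omega), ← hτ, hvar]; exact k2
      · simp only [iter, State.setVar, lastSat]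
        rw [← hτ, hrun]
        split_ifs
        · simp [State.setArr, k3]
        · exact k3
  let outer : State → State := fun σ => (LProg.seq (.put 11 (.var 8) (.var 0))
    (.loop 9 0 (.ifPos candExpr (.put 11 (.var 8) (.var 9)) .skip))).run σ
  have houter : ∀ i ≤ I.n, Q (iter outer 8 i s) ∧
      ∀ u < i, (iter outer 8 i s).arr 11 u = I.label u := by
    intro i
    induction i with
    | zero =>
      refine fun _ => ⟨⟨fun x hx => ?_, fun b _ => rfl⟩, fun u hu => absurd hu (Nat.not_lt_zero u)⟩
      simp only [iter, State.setVar]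
      rw [Function.update_of_ne (by omega)]
    | succ i ih =>
      intro hi
      obtain ⟨k1, k2⟩ := ih (by omega)
      set τ := iter outer 8 i s with hτ
      have k8 : τ.var 8 = i := iter_self _ _ _ _
      have k0 : τ.var 0 = I.n := (k1.1 0 (by omega)).trans h.var_n
      have hrun : outer τ = iter inner 9 I.n (τ.setArr 11 i I.n) := by
        have e0 : (τ.setArr 11 i I.n).var 0 = I.n := k0
        simp only [outer, LProg.run, Expr.eval, k8, k0, e0]
        rfl
      obtain ⟨j1, j2, j3⟩ := hinner i (by omega) τ k1 k8 I.n le_rfl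
      refine ⟨⟨fun x hx => ?_, fun b hb => ?_⟩, fun u hu => ?_⟩
      · simp only [iter, State.setVar]
        rw [Function.update_of_ne (by omega), ← hτ, hrun]; exact j1.1 x hx
      · simp only [iter, State.setVar]
        rw [← hτ, hrun]; exact j1.2 b hb
      · simp only [iter, State.setVar]
        rw [← hτ, hrun, j3]
        by_cases hui : u = i
        · subst hui; simp [Instance.label]
        · rw [Function.update_of_ne hui]
          exact k2 u (by omega)
  have hfin : progLabel.run s = iter outer 8 I.n s := by
    simp only [progLabel, LProg.run, h.var_n]
    rfl
  rw [hfin]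
  obtain ⟨k1, k2⟩ := houter I.n le_rfl
  exact h.step (by omega) k1.1 k1.2 k2

theorem Ready.run_progDense (h : Ready I m ex ey 12 s) :
    Ready I m ex ey 13 (progDense.run s) := by
  have h6 := h.core_iff (by omega)
  have h11 := h.label_eq (by omega)
  refine h.countNest (by omega) (by decide) (by decide) fun f hf u hu => ?_
  rw [hf, count_pos_iff, h.hits_edge (φ := fun x y => (¬ I.Core x ∧ ¬ I.Core y ∧
    I.label x = I.label y ∧ I.label x < I.n) ∧ x = u)]
  · constructor
    · rintro ⟨x, y, hxy, ⟨h1, h2, h3, h4⟩, rfl⟩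
      exact ⟨h1, y, hxy, h2, h3, h4⟩
    · rintro ⟨h1, y, hxy, h2, h3, h4⟩
      exact ⟨u, y, hxy, ⟨h1, h2, h3, h4⟩, rfl⟩
  · intro X Y σ hσ hX hY _
    simp [Expr.eval, hσ.var_n, hσ.arr, h6, h11, hX, hY]

theorem Ready.run_progUsed (h : Ready I m ex ey 13 s) : Ready I m ex ey 14 (progUsed.run s) := by
  have h11 := h.label_eq (by omega)
  refine h.countNest (by omega) (by decide) (by decide) fun f hf p hp => ?_
  rw [hf, count_pos_iff, h.hits_one (φ := fun u => I.label u < I.n ∧ I.label u = p)]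
  · constructor
    · rintro ⟨u, -, -, h2⟩
      exact ⟨hp, u, h2⟩
    · rintro ⟨-, u, rfl⟩
      refine ⟨u, ?_, hp, rfl⟩
      rcases (Instance.cand_label hp).2 with h' | h'
      · exact h'.2.lt
      · exact h'.2.1.lt.1
  · intro σ hσ hu
    simp [Expr.eval, hσ.var_n, hσ.arr, h11, hu]

/-- Counting the positive cells of array `b`. -/
theorem Ready.count_eq_card (h : Ready I m ex ey a s) {b : ℕ} {P : ℕ → Prop} [DecidablePred P]
    (hb : ∀ x < I.n, 0 < s.arr b x ↔ P x) :
    count [(.get b (.var 8), .const 0)] [(8, 0)] s 0 = ((Finset.range I.n).filter P).card := by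
  rw [Finset.card_filter]
  simp only [count, h.var_n]
  refine Finset.sum_congr rfl fun x hx => ?_
  simp [Expr.eval, State.setVar, hb x (Finset.mem_range.1 hx)]

theorem Ready.run_progCountUsed (h : Ready I m ex ey 14 s) :
    Ready I m ex ey 15 (progCountUsed.run s) := by
  classical
  refine h.countNest (by omega) (by decide) (by decide) fun f hf => ?_
  exact (hf 0).trans (h.count_eq_card (h.used_iff le_rfl))

/-! #### Clashes and the verdict -/

def progClashing : LProg := LProg.countNest 15
  (edgeBody fun X Y => [(.and (.not (.get 6 X)) (.and (.not (.get 6 Y))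
    (.and (.or (.and (.get 12 X) (.get 12 Y)) (.and (.not (.get 12 X)) (.not (.get 12 Y))))
      (.not (.and (.get 12 X) (.eq (.get 11 X) (.get 11 Y)))))), X)]) [(8, 2)]

def progCountClashing : LProg := LProg.countNest 16 [(.get 15 (.var 8), .const 0)] [(8, 0)]

def progInconsistent : LProg := LProg.countNest 17
  [(.and (.get 6 (.var 8)) (.get 9 (.var 8)), .const 0)] [(8, 0)]

def progExistsOuter : LProg := LProg.countNest 18 [(.get 9 (.var 8), .const 0)] [(8, 0)]

theorem Ready.run_progClashing (h : Ready I m ex ey 15 s) :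
    Ready I m ex ey 16 (progClashing.run s) := by
  have h6 := h.core_iff (by omega)
  have h11 := h.label_eq (by omega)
  have h12 := h.dense_iff (by omega)
  refine h.countNest (by omega) (by decide) (by decide) fun f hf u hu => ?_
  rw [hf, count_pos_iff, h.hits_edge (φ := fun x y => (¬ I.Core x ∧ ¬ I.Core y ∧
    (I.Dense x ↔ I.Dense y) ∧ ¬ (I.Dense x ∧ I.label x = I.label y)) ∧ x = u)]
  · constructor
    · rintro ⟨x, y, hxy, h1, rfl⟩
      exact ⟨y, hxy, h1⟩
    · rintro ⟨y, hxy, h1⟩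
      exact ⟨u, y, hxy, h1, rfl⟩
  · intro X Y σ hσ hX hY _
    simp only [List.mem_cons, List.not_mem_nil, or_false, exists_eq_left, Expr.pos_and,
      Expr.pos_or, Expr.pos_not, Expr.pos_eq, Expr.eval, hσ.arr, h6 _ hX, h6 _ hY, h11 _ hX,
      h11 _ hY, h12 _ hX, h12 _ hY, ← iff_iff_and_or_not_and_not]

theorem Ready.run_progCountClashing (h : Ready I m ex ey 16 s) :
    Ready I m ex ey 17 (progCountClashing.run s) := by
  classical
  refine h.countNest (by omega) (by decide) (by decide) fun f hf => ?_
  exact (hf 0).trans (h.count_eq_card (h.clashing_iff le_rfl))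

theorem _root_.Instance.Outer.lt {u : ℕ} (h : I.Outer u) : u < I.n := by
  obtain ⟨p, z, -, -, h, -⟩ := h
  exact I.lt_of_adj _ _ h

theorem Ready.run_progInconsistent (h : Ready I m ex ey 17 s) :
    Ready I m ex ey 18 (progInconsistent.run s) := by
  have h6 := h.core_iff (by omega)
  have h9 := h.outer_iff (by omega)
  refine h.countNest (by omega) (by decide) (by decide) fun f hf => ?_
  show 0 < f 0 ↔ _
  rw [hf, count_pos_iff, h.hits_one (φ := fun u => I.Core u ∧ I.Outer u)]
  · simp only [Instance.Consistent, not_forall, not_not]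
    constructor
    · rintro ⟨u, -, h1, h2⟩
      exact ⟨u, h1, h2⟩
    · rintro ⟨u, h1, h2⟩
      exact ⟨u, h1.lt, h1, h2⟩
  · intro σ hσ hu
    simp [Expr.eval, hσ.arr, h6, h9, hu]

theorem Ready.run_progExistsOuter (h : Ready I m ex ey 18 s) :
    Ready I m ex ey 19 (progExistsOuter.run s) := by
  have h9 := h.outer_iff (by omega)
  refine h.countNest (by omega) (by decide) (by decide) fun f hf => ?_
  show 0 < f 0 ↔ _
  rw [hf, count_pos_iff, h.hits_one (φ := fun u => I.Outer u)]
  · constructor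
    · rintro ⟨u, -, h1⟩
      exact ⟨u, h1⟩
    · rintro ⟨u, h1⟩
      exact ⟨u, h1.lt, h1⟩
  · intro σ hσ hu
    simp [Expr.eval, hσ.arr, h9, hu]

end WordRAM

/-! #### Tied parts -/

namespace Instance

variable {I : Instance}

open Classical in
variable (I) in
/-- Add `y` to `S` if it is tied to the element `x` of `S` and `S` is not yet full. -/
noncomputable def growStep (S : Finset ℕ) (x y : ℕ) : Finset ℕ :=
  if x ∈ S ∧ y ∉ S ∧ I.Tied x y ∧ S.card < 2 * I.k + 1 then insert y S else S

variable (I) in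
/-- One scan over the first `i` edges, in both orientations. -/
noncomputable def growPass (ex ey : ℕ → ℕ) : ℕ → Finset ℕ → Finset ℕ
  | 0, S => S
  | i + 1, S => I.growStep (I.growStep (growPass ex ey i S) (ex i) (ey i)) (ey i) (ex i)

variable (I) in
/-- The set reached from `w` after `j` scans over `m` edges. -/
noncomputable def grow (m : ℕ) (ex ey : ℕ → ℕ) (w : ℕ) : ℕ → Finset ℕ
  | 0 => {w}
  | j + 1 => I.growPass ex ey m (grow m ex ey w j)

theorem subset_growStep (S : Finset ℕ) (x y : ℕ) : S ⊆ I.growStep S x y := by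
  unfold growStep
  split_ifs
  · exact Finset.subset_insert _ _
  · exact Finset.Subset.refl _

theorem growPass_mono {ex ey : ℕ → ℕ} (S : Finset ℕ) {i j : ℕ} (hij : i ≤ j) :
    I.growPass ex ey i S ⊆ I.growPass ex ey j S := by
  induction j with
  | zero => simp [Nat.le_zero.1 hij]
  | succ j ih =>
    rcases Nat.le_succ_iff.1 hij with h | rfl
    · exact (ih h).trans ((subset_growStep _ _ _).trans (subset_growStep _ _ _))
    · exact Finset.Subset.refl _

theorem growStep_induction {p : Finset ℕ → Prop} {S : Finset ℕ} (hS : p S) (x y : ℕ)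
    (h : x ∈ S → y ∉ S → I.Tied x y → S.card < 2 * I.k + 1 → p (insert y S)) :
    p (I.growStep S x y) := by
  unfold growStep
  split_ifs with hc
  · exact h hc.1 hc.2.1 hc.2.2.1 hc.2.2.2
  · exact hS

theorem grow_induction {p : Finset ℕ → Prop} {m : ℕ} {ex ey : ℕ → ℕ} {w : ℕ} (h0 : p {w})
    (h : ∀ S x y, p S → x ∈ S → y ∉ S → I.Tied x y → S.card < 2 * I.k + 1 → p (insert y S))
    (j : ℕ) : p (I.grow m ex ey w j) := by
  have hstep : ∀ S x y, p S → p (I.growStep S x y) := fun S x y hS =>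
    growStep_induction hS x y (h S x y hS)
  have hpass : ∀ i S, p S → p (I.growPass ex ey i S) := by
    intro i
    induction i with
    | zero => exact fun S hS => hS
    | succ i ih => exact fun S hS => hstep _ _ _ (hstep _ _ _ (ih S hS))
  induction j with
  | zero => exact h0
  | succ j ih => exact hpass m _ ih

theorem closed_of_growPass_eq {m : ℕ} {ex ey : ℕ → ℕ}
    (hadj : ∀ x y, I.G.Adj x y ↔ ∃ i < m, (ex i = x ∧ ey i = y) ∨ (ey i = x ∧ ex i = y))
    {S : Finset ℕ} (hS : I.growPass ex ey m S = S) (hcard : S.card < 2 * I.k + 1) :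
    ∀ x ∈ S, ∀ y, I.Tied x y → y ∈ S := by
  intro x hx y hxy
  by_contra hy
  have hsame : ∀ i ≤ m, I.growPass ex ey i S = S := fun i hi =>
    (Finset.Subset.antisymm ((growPass_mono S hi).trans_eq hS)
      (growPass_mono (i := 0) S (Nat.zero_le i)))
  have hfix : I.growStep S x y = S → False := by
    intro h
    rw [growStep, if_pos ⟨hx, hy, hxy, hcard⟩] at h
    exact hy (by rw [← h]; exact Finset.mem_insert_self _ _)
  obtain ⟨i, hi, ⟨rfl, rfl⟩ | ⟨rfl, rfl⟩⟩ := (hadj x y).1 hxy.1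
  · have h1 := hsame (i + 1) hi
    rw [growPass, hsame i hi.le] at h1
    exact hfix (Finset.Subset.antisymm ((subset_growStep _ _ _).trans_eq h1)
      (subset_growStep _ _ _))
  · have h1 := hsame (i + 1) hi
    rw [growPass, hsame i hi.le] at h1
    have h2 : I.growStep S (ex i) (ey i) = S := Finset.Subset.antisymm
      ((subset_growStep _ _ _).trans_eq h1) (subset_growStep _ _ _)
    rw [h2] at h1
    exact hfix h1

theorem grow_subset {m : ℕ} {ex ey : ℕ → ℕ} {w : ℕ} (hw : w < I.n) (j : ℕ) :
    I.grow m ex ey w j ⊆ Finset.range I.n := by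
  refine grow_induction (p := fun S => S ⊆ Finset.range I.n) (by simpa using hw) ?_ j
  intro S x y hS _ _ hxy _
  exact Finset.insert_subset (Finset.mem_range.2 (I.lt_of_adj' hxy.1)) hS

/-- After `n` scans the set reached is a tied part: as long as a scan changes it, it gains a
vertex. -/
theorem isTiedPart_grow {m : ℕ} {ex ey : ℕ → ℕ}
    (hadj : ∀ x y, I.G.Adj x y ↔ ∃ i < m, (ex i = x ∧ ey i = y) ∨ (ey i = x ∧ ex i = y))
    {w : ℕ} (hw : w < I.n) : I.IsTiedPart w (I.grow m ex ey w I.n) := by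
  have hcard : ∀ j, (I.grow m ex ey w j).card ≤ 2 * I.k + 1 :=
    grow_induction (p := fun S => S.card ≤ 2 * I.k + 1) (by simp) fun S x y _ _ hy _ h => by
      rw [Finset.card_insert_of_notMem hy]; omega
  refine ⟨?_, ?_, hcard _, ?_⟩
  · exact grow_induction (p := fun S => w ∈ S) (by simp)
      (fun S x y h _ _ _ _ => Finset.mem_insert_of_mem h) _
  · intro P hP
    refine grow_induction (p := fun S => (∀ x ∈ S, ∀ y ∈ S, I.Tied x y → P x → P y) →
      ∀ v ∈ S, P v) ?_ ?_ _
    · intro _ v hv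
      rwa [Finset.mem_singleton.1 hv]
    · intro S x y ih hx hy hxy _ hcl
      have hS := ih fun a ha b hb => hcl a (Finset.mem_insert_of_mem ha) b
        (Finset.mem_insert_of_mem hb)
      intro v hv
      rcases Finset.mem_insert.1 hv with rfl | hv
      · exact hcl x (Finset.mem_insert_of_mem hx) v (Finset.mem_insert_self _ _) hxy (hS x hx)
      · exact hS v hv
  · have hprog : ∀ j, j + 1 ≤ (I.grow m ex ey w j).card ∨
        I.growPass ex ey m (I.grow m ex ey w j) = I.grow m ex ey w j := by
      intro j
      induction j with
      | zero => exact Or.inl (by simp [grow])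
      | succ j ih =>
        rcases ih with ih | ih
        · by_cases heq : I.growPass ex ey m (I.grow m ex ey w j) = I.grow m ex ey w j
          · exact Or.inr (by rw [grow, heq, heq])
          · refine Or.inl ?_
            have := Finset.card_lt_card ((growPass_mono (I := I) (ex := ex) (ey := ey)
              (I.grow m ex ey w j) (Nat.zero_le m)).ssubset_of_ne (Ne.symm heq))
            simp only [growPass] at this
            rw [grow]
            omega
        · exact Or.inr (by rw [grow, ih, ih])
    have hn := Finset.card_le_card (grow_subset (I := I) (m := m) (ex := ex) (ey := ey) hw I.n)
    rw [Finset.card_range] at hn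
    rcases Nat.lt_or_ge (I.grow m ex ey w I.n).card (2 * I.k + 1) with hlt | hge
    · refine Or.inr (closed_of_growPass_eq hadj ((hprog I.n).resolve_left (by omega)) hlt)
    · exact Or.inl (le_antisymm (hcard _) hge)

end Instance

namespace WordRAM

open LProg

variable {I : Instance} {m : ℕ} {ex ey : ℕ → ℕ} {a : ℕ} {s : State}

/-- Add the vertex `Y` to row `8` if it is tied to the vertex `X` of that row. The number of
elements of the row is kept in register `11`. -/
def growCmd (X Y : Expr) : LProg :=
  .ifPos (.and (.get2 19 (.var 8) X) (.and (.not (.get2 19 (.var 8) Y))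
    (.and (.and (.not (.get 6 X)) (.and (.not (.get 6 Y))
      (.or (.and (.get 12 X) (.not (.get 12 Y))) (.and (.not (.get 12 X)) (.get 12 Y)))))
      (.lt (.var 11) (.add (.mul (.const 2) (.var 1)) (.const 1))))))
    (.seq (.put 19 (.idx2 (.var 8) Y) (.const 1)) (.set 11 (.add (.var 11) (.const 1)))) .skip

/-- One scan over the edges, as in `Instance.growPass`. -/
def growScan : LProg := .loop 10 2 (.seq (growCmd (edgeFst 10) (edgeSnd 10))
  (growCmd (edgeSnd 10) (edgeFst 10)))

/-- Row `w` starts as `{w}` and grows along ties in `n` scans. -/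
def progGrow : LProg :=
  .loop 8 0 (.seq (.put 19 (.idx2 (.var 8) (.var 8)) (.const 1)) (.seq (.set 11 (.const 1))
    (.loop 9 0 growScan)))

/-- The state `σ` differs from `s` only in registers from `8` on and in array `19`, where row `w`
represents the set `S` and the other rows agree with `g`. -/
structure GrowState (I : Instance) (s : State) (g : ℕ → ℕ) (w : ℕ) (S : Finset ℕ) (σ : State) :
    Prop where
  var : ∀ x < 8, σ.var x = s.var x
  arr : ∀ b, b ≠ 19 → σ.arr b = s.arr b
  row : σ.var 8 = w
  card : σ.var 11 = S.card
  mem : ∀ v < I.n, 0 < σ.arr 19 (w * I.n + v) ↔ v ∈ S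
  other : ∀ w', w' ≠ w → ∀ v < I.n, σ.arr 19 (w' * I.n + v) = g (w' * I.n + v)

theorem GrowState.setVar {g : ℕ → ℕ} {w : ℕ} {S : Finset ℕ} {σ : State}
    (h : GrowState I s g w S σ) {x : ℕ} (hx : x = 9 ∨ x = 10) (v : ℕ) :
    GrowState I s g w S (σ.setVar x v) where
  var y hy := by
    simp only [State.setVar]; rw [Function.update_of_ne (by omega)]; exact h.var y hy
  arr := h.arr
  row := by simp only [State.setVar]; rw [Function.update_of_ne (by omega)]; exact h.row
  card := by simp only [State.setVar]; rw [Function.update_of_ne (by omega)]; exact h.card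
  mem := h.mem
  other := h.other

theorem GrowState.run_growCmd (h : Ready I m ex ey 19 s) {g : ℕ → ℕ} {w : ℕ} {S : Finset ℕ}
    {σ : State} (hσ : GrowState I s g w S σ) {X Y : Expr} (hXY : I.G.Adj (X.eval σ) (Y.eval σ)) :
    GrowState I s g w (I.growStep S (X.eval σ) (Y.eval σ)) ((growCmd X Y).run σ) ∧
      ((growCmd X Y).run σ).var 10 = σ.var 10 := by
  have hX := I.lt_of_adj _ _ hXY
  have hY := I.lt_of_adj' hXY
  have h6 := h.core_iff (by omega)
  have h12 := h.dense_iff (by omega)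
  have hn : σ.var 0 = I.n := (hσ.var 0 (by omega)).trans h.var_n
  have hk : σ.var 1 = I.k := (hσ.var 1 (by omega)).trans h.var_k
  simp only [growCmd, LProg.run]
  set C : Expr := .and (.get2 19 (.var 8) X) (.and (.not (.get2 19 (.var 8) Y))
    (.and (.and (.not (.get 6 X)) (.and (.not (.get 6 Y))
      (.or (.and (.get 12 X) (.not (.get 12 Y))) (.and (.not (.get 12 X)) (.get 12 Y)))))
      (.lt (.var 11) (.add (.mul (.const 2) (.var 1)) (.const 1))))) with hC
  have hcond : 0 < C.eval σ ↔ X.eval σ ∈ S ∧ Y.eval σ ∉ S ∧ I.Tied (X.eval σ) (Y.eval σ) ∧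
      S.card < 2 * I.k + 1 := by
    simp only [hC, Expr.pos_and, Expr.pos_or, Expr.pos_not, Expr.pos_lt, Expr.get2, Expr.eval,
      hn, hk, hσ.row, hσ.card, hσ.mem _ hX, hσ.mem _ hY, hσ.arr 6 (by omega),
      hσ.arr 12 (by omega), h6 _ hX, h6 _ hY, h12 _ hX, h12 _ hY, Instance.Tied, hXY, true_and]
    tauto
  rw [Instance.growStep]
  by_cases hc : 0 < C.eval σ
  · have hc' := hcond.1 hc
    rw [if_pos hc, if_pos hc']
    have hidx : (Expr.idx2 (.var 8) Y).eval σ = w * I.n + Y.eval σ := by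
      simp only [Expr.idx2, Expr.eval, hσ.row, hn]
    rw [hidx]
    refine ⟨⟨fun x hx => ?_, fun b hb => ?_, ?_, ?_, fun v hv => ?_, fun w' hw v hv => ?_⟩, ?_⟩
    · simp only [State.setVar]; rw [Function.update_of_ne (by omega)]; exact hσ.var x hx
    · simp only [State.setVar, State.setArr]; rw [Function.update_of_ne hb]; exact hσ.arr b hb
    · simp only [State.setVar]; rw [Function.update_of_ne (by omega)]; exact hσ.row
    · rw [Finset.card_insert_of_notMem hc'.2.1, ← hσ.card]
      simp [State.setVar, State.setArr, Expr.eval]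
    · simp only [State.setVar, State.setArr, Function.update_self, Expr.eval, Finset.mem_insert]
      by_cases hvY : v = Y.eval σ
      · simp [hvY]
      · rw [Function.update_of_ne (by omega), hσ.mem v hv]
        simp [hvY]
    · simp only [State.setVar, State.setArr, Function.update_self, Expr.eval]
      rw [Function.update_of_ne, hσ.other w' hw v hv]
      intro h'
      exact hw ((idx_inj hv hY).1 h').1
    · simp [State.setVar, State.setArr]
  · rw [if_neg hc, if_neg (fun h' => hc (hcond.2 h'))]
    exact ⟨hσ, rfl⟩

theorem GrowState.run_growScan (h : Ready I m ex ey 19 s) {g : ℕ → ℕ} {w : ℕ} {S : Finset ℕ}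
    {σ : State} (hσ : GrowState I s g w S σ) :
    GrowState I s g w (I.growPass ex ey m S) (growScan.run σ) := by
  have hm : σ.var 2 = m := (hσ.var 2 (by omega)).trans h.var_m
  simp only [growScan, LProg.run, hm]
  suffices key : ∀ i ≤ m, GrowState I s g w (I.growPass ex ey i S)
      (iter (fun τ => (growCmd (edgeSnd 10) (edgeFst 10)).run
        ((growCmd (edgeFst 10) (edgeSnd 10)).run τ)) 10 i σ) from key m le_rfl
  intro i
  induction i with
  | zero => exact fun _ => hσ.setVar (Or.inr rfl) 0
  | succ i ih =>
    intro hi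
    have k1 := ih (by omega)
    simp only [iter]
    set τ := iter (fun τ => (growCmd (edgeSnd 10) (edgeFst 10)).run
      ((growCmd (edgeFst 10) (edgeSnd 10)).run τ)) 10 i σ
    have e10 : τ.var 10 = i := iter_self _ _ _ _
    have hev : ∀ ρ : State, GrowState I s g w (I.growPass ex ey i S) ρ ∨
        GrowState I s g w (I.growStep (I.growPass ex ey i S) (ex i) (ey i)) ρ → ρ.var 10 = i →
        (edgeFst 10).eval ρ = ex i ∧ (edgeSnd 10).eval ρ = ey i := by
      intro ρ hρ h10
      have h0 : ρ.arr 0 = s.arr 0 := by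
        rcases hρ with hρ | hρ <;> exact hρ.arr 0 (by omega)
      simp only [edgeFst, edgeSnd, Expr.eval, h10, h0]
      exact ⟨h.fst i (by omega), h.snd i (by omega)⟩
    have hadj : I.G.Adj (ex i) (ey i) := (h.adj _ _).2 ⟨i, by omega, Or.inl ⟨rfl, rfl⟩⟩
    obtain ⟨e1, e2⟩ := hev τ (Or.inl k1) e10
    have k2 := k1.run_growCmd h (X := edgeFst 10) (Y := edgeSnd 10) (by rw [e1, e2]; exact hadj)
    rw [e1, e2] at k2
    obtain ⟨e3, e4⟩ := hev _ (Or.inr k2.1) (k2.2.trans e10)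
    have k3 := k2.1.run_growCmd h (X := edgeSnd 10) (Y := edgeFst 10)
      (by rw [e3, e4]; exact hadj.symm)
    rw [e3, e4] at k3
    exact k3.1.setVar (Or.inr rfl) _

theorem Ready.run_progGrow (h : Ready I m ex ey 19 s) : Ready I m ex ey 20 (progGrow.run s) := by
  let body : State → State := fun σ => (LProg.seq (.put 19 (.idx2 (.var 8) (.var 8)) (.const 1))
    (.seq (.set 11 (.const 1)) (.loop 9 0 growScan))).run σ
  have key : ∀ i ≤ I.n, (∀ x < 8, (iter body 8 i s).var x = s.var x) ∧
      (∀ b, b ≠ 19 → (iter body 8 i s).arr b = s.arr b) ∧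
      (∀ w < i, ∀ v < I.n, 0 < (iter body 8 i s).arr 19 (w * I.n + v) ↔
        v ∈ I.grow m ex ey w I.n) ∧
      ∀ w, i ≤ w → ∀ v < I.n, (iter body 8 i s).arr 19 (w * I.n + v) = 0 := by
    intro i
    induction i with
    | zero =>
      refine fun _ => ⟨fun x hx => ?_, fun b _ => rfl, fun w hw => absurd hw (Nat.not_lt_zero w),
        fun w _ v _ => h.zero 19 (Or.inr le_rfl) _⟩
      simp only [iter, State.setVar]
      rw [Function.update_of_ne (by omega)]
    | succ i ih =>
      intro hi
      obtain ⟨k1, k2, k3, k4⟩ := ih (by omega)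
      set τ := iter body 8 i s with hτ
      have k8 : τ.var 8 = i := iter_self _ _ _ _
      have k0 : τ.var 0 = I.n := (k1 0 (by omega)).trans h.var_n
      set ρ := (τ.setArr 19 (i * I.n + i) 1).setVar 11 1 with hρ
      have hrun : body τ = iter growScan.run 9 I.n ρ := by
        have e0 : ρ.var 0 = I.n := by simpa [hρ, State.setVar, State.setArr] using k0
        have e1 : (LProg.set 11 (.const 1)).run ((LProg.put 19 (.idx2 (.var 8) (.var 8))
            (.const 1)).run τ) = ρ := by
          simp only [LProg.run, Expr.idx2, Expr.eval, k8, k0, hρ]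
        have e2 : body τ = (LProg.loop 9 0 growScan).run ((LProg.set 11 (.const 1)).run
          ((LProg.put 19 (.idx2 (.var 8) (.var 8)) (.const 1)).run τ)) := rfl
        rw [e2, e1, LProg.run, e0]
      have hgs : GrowState I s (τ.arr 19) i {i} ρ := by
        refine ⟨fun x hx => ?_, fun b hb => ?_, ?_, ?_, fun v hv => ?_, fun w' hw v hv => ?_⟩
        · simp only [hρ, State.setVar, State.setArr]
          rw [Function.update_of_ne (by omega)]; exact k1 x hx
        · simp only [hρ, State.setVar, State.setArr]
          rw [Function.update_of_ne hb]; exact k2 b hb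
        · simpa [hρ, State.setVar, State.setArr] using k8
        · simp [hρ, State.setVar]
        · simp only [hρ, State.setVar, State.setArr, Function.update_self, Finset.mem_singleton]
          by_cases hvi : v = i
          · simp [hvi]
          · rw [Function.update_of_ne (by omega), k4 i le_rfl v hv]
            simp [hvi]
        · simp only [hρ, State.setVar, State.setArr, Function.update_self]
          rw [Function.update_of_ne]
          intro h'
          exact hw ((idx_inj hv (by omega)).1 h').1
      have hrounds : ∀ j, GrowState I s (τ.arr 19) i (I.grow m ex ey i j)
          (iter growScan.run 9 j ρ) := by
        intro j
        induction j with
        | zero => exact hgs.setVar (Or.inl rfl) 0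
        | succ j ihj => exact (ihj.run_growScan h).setVar (Or.inl rfl) _
      have hfin := hrounds I.n
      rw [← hrun] at hfin
      refine ⟨fun x hx => ?_, fun b hb => ?_, fun w hw v hv => ?_, fun w hw v hv => ?_⟩
      · simp only [iter, State.setVar]
        rw [Function.update_of_ne (by omega)]; exact hfin.var x hx
      · simp only [iter, State.setVar]; exact hfin.arr b hb
      · simp only [iter, State.setVar]
        by_cases hwi : w = i
        · subst hwi; exact hfin.mem v hv
        · rw [← hτ, hfin.other w hwi v hv]; exact k3 w (by omega) v hv
      · simp only [iter, State.setVar]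
        rw [← hτ, hfin.other w (by omega) v hv]; exact k4 w (by omega) v hv
  have hfin : progGrow.run s = iter body 8 I.n s := by
    simp only [progGrow, LProg.run, h.var_n]
    rfl
  rw [hfin]
  obtain ⟨k1, k2, k3, -⟩ := key I.n le_rfl
  refine h.step (by omega) k1 k2 fun w hw => ?_
  have : ((Finset.range I.n).filter fun v => 0 < (iter body 8 I.n s).arr 19 (w * I.n + v)) =
      I.grow m ex ey w I.n := by
    ext v
    rw [Finset.mem_filter, Finset.mem_range]
    constructor
    · rintro ⟨hv, h'⟩
      exact (k3 w hw v hv).1 h'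
    · intro hv
      have := Finset.mem_range.1 (Instance.grow_subset hw _ hv)
      exact ⟨this, (k3 w hw v this).2 hv⟩
  rw [this]
  exact Instance.isTiedPart_grow h.adj hw

end WordRAM

/-! ### The kernelization program: the kernel graph -/

namespace WordRAM

open LProg

variable {I : Instance} {m : ℕ} {ex ey : ℕ → ℕ} {a : ℕ} {s : State}

/-! The vertex `(t, i)` of the kernel graph has the code `t * n + i`. -/

/-- Code of the vertex `(t, e)`. -/
def codeExpr (t : ℕ) (e : Expr) : Expr := .add (.mul (.const t) (.var 0)) e

/-- Position of `(e, f)` in a table with rows of length `5 * n`. -/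
def Expr.idx5 (e f : Expr) : Expr := .add (.mul e (.var 3)) f

def progKept : LProg := LProg.countNest 20
  [(.and (.get 15 (.var 8)) (.get2 19 (.var 8) (.var 9)), .var 9)] [(8, 0), (9, 0)]

def progSelected : LProg := LProg.countNest 21
  [(.get 20 (.var 8), codeExpr 0 (.var 8)), (.get 13 (.var 8), codeExpr 1 (.var 8)),
    (.get 13 (.var 8), codeExpr 2 (.var 8)), (.get 13 (.var 8), codeExpr 3 (.var 8)),
    (.get 13 (.var 8), codeExpr 4 (.var 8))] [(8, 0)]

def progKernelRel : LProg := LProg.countNest 22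
  ((.get2 2 (.var 8) (.var 9), .idx5 (codeExpr 0 (.var 8)) (codeExpr 0 (.var 9))) ::
    (.or (.eq (.get 11 (.var 8)) (.var 9)) (.get 9 (.var 8)),
      .idx5 (codeExpr 0 (.var 8)) (codeExpr 1 (.var 9))) ::
    (.eq (.get 11 (.var 8)) (.var 9), .idx5 (codeExpr 0 (.var 8)) (codeExpr 2 (.var 9))) ::
    [(1, 2), (1, 3), (1, 4), (2, 3), (2, 4)].map fun c =>
      (.eq (.var 8) (.var 9), .idx5 (codeExpr c.1 (.var 8)) (codeExpr c.2 (.var 9))))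
  [(8, 0), (9, 0)]

theorem Ready.run_progKept (h : Ready I m ex ey 20 s) : Ready I m ex ey 21 (progKept.run s) := by
  have h15 := h.clashing_iff (by omega)
  have h19 : ∀ w < I.n, I.IsTiedPart w
      ((Finset.range I.n).filter fun v => 0 < s.arr 19 (w * I.n + v)) :=
    h.fact 19 (by omega) (by omega)
  refine h.countNest (by omega) (by decide) (by decide) fun f hf => ?_
  refine ⟨fun w => (Finset.range I.n).filter fun v => 0 < s.arr 19 (w * I.n + v),
    fun w hw => ⟨h19 w hw, Finset.filter_subset _ _⟩, fun v hv => ?_⟩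
  rw [hf, count_pos_iff, h.hits_two (φ := fun w x => (I.Clashing w ∧
    0 < s.arr 19 (w * I.n + x)) ∧ x = v)]
  · constructor
    · rintro ⟨w, -, x, -, ⟨h1, h2⟩, rfl⟩
      exact ⟨w, h1, by simp [hv, h2]⟩
    · rintro ⟨w, h1, h2⟩
      refine ⟨w, ?_, v, hv, ⟨h1, (Finset.mem_filter.1 h2).2⟩, rfl⟩
      obtain ⟨x, hx⟩ := h1
      exact I.lt_of_adj _ _ hx.1
  · intro σ hσ h8 h9
    simp [Expr.get2, Expr.eval, hσ.var_n, hσ.arr, h15, h8]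

theorem Ready.run_progSelected (h : Ready I m ex ey 21 s) :
    Ready I m ex ey 22 (progSelected.run s) := by
  have h13 := h.used_iff (by omega)
  obtain ⟨S, hS, h20⟩ : ∃ S : ℕ → Finset ℕ,
      (∀ w < I.n, I.IsTiedPart w (S w) ∧ S w ⊆ Finset.range I.n) ∧
        ∀ v < I.n, 0 < s.arr 20 v ↔ v ∈ I.kept S := h.fact 20 (by omega) (by omega)
  refine h.countNest (by omega) (by decide) (by decide) fun f hf => ⟨S, hS, fun t ht i hi => ?_⟩
  rw [hf, count_pos_iff, h.hits_one (φ := fun v => (v ∈ I.kept S ∧ 0 * I.n + v = t * I.n + i) ∨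
    (I.Used v ∧ ∃ r, 1 ≤ r ∧ r ≤ 4 ∧ r * I.n + v = t * I.n + i))]
  · constructor
    · rintro ⟨v, hv, ⟨h1, h2⟩ | ⟨h1, r, hr, hr', h2⟩⟩
      · obtain ⟨rfl, rfl⟩ := (idx_inj hv hi).1 h2
        exact Or.inl ⟨rfl, h1⟩
      · obtain ⟨rfl, rfl⟩ := (idx_inj hv hi).1 h2
        exact Or.inr ⟨hr, hr', h1⟩
    · rintro (⟨h1, h2⟩ | ⟨h1, h2, h3⟩)
      · simp only at h1 h2
        exact ⟨i, hi, Or.inl ⟨h2, by rw [h1]⟩⟩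
      · exact ⟨i, hi, Or.inr ⟨h3, t, h1, h2, rfl⟩⟩
  · intro σ hσ h8
    simp only [List.mem_cons, List.not_mem_nil, or_false, exists_eq_or_imp, exists_eq_left,
      codeExpr, Expr.eval, hσ.var_n, hσ.arr, h13 _ h8, h20 _ h8]
    refine or_congr Iff.rfl ?_
    constructor
    · rintro (⟨h1, h2⟩ | ⟨h1, h2⟩ | ⟨h1, h2⟩ | ⟨h1, h2⟩) <;>
        exact ⟨h1, _, by norm_num, by norm_num, h2⟩
    · rintro ⟨h1, r, hr, hr', h2⟩
      have : r = 1 ∨ r = 2 ∨ r = 3 ∨ r = 4 := by omega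
      rcases this with rfl | rfl | rfl | rfl <;> simp only [h1, h2, true_and, true_or, or_true]

theorem code_lt {n t i : ℕ} (ht : t < 5) (hi : i < n) : t * n + i < 5 * n := by
  have : t * n ≤ 4 * n := Nat.mul_le_mul_right _ (by omega)
  omega

theorem Ready.run_progKernelRel (h : Ready I m ex ey 22 s) :
    Ready I m ex ey 23 (progKernelRel.run s) := by
  have h2 := h.adj_iff (by omega)
  have h9 := h.outer_iff (by omega)
  have h11 := h.label_eq (by omega)
  refine h.countNest (by omega) (by decide) (by decide) fun f hf t ht i hi t' ht' i' hi' => ?_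
  rw [hf, count_pos_iff, h.hits_two (φ := fun u v => ∃ r r', r < 5 ∧ r' < 5 ∧
    I.KernelRel (r, u) (r', v) ∧
    (r * I.n + u) * (5 * I.n) + (r' * I.n + v) = (t * I.n + i) * (5 * I.n) + (t' * I.n + i'))]
  · constructor
    · rintro ⟨u, hu, v, hv, r, r', hr, hr', h1, h3⟩
      obtain ⟨e1, e2⟩ := (idx_inj (code_lt hr' hv) (code_lt ht' hi')).1 h3
      obtain ⟨rfl, rfl⟩ := (idx_inj hu hi).1 e1
      obtain ⟨rfl, rfl⟩ := (idx_inj hv hi').1 e2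
      exact h1
    · exact fun h1 => ⟨i, hi, i', hi', t, t', ht, ht', h1, rfl⟩
  · intro σ hσ h8 h9'
    simp only [List.mem_cons, List.map_cons, List.map_nil, List.not_mem_nil, or_false,
      exists_eq_or_imp, exists_eq_left, Expr.idx5, codeExpr, Expr.get2, Expr.pos_or, Expr.pos_eq,
      Expr.eval, hσ.var_n, hσ.var_N, hσ.arr, h2 _ h8 _ h9', h9 _ h8, h11 _ h8]
    constructor
    · rintro (⟨h1, h3⟩ | ⟨h1, h3⟩ | ⟨h1, h3⟩ | ⟨h1, h3⟩ | ⟨h1, h3⟩ | ⟨h1, h3⟩ | ⟨h1, h3⟩ |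
        ⟨h1, h3⟩) <;>
        exact ⟨_, _, by norm_num, by norm_num, by simp [Instance.KernelRel, h1], h3⟩
    · rintro ⟨r, r', hr, hr', ⟨e1, e2, h1⟩ | ⟨e1, e2, h1⟩ | ⟨e1, e2, h1⟩ | ⟨g1, g2, g3, g4, h1⟩, h3⟩
      · simp only at e1 e2 h1; subst e1 e2; exact Or.inl ⟨h1, h3⟩
      · simp only at e1 e2 h1; subst e1 e2; exact Or.inr (Or.inl ⟨h1, h3⟩)
      · simp only at e1 e2 h1; subst e1 e2; exact Or.inr (Or.inr (Or.inl ⟨h1, h3⟩))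
      · simp only at g1 g2 g3 g4 h1
        have : (r = 1 ∧ r' = 2) ∨ (r = 1 ∧ r' = 3) ∨ (r = 1 ∧ r' = 4) ∨ (r = 2 ∧ r' = 3) ∨
          (r = 2 ∧ r' = 4) := by omega
        rcases this with ⟨rfl, rfl⟩ | ⟨rfl, rfl⟩ | ⟨rfl, rfl⟩ | ⟨rfl, rfl⟩ | ⟨rfl, rfl⟩ <;>
          simp [h1] at h3 ⊢ <;> simp [h3]

end WordRAM

/-! ### The kernelization program: output -/

namespace WordRAM

open LProg

variable {I : Instance} {m : ℕ} {ex ey : ℕ → ℕ} {s : State}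

theorem LProg.iter_induction {f : State → State} {x N : ℕ} {s : State} {Q : ℕ → State → Prop}
    (h0 : Q 0 (s.setVar x 0))
    (h : ∀ i < N, ∀ σ : State, σ.var x = i → Q i σ → Q (i + 1) ((f σ).setVar x (i + 1))) :
    Q N (iter f x N s) := by
  suffices key : ∀ i ≤ N, Q i (iter f x i s) from key N le_rfl
  intro i
  induction i with
  | zero => exact fun _ => h0
  | succ i ih => exact fun hi => h i hi _ (iter_self _ _ _ _) (ih (by omega))

/-- List the codes of the selected vertices in array `23`, and their number in register `12`. -/
def progCompress : LProg := .seq (.set 12 (.const 0)) (.loop 8 3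
  (.ifPos (.get 21 (.var 8))
    (.seq (.put 23 (.var 12) (.var 8)) (.set 12 (.add (.var 12) (.const 1)))) .skip))

/-- The codes of the selected vertices. -/
def selectedCodes (I : Instance) (s : State) : List ℕ :=
  (List.range (5 * I.n)).filter fun q => 0 < s.arr 21 q

/-- The first registers and all arrays except for array `a` agree. -/
structure SameExcept (a : ℕ) (s σ : State) : Prop where
  var : ∀ x < 8, σ.var x = s.var x
  arr : ∀ b, b ≠ a → σ.arr b = s.arr b

theorem SameExcept.setVar {a : ℕ} {σ : State} (h : SameExcept a s σ) {x : ℕ} (hx : 8 ≤ x) (v : ℕ) :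
    SameExcept a s (σ.setVar x v) where
  var y hy := by
    simp only [State.setVar]; rw [Function.update_of_ne (by omega)]; exact h.var y hy
  arr := h.arr

theorem SameExcept.setArr {a : ℕ} {σ : State} (h : SameExcept a s σ) (i v : ℕ) :
    SameExcept a s (σ.setArr a i v) where
  var := h.var
  arr b hb := by
    simp only [State.setArr]; rw [Function.update_of_ne hb]; exact h.arr b hb

theorem SameExcept.refl (a : ℕ) (s : State) : SameExcept a s s := ⟨fun _ _ => rfl, fun _ _ => rfl⟩

/-- Array `a` begins with the elements of the list `L`, and register `12` holds its length. -/
structure Listed (a : ℕ) (L : List ℕ) (σ : State) : Prop where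
  length : σ.var 12 = L.length
  get : ∀ t (ht : t < L.length), σ.arr a t = L[t]

theorem Ready.run_progCompress (h : Ready I m ex ey 23 s) :
    SameExcept 23 s (progCompress.run s) ∧ Listed 23 (selectedCodes I s) (progCompress.run s) := by
  have hN : (s.setVar 12 0).var 3 = 5 * I.n := by simp [State.setVar, h.var_N]
  simp only [progCompress, LProg.run, Expr.eval, hN, selectedCodes]
  refine LProg.iter_induction (Q := fun i σ => SameExcept 23 s σ ∧
    Listed 23 ((List.range i).filter fun q => 0 < s.arr 21 q) σ) ?_ ?_
  · refine ⟨((SameExcept.refl 23 s).setVar (by omega) _).setVar (by omega) _, ?_, ?_⟩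
    · simp [State.setVar]
    · simp
  · rintro i - σ h8 ⟨h1, h2⟩
    simp only [h8, h1.arr 21 (by omega)]
    by_cases hc : 0 < s.arr 21 i
    · rw [if_pos hc]
      refine ⟨((h1.setArr _ _).setVar (by omega) _).setVar (by omega) _, ?_, ?_⟩
      · simp [State.setVar, State.setArr, List.range_succ, hc, h2.length]
      · intro t ht
        simp only [List.range_succ, List.filter_append, List.length_append] at ht
        simp only [State.setVar, State.setArr, Function.update_self, List.range_succ,
          List.filter_append, h2.length]
        by_cases htl : t < ((List.range i).filter fun q => 0 < s.arr 21 q).length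
        · rw [Function.update_of_ne (by omega), h2.get t htl, List.getElem_append_left htl]
        · have hte : t = ((List.range i).filter fun q => 0 < s.arr 21 q).length := by
            simp [hc] at ht htl ⊢; omega
          subst hte
          simp [hc]
    · rw [if_neg hc]
      have : ((List.range (i + 1)).filter fun q => 0 < s.arr 21 q) =
          (List.range i).filter fun q => 0 < s.arr 21 q := by
        simp [List.range_succ, List.filter_append, hc]
      rw [this]
      refine ⟨h1.setVar (by omega) _, ?_, h2.get⟩
      rw [← h2.length]; simp [State.setVar]

/-- The vertices listed at the positions in registers `8` and `9` are adjacent, and the first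
position is the smaller one. -/
def pairExpr : Expr := .and (.lt (.var 8) (.var 9)) (.and (.lt (.var 9) (.var 12))
  (.or (.get 22 (.idx5 (.get 23 (.var 8)) (.get 23 (.var 9))))
    (.get 22 (.idx5 (.get 23 (.var 9)) (.get 23 (.var 8))))))

/-- Append the pair of registers `8` and `9` to the edges in the output, which are counted by
register `13`. -/
def appendPair : LProg :=
  .seq (.put 1 (.add (.const 3) (.mul (.const 2) (.var 13))) (.var 8))
    (.seq (.put 1 (.add (.const 4) (.mul (.const 2) (.var 13))) (.var 9))
      (.set 13 (.add (.var 13) (.const 1))))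

def progWriteEdges : LProg := .seq (.set 13 (.const 0))
  (.loop 8 3 (.loop 9 3 (.ifPos pairExpr appendPair .skip)))

/-- Write the number of vertices, the parameter and the number of edges in front of the edges. -/
def progHeader : LProg := .seq (.put 1 (.const 0) (.var 12))
  (.seq (.put 1 (.const 1) (.var 1)) (.put 1 (.const 2) (.var 13)))

/-- The pairs of positions of adjacent vertices in the list `L`, the smaller position first. -/
def PairAt (I : Instance) (s : State) (L : List ℕ) (i j : ℕ) : Prop :=
  ∃ (hij : i < j) (hj : j < L.length),
    0 < s.arr 22 (L[i] * (5 * I.n) + L[j]) ∨ 0 < s.arr 22 (L[j] * (5 * I.n) + L[i])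

/-- The pairs in `E` have been written to the output, after the three cells of the header. -/
structure Written (E : List (ℕ × ℕ)) (σ : State) : Prop where
  length : σ.var 13 = E.length
  get : ∀ t (ht : t < E.length), σ.arr 1 (3 + 2 * t) = E[t].1 ∧ σ.arr 1 (4 + 2 * t) = E[t].2

theorem Written.setVar {E : List (ℕ × ℕ)} {σ : State} (h : Written E σ) {x : ℕ} (hx : x ≠ 13)
    (v : ℕ) : Written E (σ.setVar x v) := by
  refine ⟨?_, h.get⟩
  rw [← h.length]; simp [State.setVar, Ne.symm hx]

theorem Written.run_appendPair {E : List (ℕ × ℕ)} {σ : State} (h : Written E σ) :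
    Written (E ++ [(σ.var 8, σ.var 9)]) (appendPair.run σ) := by
  have h0 := h.length
  refine ⟨?_, fun t ht => ?_⟩
  · simp [appendPair, LProg.run, State.setVar, State.setArr, Expr.eval, h0]
  · simp only [appendPair, LProg.run, State.setVar, State.setArr, Expr.eval, h0,
      Function.update_self]
    by_cases htl : t < E.length
    · rw [List.getElem_append_left htl, Function.update_of_ne (by omega),
        Function.update_of_ne (by omega), Function.update_of_ne (by omega),
        Function.update_of_ne (by omega)]
      exact h.get t htl
    · have : t = E.length := by simp at ht; omega
      subst this
      simp

theorem SameExcept.run_appendPair {σ : State} (h : SameExcept 1 s σ) :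
    SameExcept 1 s (appendPair.run σ) ∧ ∀ x, x ≠ 13 → (appendPair.run σ).var x = σ.var x :=
  ⟨((h.setArr _ _).setArr _ _).setVar (by omega) _, fun x hx => by
    simp [appendPair, LProg.run, State.setVar, State.setArr, hx]⟩

open Classical in
theorem run_progWriteEdges {L : List ℕ} (hN : s.var 3 = 5 * I.n) (hL : Listed 23 L s)
    (hlen : L.length ≤ 5 * I.n) :
    ∃ E : List (ℕ × ℕ), E.Nodup ∧ (∀ i j, (i, j) ∈ E ↔ PairAt I s L i j) ∧
      SameExcept 1 s (progWriteEdges.run s) ∧ (progWriteEdges.run s).var 12 = L.length ∧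
      Written E (progWriteEdges.run s) := by
  let row : ℕ → ℕ → List (ℕ × ℕ) := fun i j =>
    ((List.range j).filter fun j' => PairAt I s L i j').map fun j' => (i, j')
  let all : ℕ → List (ℕ × ℕ) := fun i => (List.range i).flatMap fun i' => row i' (5 * I.n)
  refine ⟨all (5 * I.n), ?_, ?_, ?_⟩
  · refine List.nodup_flatMap.2 ⟨fun i _ => ?_, ?_⟩
    · exact (List.nodup_range.filter _).map fun _ _ h => (Prod.mk.inj h).2
    · refine List.nodup_range.imp fun {i j} hij => ?_
      intro p hp hq
      obtain ⟨_, -, rfl⟩ := List.mem_map.1 hp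
      obtain ⟨_, -, h⟩ := List.mem_map.1 hq
      exact hij (Prod.mk.inj h).1.symm
  · intro i j
    simp only [all, row, List.mem_flatMap, List.mem_range, List.mem_map, List.mem_filter,
      decide_eq_true_eq, Prod.mk.injEq]
    constructor
    · rintro ⟨_, -, _, ⟨-, h⟩, rfl, rfl⟩; exact h
    · intro h
      obtain ⟨hij, hj, -⟩ := id h
      exact ⟨i, by omega, j, ⟨by omega, h⟩, rfl, rfl⟩
  · have h12 : (s.setVar 13 0).var 12 = L.length := by simp [State.setVar, hL.length]
    have hN' : (s.setVar 13 0).var 3 = 5 * I.n := by simp [State.setVar, hN]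
    simp only [progWriteEdges, LProg.run, Expr.eval, hN']
    refine LProg.iter_induction (Q := fun i σ => SameExcept 1 s σ ∧ σ.var 12 = L.length ∧
      Written (all i) σ) ?_ ?_
    · refine ⟨((SameExcept.refl 1 s).setVar (by omega) _).setVar (by omega) _, ?_, ?_, ?_⟩
      · simp [State.setVar, hL.length]
      · simp [State.setVar, all]
      · simp [all]
    · rintro i hi σ h8 ⟨h1, h2, h3⟩
      have hN2 : σ.var 3 = 5 * I.n := by rw [h1.var 3 (by omega), hN]
      have key : SameExcept 1 s (iter (fun τ => if 0 < pairExpr.eval τ then appendPair.run τ else τ)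
            9 (5 * I.n) σ) ∧
          (iter (fun τ => if 0 < pairExpr.eval τ then appendPair.run τ else τ)
            9 (5 * I.n) σ).var 8 = i ∧
          (iter (fun τ => if 0 < pairExpr.eval τ then appendPair.run τ else τ)
            9 (5 * I.n) σ).var 12 = L.length ∧
          Written (all i ++ row i (5 * I.n))
            (iter (fun τ => if 0 < pairExpr.eval τ then appendPair.run τ else τ)
              9 (5 * I.n) σ) := by
        refine LProg.iter_induction (Q := fun j σ => SameExcept 1 s σ ∧ σ.var 8 = i ∧
          σ.var 12 = L.length ∧ Written (all i ++ row i j) σ) ?_ ?_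
        · refine ⟨h1.setVar (by omega) _, ?_, ?_, ?_⟩
          · simp [State.setVar, h8]
          · simp [State.setVar, h2]
          · simpa [row] using h3.setVar (by omega) 0
        · rintro j hj τ g9 ⟨g1, g2, g3, g4⟩
          have hcond : 0 < pairExpr.eval τ ↔ PairAt I s L i j := by
            simp only [pairExpr, Expr.pos_and, Expr.pos_or, Expr.pos_lt, Expr.idx5, Expr.eval,
              g2, g3, g9, g1.arr 22 (by omega), g1.arr 23 (by omega), g1.var 3 (by omega), hN,
              PairAt]
            constructor
            · rintro ⟨k1, k2, k3⟩
              refine ⟨k1, k2, ?_⟩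
              rwa [hL.get j k2, hL.get i (by omega)] at k3
            · rintro ⟨k1, k2, k3⟩
              refine ⟨k1, k2, ?_⟩
              rwa [hL.get j k2, hL.get i (by omega)]
          by_cases hc : 0 < pairExpr.eval τ
          · rw [if_pos hc]
            have hrow : all i ++ row i (j + 1) = all i ++ row i j ++ [(τ.var 8, τ.var 9)] := by
              simp only [row, List.range_succ, List.filter_append, List.map_append, g2, g9,
                List.append_assoc]
              simp [hcond.1 hc]
            rw [hrow]
            obtain ⟨k1, k2⟩ := g1.run_appendPair
            refine ⟨k1.setVar (by omega) _, ?_, ?_, g4.run_appendPair.setVar (by omega) _⟩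
            · simp [State.setVar, k2, g2]
            · simp [State.setVar, k2, g3]
          · rw [if_neg hc]
            have hrow : row i (j + 1) = row i j := by
              simp only [row, List.range_succ, List.filter_append, List.map_append]
              simp [mt hcond.2 hc]
            rw [hrow]
            refine ⟨g1.setVar (by omega) _, ?_, ?_, g4.setVar (by omega) _⟩
            · simp [State.setVar, g2]
            · simp [State.setVar, g3]
      obtain ⟨k1, k2, k3, k4⟩ := key
      have hall : all (i + 1) = all i ++ row i (5 * I.n) := by
        simp [all, List.range_succ]
      rw [hall]
      simp only [hN2]
      refine ⟨k1.setVar (by omega) _, ?_, k4.setVar (by omega) _⟩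
      simp [State.setVar, k3]

theorem run_progHeader {E : List (ℕ × ℕ)} (hE : Written E s) :
    (progHeader.run s).arr 1 0 = s.var 12 ∧ (progHeader.run s).arr 1 1 = s.var 1 ∧
      (progHeader.run s).arr 1 2 = E.length ∧
      ∀ t (ht : t < E.length), (progHeader.run s).arr 1 (3 + 2 * t) = E[t].1 ∧
        (progHeader.run s).arr 1 (4 + 2 * t) = E[t].2 := by
  simp only [progHeader, LProg.run, State.setArr, Expr.eval, Function.update_self, hE.length]
  refine ⟨by simp, by simp, trivial, fun t ht => ?_⟩
  repeat rw [Function.update_of_ne (by omega)]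
  exact hE.get t ht

end WordRAM

namespace WordRAM

open LProg

variable {I : Instance} {m : ℕ} {ex ey : ℕ → ℕ} {s : State}

/-! ### The kernelization program -/

/-- All tables on which the decision about the output depends. -/
def progTables : LProg :=
  .seq progAdj <| .seq progPath <| .seq progNonMin <| .seq progCountMin <| .seq progCore <|
  .seq progTri <| .seq progFreeTri <| .seq progOuter <| .seq progAtt <| .seq progLabel <|
  .seq progDense <| .seq progUsed <| .seq progCountUsed <| .seq progClashing <|
  .seq progCountClashing <| .seq progInconsistent progExistsOuter

/-- One of the conditions that show the input to be a no-instance. -/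
def rejectExpr : Expr :=
  .or (.get 17 (.const 0)) (.or (.lt (.var 1) (.get 14 (.const 0)))
    (.or (.and (.get 18 (.const 0)) (.not (.get 14 (.const 0))))
      (.lt (.mul (.mul (.const 2) (.var 1)) (.add (.var 1) (.const 1))) (.get 16 (.const 0)))))

/-- Write the complete graph on two vertices, with parameter `0`. -/
def progReject : LProg := .seq (.put 1 (.const 0) (.const 2))
  (.seq (.put 1 (.const 2) (.const 1)) (.put 1 (.const 4) (.const 1)))

/-- Compute the kernel and write it to the output. -/
def progKernel : LProg :=
  .seq progGrow <| .seq progKept <| .seq progSelected <| .seq progKernelRel <|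
  .seq progCompress <| .seq progWriteEdges progHeader

def progMain : LProg := .seq progTables (.ifPos rejectExpr progReject progKernel)

/-- Move `n`, `k` and `m` to the registers `0`, `1` and `2`, and `5 * n` to register `3`. -/
def progInit : Prog := .seq (.set 0 (.get 0 (.const 0))) (.seq (.set 1 (.get 0 (.const 1)))
  (.seq (.set 2 (.get 0 (.const 2))) (.set 3 (.mul (.const 5) (.var 0)))))

/-- Without edges nothing is done: the output is then the empty graph with parameter `0`. -/
def kernelization : Prog :=
  .ifLt (.const 0) (.get 0 (.const 2)) (.seq progInit progMain.toProg) .skip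

theorem Ready.run_progTables (h : Ready I m ex ey 2 s) :
    Ready I m ex ey 19 (progTables.run s) :=
  h.run_progAdj.run_progPath.run_progNonMin.run_progCountMin.run_progCore.run_progTri
    |>.run_progFreeTri.run_progOuter.run_progAtt.run_progLabel.run_progDense.run_progUsed
    |>.run_progCountUsed.run_progClashing.run_progCountClashing.run_progInconsistent
    |>.run_progExistsOuter

theorem wf_progMain : progMain.WF := by
  have hlabel : progLabel.WF := by
    simp [progLabel, LProg.WF, LProg.NoWrite, Expr.Slow, Expr.Atomic]
  have hgrow : progGrow.WF := by
    simp [progGrow, growScan, growCmd, LProg.WF, LProg.NoWrite, Expr.Slow, Expr.Atomic]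
  have hcompress : progCompress.WF := by
    simp [progCompress, LProg.WF, LProg.NoWrite, Expr.Slow, Expr.Atomic]
  have hwrite : progWriteEdges.WF := by
    simp [progWriteEdges, appendPair, LProg.WF, LProg.NoWrite, Expr.Slow, Expr.Atomic]
  have hheader : progHeader.WF := by
    simp [progHeader, LProg.WF, Expr.Slow, Expr.Atomic]
  have hreject : progReject.WF := by
    simp [progReject, LProg.WF, Expr.Slow, Expr.Atomic]
  refine ⟨⟨?_, ?_, ?_, ?_, ?_, ?_, ?_, ?_, ?_, hlabel, ?_, ?_, ?_, ?_, ?_, ?_, ?_⟩, hreject,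
    hgrow, ?_, ?_, ?_, hcompress, hwrite, hheader⟩ <;>
  exact wf_countNest (by decide) (by decide)

theorem boundsIn_progMain : progMain.BoundsIn [0, 2, 3] = true := by decide

theorem depthN_progMain : progMain.depthN ≤ 2 := by decide

theorem depthM_progMain : progMain.depthM ≤ 1 := by decide

end WordRAM

/-! ### Correctness of the output -/

theorem exists_colouring_comap_iff {V W : Type*} {G : SimpleGraph W} {k : ℕ} {S : Set W}
    {φ : V → W} (hφ : Function.Injective φ) (hS : Set.range φ = S) :
    (∃ f, IsClusterColouring (G.comap φ) k Set.univ f) ↔ ∃ g, IsClusterColouring G k S g := by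
  subst hS
  constructor
  · rintro ⟨f, hf⟩
    refine ⟨Function.extend φ f 0, ?_, ?_, ?_⟩
    · rintro _ ⟨u, rfl⟩
      rw [hφ.extend_apply]; exact hf.le u trivial
    · rintro _ ⟨u, rfl⟩ _ ⟨v, rfl⟩
      rw [hφ.extend_apply, hφ.extend_apply]; exact hf.indep u trivial v trivial
    · rintro _ ⟨u, rfl⟩ _ ⟨v, rfl⟩ hne
      rw [hφ.extend_apply, hφ.extend_apply]
      exact hf.adj_iff u trivial v trivial (fun h => hne (by rw [h]))
  · rintro ⟨g, hg⟩
    exact ⟨g ∘ φ, fun u _ => hg.le _ ⟨u, rfl⟩, fun u _ v _ => hg.indep _ ⟨u, rfl⟩ _ ⟨v, rfl⟩,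
      fun u _ v _ hne => hg.adj_iff _ ⟨u, rfl⟩ _ ⟨v, rfl⟩ (hφ.ne hne)⟩

theorem IsEdgeList.length_le {n : ℕ} {G : SimpleGraph (Fin n)} {es : List (Fin n × Fin n)}
    (h : IsEdgeList G es) : es.length ≤ n ^ 2 := by
  have := (List.Nodup.of_map _ h.1).length_le_card
  simpa [sq] using this

theorem IsEdgeList.length_eq {n : ℕ} {G : SimpleGraph (Fin n)} {es : List (Fin n × Fin n)}
    (h : IsEdgeList G es) : es.length = G.edgeSet.ncard := by
  classical
  have hset : G.edgeSet = ((es.map fun p => s(p.1, p.2)).toFinset : Set (Sym2 (Fin n))) := by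
    ext e
    simp only [List.coe_toFinset, Set.mem_ofPred_eq]
    exact (h.2 e).symm
  rw [hset, Set.ncard_coe_finset, List.toFinset_card_of_nodup h.1, List.length_map]

theorem IsEdgeList.adj_iff {n : ℕ} {G : SimpleGraph (Fin n)} {es : List (Fin n × Fin n)}
    (h : IsEdgeList G es) (u v : Fin n) : G.Adj u v ↔ (u, v) ∈ es ∨ (v, u) ∈ es := by
  rw [← SimpleGraph.mem_edgeSet, ← h.2, List.mem_map]
  constructor
  · rintro ⟨⟨x, y⟩, hxy, he⟩
    rcases Sym2.eq_iff.1 he with ⟨rfl, rfl⟩ | ⟨rfl, rfl⟩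
    · exact Or.inl hxy
    · exact Or.inr hxy
  · rintro (h | h)
    · exact ⟨_, h, rfl⟩
    · exact ⟨_, h, Sym2.eq_swap⟩

/-- A list that contains each edge with its smaller end first is an edge list. -/
theorem isEdgeList_of_lt {n : ℕ} {G : SimpleGraph (Fin n)} {es : List (Fin n × Fin n)}
    (hnd : es.Nodup) (h : ∀ u v, (u, v) ∈ es ↔ u < v ∧ G.Adj u v) : IsEdgeList G es := by
  refine ⟨hnd.map_on ?_, ?_⟩
  · rintro ⟨u, v⟩ huv ⟨u', v'⟩ huv' he
    have h1 := ((h _ _).1 huv).1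
    have h2 := ((h _ _).1 huv').1
    rcases Sym2.eq_iff.1 he with ⟨h3, h4⟩ | ⟨h3, h4⟩
    · exact Prod.ext h3 h4
    · simp only at h3 h4
      subst h3 h4
      exact absurd h1 h2.asymm
  · intro e
    induction e with
    | _ u v =>
      rw [SimpleGraph.mem_edgeSet, List.mem_map]
      constructor
      · rintro ⟨⟨x, y⟩, hxy, he⟩
        have := ((h _ _).1 hxy).2
        rcases Sym2.eq_iff.1 he with ⟨rfl, rfl⟩ | ⟨rfl, rfl⟩
        · exact this
        · exact this.symm
      · intro huv
        rcases lt_or_gt_of_ne huv.ne with hlt | hlt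
        · exact ⟨(u, v), (h _ _).2 ⟨hlt, huv⟩, rfl⟩
        · exact ⟨(v, u), (h _ _).2 ⟨hlt, huv.symm⟩, Sym2.eq_swap⟩

theorem bitLength_le {n k : ℕ} {es : List (Fin n × Fin n)} :
    bitLength (encodeInstance n k es) ≤
      (n + 1) + (k + 1) + (es.length + 1) + es.length * (2 * (n + 1)) := by
  have hsize : ∀ w, Nat.size w ≤ w := fun w => Nat.size_le.2 Nat.lt_two_pow_self
  have hsum : ∀ l : List (Fin n × Fin n), bitLength (l.flatMap fun p => [(p.1 : ℕ), (p.2 : ℕ)]) ≤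
      l.length * (2 * (n + 1)) := by
    intro l
    induction l with
    | nil => simp [bitLength]
    | cons p l ih =>
      simp only [bitLength, List.flatMap_cons, List.map_append, List.sum_append, List.map_cons,
        List.map_nil, List.sum_cons, List.sum_nil, List.length_cons] at ih ⊢
      have h1 := hsize p.1
      have h2 := hsize p.2
      have h3 := p.1.isLt
      have h4 := p.2.isLt
      rw [Nat.succ_mul]
      omega
  have h := hsum es
  simp only [bitLength, encodeInstance, List.map_cons, List.sum_cons] at h ⊢
  have h1 := hsize n
  have h2 := hsize k
  have h3 := hsize es.length
  omega

/-- The words at the positions `i`, `i + 1`, … that encode the ends of edges. -/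
theorem getElem_flatMap_iff {n : ℕ} (es : List (Fin n × Fin n)) (A : ℕ → ℕ) (o : ℕ) :
    (∀ (i : ℕ) (h : i < (es.flatMap fun p => [(p.1 : ℕ), (p.2 : ℕ)]).length),
      A (o + i) = (es.flatMap fun p => [(p.1 : ℕ), (p.2 : ℕ)])[i]) ↔
    ∀ (t : ℕ) (h : t < es.length), A (o + 2 * t) = es[t].1 ∧ A (o + 1 + 2 * t) = es[t].2 := by
  induction es generalizing o with
  | nil => simp
  | cons p l ih =>
    have ih := ih (o + 2)
    constructor
    · intro h t ht
      cases t with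
      | zero => exact ⟨h 0 (by simp), h 1 (by simp)⟩
      | succ t =>
        have := ih.1 (fun i hi => by
          have := h (i + 2) (by simp at hi ⊢; omega)
          rw [show o + 2 + i = o + (i + 2) by omega, this]
          simp) t (by simpa using ht)
        rw [show o + 2 * (t + 1) = o + 2 + 2 * t by omega,
          show o + 1 + 2 * (t + 1) = o + 2 + 1 + 2 * t by omega]
        simpa using this
    · intro h i hi
      match i with
      | 0 => exact (h 0 (by simp)).1
      | 1 => exact (h 0 (by simp)).2
      | i + 2 =>
        have := ih.2 (fun t ht => by
          have := h (t + 1) (by simpa using ht)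
          rw [show o + 2 + 2 * t = o + 2 * (t + 1) by omega,
            show o + 2 + 1 + 2 * t = o + 1 + 2 * (t + 1) by omega, this.1, this.2]
          simp) i (by simp at hi ⊢; omega)
        rw [show o + (i + 2) = o + 2 + i by omega, this]
        simp

namespace WordRAM

open LProg

variable {I : Instance} {m : ℕ} {ex ey : ℕ → ℕ} {s : State}

theorem outputs_iff {n k : ℕ} {es : List (Fin n × Fin n)} :
    s.Outputs (encodeInstance n k es) ↔ s.arr 1 0 = n ∧ s.arr 1 1 = k ∧ s.arr 1 2 = es.length ∧
      ∀ (t : ℕ) (h : t < es.length), s.arr 1 (3 + 2 * t) = es[t].1 ∧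
        s.arr 1 (4 + 2 * t) = es[t].2 := by
  rw [← getElem_flatMap_iff es (s.arr 1) 3]
  constructor
  · intro h
    refine ⟨h 0 (by simp [encodeInstance]), h 1 (by simp [encodeInstance]),
      h 2 (by simp [encodeInstance]), fun i hi => ?_⟩
    have := h (i + 3) (by simp [encodeInstance] at hi ⊢; omega)
    rw [add_comm 3 i, this]
    simp [encodeInstance]
  · rintro ⟨h0, h1, h2, h3⟩ i hi
    match i with
    | 0 => simpa [encodeInstance] using h0
    | 1 => simpa [encodeInstance] using h1
    | 2 => simpa [encodeInstance] using h2
    | i + 3 =>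
      have := h3 i (by simp [encodeInstance] at hi ⊢; omega)
      rw [add_comm 3 i] at this
      rw [this]
      simp [encodeInstance]

/-- The output of a state is an instance that is equivalent to `I` and satisfies the bounds of the
kernel. -/
def IsKernelOutput (I : Instance) (s : State) : Prop :=
  ∃ (n' k' : ℕ) (G' : SimpleGraph (Fin n')) (es' : List (Fin n' × Fin n')),
    IsEdgeList G' es' ∧ s.Outputs (encodeInstance n' k' es') ∧
      ((∃ f, IsClusterColouring I.G I.k Set.univ f) ↔ MonopolarYes G' k') ∧ k' ≤ I.k ∧
      n' ≤ max 2 (4 * I.k + 2 * I.k * (I.k + 1) * (2 * I.k + 1))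

theorem Ready.run_progReject (h : Ready I m ex ey 19 s)
    (hno : ¬ ∃ f, IsClusterColouring I.G I.k Set.univ f) :
    IsKernelOutput I (progReject.run s) := by
  have hz := h.zero 1 (Or.inl rfl)
  refine ⟨2, 0, ⊤, [(0, 1)], isEdgeList_of_lt (by simp) ?_, ?_, iff_of_false hno ?_,
    Nat.zero_le _, le_max_left _ _⟩
  · decide
  · refine outputs_iff.2 ⟨?_, ?_, ?_, fun t ht => ?_⟩
    · simp [progReject, LProg.run, State.setArr, Expr.eval]
    · simp [progReject, LProg.run, State.setArr, Expr.eval, hz]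
    · simp [progReject, LProg.run, State.setArr, Expr.eval]
    · obtain rfl : t = 0 := by simpa using ht
      simp [progReject, LProg.run, State.setArr, Expr.eval, hz]
  · rw [monopolarYes_iff_exists_colouring]
    rintro ⟨f, hf⟩
    exact hf.indep 0 trivial 1 trivial (by simp) (Nat.le_zero.1 (hf.le 0 trivial))
      (Nat.le_zero.1 (hf.le 1 trivial))

open Classical in
/-- The conditions under which the input is not rejected. -/
structure Passes (I : Instance) : Prop where
  consistent : I.Consistent
  card_used : ((Finset.range I.n).filter I.Used).card ≤ I.k
  exists_used : ∀ u, I.Outer u → ∃ p, I.Used p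
  card_clashing : ((Finset.range I.n).filter I.Clashing).card ≤ 2 * I.k * (I.k + 1)

theorem Passes.of_colouring {f : ℕ → ℕ} (hf : IsClusterColouring I.G I.k Set.univ f) :
    Passes I := by
  have hcons : I.Consistent := fun u h1 h2 => h1.ne_zero hf (h2.eq_zero hf)
  obtain ⟨h, c, P⟩ := (Instance.exists_colouring_iff hcons).1 ⟨f, hf⟩
  exact ⟨hcons, P.card_used_le, fun u hu => Instance.exists_used_of_outer hf hcons hu,
    P.card_clashing_le⟩

theorem Ready.rejectExpr_iff (h : Ready I m ex ey 19 s) :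
    0 < rejectExpr.eval s ↔ ¬ Passes I := by
  classical
  have h14 : s.arr 14 0 = ((Finset.range I.n).filter I.Used).card := by
    refine (h.fact 14 (by omega) (by omega)).trans ?_
    congr
  have h16 : s.arr 16 0 = ((Finset.range I.n).filter I.Clashing).card := by
    refine (h.fact 16 (by omega) (by omega)).trans ?_
    congr
  have h17 : 0 < s.arr 17 0 ↔ ¬ I.Consistent := h.fact 17 (by omega) (by omega)
  have h18 : 0 < s.arr 18 0 ↔ ∃ u, I.Outer u := h.fact 18 (by omega) (by omega)
  have hused : 0 < s.arr 14 0 ↔ ∃ p, I.Used p := by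
    rw [h14, Finset.card_pos]
    constructor
    · rintro ⟨p, hp⟩; exact ⟨p, (Finset.mem_filter.1 hp).2⟩
    · rintro ⟨p, hp⟩; exact ⟨p, Finset.mem_filter.2 ⟨Finset.mem_range.2 hp.1, hp⟩⟩
  simp only [rejectExpr, Expr.pos_or, Expr.pos_and, Expr.pos_not, Expr.pos_lt, Expr.eval,
    h17, h18, hused, h.var_k]
  rw [h14, h16]
  constructor
  · rintro (h1 | h1 | ⟨⟨u, hu⟩, h1⟩ | h1) hp
    · exact h1 hp.consistent
    · have := hp.card_used
      omega
    · exact h1 (hp.exists_used u hu)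
    · have := hp.card_clashing
      omega
  · intro h1
    by_contra! h2
    exact h1 ⟨h2.1, by convert h2.2.1, fun u hu => h2.2.2.1 ⟨u, hu⟩, by convert h2.2.2.2⟩

/-- The number of vertices of the kernel. -/
theorem card_le_of_selected (hI : Passes I) {S : ℕ → Finset ℕ}
    (hS : ∀ w < I.n, I.IsTiedPart w (S w)) {N : ℕ} {φ : Fin N → ℕ × ℕ}
    (hφ : Function.Injective φ) (hsel : ∀ i, φ i ∈ I.Selected (I.kept S)) :
    N ≤ 4 * I.k + 2 * I.k * (I.k + 1) * (2 * I.k + 1) := by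
  classical
  let T : Finset (ℕ × ℕ) := (Finset.Icc 1 4 ×ˢ (Finset.range I.n).filter I.Used) ∪
    {0} ×ˢ ((Finset.range I.n).filter I.Clashing).biUnion S
  have hT : ∀ i, φ i ∈ T := by
    intro i
    rcases hsel i with ⟨h0, w, hw, hmem⟩ | ⟨h1, h4, hu⟩
    · have hwn : w < I.n := I.lt_of_adj _ _ hw.choose_spec.1
      simp only [T, Finset.mem_union, Finset.mem_product, Finset.mem_singleton,
        Finset.mem_biUnion, Finset.mem_filter, Finset.mem_range]
      exact Or.inr ⟨h0, w, ⟨hwn, hw⟩, hmem⟩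
    · simp only [T, Finset.mem_union, Finset.mem_product, Finset.mem_Icc, Finset.mem_filter,
        Finset.mem_range]
      exact Or.inl ⟨⟨h1, h4⟩, hu.1, hu⟩
  have hcard : N ≤ T.card := by
    have := Finset.card_le_card_of_injOn (s := Finset.univ) (t := T) φ (fun i _ => hT i)
      hφ.injOn
    simpa using this
  have h1 : (((Finset.range I.n).filter I.Clashing).biUnion S).card ≤
      ((Finset.range I.n).filter I.Clashing).card * (2 * I.k + 1) :=
    Finset.card_biUnion_le_card_mul _ _ _ fun w hw =>
      (hS w (Finset.mem_range.1 (Finset.mem_filter.1 hw).1)).card_le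
  have h2 := hI.card_used
  have h3 := Nat.mul_le_mul_right (2 * I.k + 1) hI.card_clashing
  refine hcard.trans ((Finset.card_union_le _ _).trans (Nat.add_le_add ?_ ?_))
  · rw [Finset.card_product, Nat.card_Icc]
    refine Nat.mul_le_mul_left 4 ?_
    convert h2
  · rw [Finset.card_product, Finset.card_singleton, one_mul]
    refine h1.trans (le_trans (le_of_eq ?_) h3)
    congr

theorem Ready.run_progKernel (h : Ready I m ex ey 19 s) (hI : Passes I) :
    IsKernelOutput I (progKernel.run s) := by
  have h23 := h.run_progGrow.run_progKept.run_progSelected.run_progKernelRel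
  set σ := progKernelRel.run (progSelected.run (progKept.run (progGrow.run s))) with hσ
  obtain ⟨S, hS, h21⟩ : ∃ S : ℕ → Finset ℕ,
      (∀ w < I.n, I.IsTiedPart w (S w) ∧ S w ⊆ Finset.range I.n) ∧
        ∀ t < 5, ∀ i < I.n, 0 < σ.arr 21 (t * I.n + i) ↔ (t, i) ∈ I.Selected (I.kept S) :=
    h23.fact 21 (by omega) (by omega)
  have h22 : ∀ t < 5, ∀ i < I.n, ∀ t' < 5, ∀ i' < I.n,
      0 < σ.arr 22 ((t * I.n + i) * (5 * I.n) + (t' * I.n + i')) ↔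
        I.KernelRel (t, i) (t', i') := h23.fact 22 (by omega) (by omega)
  have hclash : ∀ w, I.Clashing w → w < I.n := fun w hw => I.lt_of_adj _ _ hw.choose_spec.1
  set L := selectedCodes I σ with hL
  have hLmem : ∀ q, q ∈ L ↔ q < 5 * I.n ∧ 0 < σ.arr 21 q := by
    intro q; simp [hL, selectedCodes]
  let dec : ℕ → ℕ × ℕ := fun q => (q / I.n, q % I.n)
  have hdec : ∀ q, q < 5 * I.n → (dec q).1 < 5 ∧ (dec q).2 < I.n ∧
      (dec q).1 * I.n + (dec q).2 = q := by
    intro q hq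
    have hn : 0 < I.n := by omega
    exact ⟨(Nat.div_lt_iff_lt_mul hn).2 hq, Nat.mod_lt _ hn, by
      rw [mul_comm]; exact Nat.div_add_mod q I.n⟩
  have hLlt : ∀ i : Fin L.length, L[i] < 5 * I.n := fun i =>
    ((hLmem _).1 (List.getElem_mem i.isLt)).1
  let φ : Fin L.length → ℕ × ℕ := fun i => dec L[i]
  have hφ : Function.Injective φ := by
    intro i j hij
    have h1 := (hdec _ (hLlt i)).2.2
    have h2 := (hdec _ (hLlt j)).2.2
    have h3 : dec L[i] = dec L[j] := hij
    rw [h3] at h1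
    have hnd : L.Nodup := List.nodup_range.filter _
    exact Fin.ext ((hnd.getElem_inj_iff).1 (h1.symm.trans h2))
  have hrange : Set.range φ = I.Selected (I.kept S) := by
    ext ⟨t, i⟩
    constructor
    · rintro ⟨x, hx⟩
      obtain ⟨h1, h2, h3⟩ := hdec _ (hLlt x)
      have h4 : dec L[x] = (t, i) := hx
      rw [h4] at h1 h2 h3
      rw [← h21 t h1 i h2]
      simp only at h3
      rw [h3]
      exact ((hLmem _).1 (List.getElem_mem x.isLt)).2
    · intro hti
      have hlt : t < 5 ∧ i < I.n := by
        rcases hti with ⟨h0, w, hw, hmem⟩ | ⟨-, h4, hu⟩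
        · simp only at h0
          exact ⟨by omega, Finset.mem_range.1 ((hS w (hclash w hw)).2 hmem)⟩
        · simp only at h4
          exact ⟨by omega, hu.1⟩
      have hcode := code_lt hlt.1 hlt.2
      obtain ⟨x, hx, hxe⟩ := List.getElem_of_mem
        ((hLmem _).2 ⟨hcode, (h21 t hlt.1 i hlt.2).2 hti⟩)
      refine ⟨⟨x, hx⟩, ?_⟩
      show dec L[x] = _
      obtain ⟨h1, h2, h3⟩ := hdec _ hcode
      rw [hxe]
      have := (idx_inj h2 hlt.2).1 h3
      exact Prod.ext this.1 this.2
  obtain ⟨hsame, hlist⟩ := h23.run_progCompress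
  set τ := progCompress.run σ with hτ
  obtain ⟨E, hnd, hE, hsame', h12, hw⟩ := run_progWriteEdges
    ((hsame.var 3 (by omega)).trans h23.var_N) hlist (by
      rw [← hL]
      exact (List.length_filter_le _ _).trans_eq (List.length_range))
  have hpair : ∀ i j, PairAt I τ L i j ↔ ∃ (hij : i < j) (hj : j < L.length),
      I.kernelGraph.Adj (φ ⟨i, hij.trans hj⟩) (φ ⟨j, hj⟩) := by
    intro i j
    refine exists_congr fun hij => exists_congr fun hj => ?_
    obtain ⟨a1, a2, a3⟩ := hdec _ (hLlt ⟨i, hij.trans hj⟩)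
    obtain ⟨b1, b2, b3⟩ := hdec _ (hLlt ⟨j, hj⟩)
    have k1 := h22 _ a1 _ a2 _ b1 _ b2
    have k2 := h22 _ b1 _ b2 _ a1 _ a2
    rw [a3, b3] at k1 k2
    rw [hsame.arr 22 (by omega), Instance.kernelGraph, SimpleGraph.fromRel_adj]
    have hne : φ ⟨i, hij.trans hj⟩ ≠ φ ⟨j, hj⟩ := fun he => by
      have := congrArg Fin.val (hφ he)
      simp only at this; omega
    exact ((or_congr k1 k2).trans (and_iff_right hne).symm)
  obtain ⟨es, hes⟩ : ∃ es : List (Fin L.length × Fin L.length),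
      es.map (fun p => ((p.1 : ℕ), (p.2 : ℕ))) = E := by
    have : E ∈ Set.range (List.map fun p : Fin L.length × Fin L.length =>
        ((p.1 : ℕ), (p.2 : ℕ))) := by
      rw [Set.range_list_map]
      rintro ⟨i, j⟩ hij
      obtain ⟨h1, h2, -⟩ := (hE i j).1 hij
      exact ⟨(⟨i, h1.trans h2⟩, ⟨j, h2⟩), rfl⟩
    exact this
  have hinj : Function.Injective fun p : Fin L.length × Fin L.length =>
      ((p.1 : ℕ), (p.2 : ℕ)) := by
    rintro ⟨a, b⟩ ⟨c, d⟩ he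
    simp only [Prod.mk.injEq] at he
    exact Prod.ext (Fin.ext he.1) (Fin.ext he.2)
  refine ⟨L.length, I.k, I.kernelGraph.comap φ, es, isEdgeList_of_lt ?_ ?_, ?_, ?_, le_rfl, ?_⟩
  · exact List.Nodup.of_map _ (hes ▸ hnd)
  · intro u v
    rw [← List.mem_map_of_injective hinj, hes, hE, hpair, SimpleGraph.comap_adj]
    constructor
    · rintro ⟨h1, h2, h3⟩; exact ⟨h1, h3⟩
    · rintro ⟨h1, h2⟩; exact ⟨h1, v.isLt, h2⟩
  · obtain ⟨o0, o1, o2, o3⟩ := run_progHeader hw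
    have hrun : progKernel.run s = progHeader.run (progWriteEdges.run τ) := rfl
    rw [hrun]
    have hlen : es.length = E.length := by rw [← hes, List.length_map]
    refine outputs_iff.2 ⟨o0.trans h12, ?_, by rw [o2, hlen], fun t ht => ?_⟩
    · rw [o1, hsame'.var 1 (by omega), hsame.var 1 (by omega), h23.var_k]
    · have := o3 t (hlen ▸ ht)
      simp only [← hes, List.getElem_map] at this
      exact this
  · rw [monopolarYes_iff_exists_colouring, exists_colouring_comap_iff hφ hrange]
    exact Instance.exists_colouring_iff_kernelGraph hI.consistent hI.exists_used
      fun w hw => (hS w (hclash w hw)).1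
  · refine le_trans (card_le_of_selected hI (fun w hw => (hS w hw).1) hφ fun i => ?_)
      (le_max_right _ _)
    rw [← hrange]; exact ⟨i, rfl⟩

theorem Ready.run_progMain (h : Ready I m ex ey 2 s) : IsKernelOutput I (progMain.run s) := by
  have h19 := h.run_progTables
  simp only [progMain, LProg.run]
  by_cases hI : Passes I
  · rw [if_neg (fun hr => h19.rejectExpr_iff.1 hr hI)]
    exact h19.run_progKernel hI
  · rw [if_pos (h19.rejectExpr_iff.2 hI)]
    exact h19.run_progReject fun ⟨f, hf⟩ => hI (.of_colouring hf)

end WordRAM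

/-! ### Instances given as edge lists -/

/-- The instance `(G, k)`, on the natural numbers. -/
def Instance.ofFin {n : ℕ} (k : ℕ) (G : SimpleGraph (Fin n)) : Instance where
  n := n
  k := k
  G := G.map Fin.valEmbedding
  lt_of_adj := by
    rintro x y h
    obtain ⟨u, v, -, rfl, -⟩ := SimpleGraph.map_adj _ _ _ _ |>.1 h
    exact u.isLt

theorem Instance.exists_colouring_ofFin_iff {n k : ℕ} (G : SimpleGraph (Fin n)) :
    (∃ f, IsClusterColouring (Instance.ofFin k G).G k Set.univ f) ↔ MonopolarYes G k := by
  rw [monopolarYes_iff_exists_colouring]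
  have hadj : ∀ u v : Fin n, (Instance.ofFin k G).G.Adj u v ↔ G.Adj u v := fun u v =>
    SimpleGraph.map_adj_apply (f := Fin.valEmbedding)
  constructor
  · rintro ⟨f, hf⟩
    refine ⟨fun u => f u, fun u _ => hf.le _ trivial, fun u _ v _ huv => ?_,
      fun u _ v _ hne h0 h1 => ?_⟩
    · exact hf.indep _ trivial _ trivial ((hadj u v).2 huv)
    · rw [← hadj]
      exact hf.adj_iff _ trivial _ trivial (fun h => hne (Fin.ext h)) h0 h1
  · rintro ⟨f, hf⟩
    have hval : ∀ {x : ℕ}, (if h : x < n then f ⟨x, h⟩ else 0) ≠ 0 → x < n := by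
      intro x hx
      by_contra h
      exact hx (dif_neg h)
    refine ⟨fun x => if h : x < n then f ⟨x, h⟩ else 0, fun x _ => ?_, fun x _ y _ hxy => ?_,
      fun x _ y _ hne h0 h1 => ?_⟩
    · split_ifs
      · exact hf.le _ trivial
      · exact Nat.zero_le _
    · have hx : x < n := (Instance.ofFin k G).lt_of_adj _ _ hxy
      have hy : y < n := (Instance.ofFin k G).lt_of_adj' hxy
      simp only [hx, hy, dif_pos]
      exact hf.indep _ trivial _ trivial ((hadj ⟨x, hx⟩ ⟨y, hy⟩).1 hxy)
    · have hx := hval h0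
      have hy := hval h1
      simp only [hx, hy, dif_pos] at h0 h1 ⊢
      rw [← hf.adj_iff ⟨x, hx⟩ trivial ⟨y, hy⟩ trivial (by simpa using hne) h0 h1]
      exact hadj ⟨x, hx⟩ ⟨y, hy⟩

namespace WordRAM

open LProg

/-- The state after `progInit`. -/
def initState (n k : ℕ) (es : List (Fin n × Fin n)) : State :=
  ((((State.input (encodeInstance n k es)).setVar 0 n).setVar 1 k).setVar 2 es.length).setVar 3
    (5 * n)

theorem input_edge {n k : ℕ} {es : List (Fin n × Fin n)} :
    ∀ (t : ℕ) (h : t < es.length), (State.input (encodeInstance n k es)).arr 0 (3 + 2 * t) =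
      es[t].1 ∧ (State.input (encodeInstance n k es)).arr 0 (4 + 2 * t) = es[t].2 := by
  refine (getElem_flatMap_iff es ((State.input (encodeInstance n k es)).arr 0) 3).1 fun i hi => ?_
  rw [add_comm 3 i]
  simp only [State.input, encodeInstance, if_true, List.getD_cons_succ]
  exact List.getD_eq_getElem _ _ hi

theorem ready_initState {n k : ℕ} {G : SimpleGraph (Fin n)} {es : List (Fin n × Fin n)}
    (h : IsEdgeList G es) : Ready (Instance.ofFin k G) es.length
      (fun i => (State.input (encodeInstance n k es)).arr 0 (3 + 2 * i))
      (fun i => (State.input (encodeInstance n k es)).arr 0 (4 + 2 * i)) 2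
      (initState n k es) where
  var_n := by simp [initState, State.setVar, Instance.ofFin]
  var_k := by simp [initState, State.setVar, Instance.ofFin]
  var_m := by simp [initState, State.setVar]
  var_N := by simp [initState, State.setVar, Instance.ofFin]
  fst _ _ := rfl
  snd _ _ := rfl
  adj x y := by
    constructor
    · intro hxy
      obtain ⟨u, v, huv, rfl, rfl⟩ := SimpleGraph.map_adj _ _ _ _ |>.1 hxy
      rcases (h.adj_iff u v).1 huv with he | he <;>
        obtain ⟨t, ht, hte⟩ := List.getElem_of_mem he
      · exact ⟨t, ht, Or.inl (by simp [input_edge t ht, hte])⟩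
      · exact ⟨t, ht, Or.inr (by simp [input_edge t ht, hte])⟩
    · rintro ⟨t, ht, hxy⟩
      have hadj : G.Adj es[t].1 es[t].2 := (h.adj_iff _ _).2 (Or.inl (List.getElem_mem ht))
      simp only [(input_edge t ht).1, (input_edge t ht).2] at hxy
      rcases hxy with ⟨rfl, rfl⟩ | ⟨rfl, rfl⟩
      · exact SimpleGraph.map_adj_apply (f := Fin.valEmbedding).2 hadj
      · exact SimpleGraph.map_adj_apply (f := Fin.valEmbedding).2 hadj.symm
  fact b h2 hb := by omega
  zero b hb j := by
    simp only [initState, State.setVar, State.input]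
    rw [if_neg (by omega)]

theorem boundedBy_input {n k B : ℕ} {es : List (Fin n × Fin n)} (hn : n ≤ B) (hk : k ≤ B)
    (hm : es.length ≤ B) : (State.input (encodeInstance n k es)).BoundedBy B := by
  refine ⟨fun x => Nat.zero_le _, fun a i => ?_⟩
  simp only [State.input]
  split_ifs
  · have hmem : ∀ w ∈ encodeInstance n k es, w ≤ B := by
      intro w hw
      simp only [encodeInstance, List.mem_cons, List.mem_flatMap, List.not_mem_nil, or_false] at hw
      rcases hw with rfl | rfl | rfl | ⟨p, -, rfl | rfl⟩
      · exact hn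
      · exact hk
      · exact hm
      · have := p.1.isLt; omega
      · have := p.2.isLt; omega
    rw [List.getD_eq_getElem?_getD]
    cases hg : (encodeInstance n k es)[i]? with
    | none => exact Nat.zero_le _
    | some w => exact hmem w (List.mem_of_getElem? hg)
  · exact Nat.zero_le _

theorem exec_progInit {n k W : ℕ} {es : List (Fin n × Fin n)} (h2 : 5 ≤ W) (hn : 5 * n ≤ W)
    (hk : k ≤ W) (hm : es.length ≤ W) :
    Exec W progInit (.input (encodeInstance n k es)) (initState n k es) 13 := by
  have hget : ∀ σ : State, σ.arr = (State.input (encodeInstance n k es)).arr →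
      (Expr.get 0 (.const 0)).eval σ = n ∧ (Expr.get 0 (.const 1)).eval σ = k ∧
        (Expr.get 0 (.const 2)).eval σ = es.length := by
    intro σ hσ
    simp [Expr.eval, hσ, State.input, encodeInstance]
  have hread : ∀ σ : State, σ.arr = (State.input (encodeInstance n k es)).arr → ∀ x i v,
      i ≤ 2 → (Expr.get 0 (.const i)).eval σ = v → v ≤ W →
      Exec W (.set x (.get 0 (.const i))) σ (σ.setVar x v) 3 := by
    intro σ hσ x i v hi hv hvW
    subst hv
    exact .set x _ σ ⟨le_trans hi (by omega), hvW⟩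
  refine .seq (t₁ := 3) (t₂ := 10) (hread _ rfl 0 0 n (by omega) (hget _ rfl).1 (by omega)) ?_
  set τ := (State.input (encodeInstance n k es)).setVar 0 n with hτ
  refine .seq (t₁ := 3) (t₂ := 7) (hread τ rfl 1 1 k (by omega) (hget τ rfl).2.1 hk) ?_
  set ρ := τ.setVar 1 k with hρ
  refine .seq (t₁ := 3) (t₂ := 4) (hread ρ rfl 2 2 _ (by omega) (hget ρ rfl).2.2 hm) ?_
  set σ := ρ.setVar 2 es.length with hσ
  have h0 : σ.var 0 = n := by simp [hσ, hρ, hτ, State.setVar]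
  have := Exec.set (W := W) 3 (.mul (.const 5) (.var 0)) σ
    ⟨h2, by simp only [Expr.Fits, h0]; omega, by simp only [Expr.eval, h0]; exact hn⟩
  simp only [Expr.eval, h0, Expr.cost] at this
  exact this

/-- Time and word bound of the kernelization, for inputs with an edge. -/
theorem exec_kernelization {n k : ℕ} {es : List (Fin n × Fin n)} (hn : 2 ≤ n)
    (hm : 1 ≤ es.length) (hle : es.length ≤ n ^ 2) {c : ℕ}
    (hc : (progMain.factor + 5) * progMain.deg + 3 ≤ c) :
    ∃ t ≤ 18 + progMain.factor * (n ^ 2 * es.length),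
      Exec ((n + k + 2) ^ c) kernelization (.input (encodeInstance n k es))
        (progMain.run (initState n k es)) t := by
  generalize hF : progMain.factor = F at hc ⊢
  set X := n + k + 2 with hX
  have hpow : ∀ {a b}, a ≤ b → X ^ a ≤ X ^ b := fun h => Nat.pow_le_pow_right (by omega) h
  have hX3 : 4 * 4 * X ≤ X ^ 3 := by
    rw [pow_succ, sq]
    exact Nat.mul_le_mul_right _ (Nat.mul_le_mul (by omega) (by omega))
  have hm2 : n ^ 2 ≤ X ^ 2 := Nat.pow_le_pow_left (by omega) 2
  have hm3 : es.length ≤ X ^ 3 := hle.trans (hm2.trans (hpow (by omega)))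
  have h3c : X ^ 3 ≤ X ^ c := hpow (by omega)
  have hbd : (initState n k es).BoundedBy (X ^ 3) :=
    boundedBy_setVar (boundedBy_setVar (boundedBy_setVar (boundedBy_setVar
      (boundedBy_input (by omega) (by omega) hm3) (by omega)) (by omega)) hm3) (by omega)
  have hvar : (initState n k es).var 0 = n ∧ (initState n k es).var 2 = es.length ∧
      (initState n k es).var 3 = 5 * n := by simp [initState, State.setVar]
  have htime : progMain.time (initState n k es).var ≤ F * (n ^ 2 * es.length) := by
    have := time_le (n := n) (m := es.length) (by omega) hm (β := (initState n k es).var)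
      hvar.2.1 (l := [0, 2, 3]) ?_ progMain boundsIn_progMain 2 1 depthN_progMain depthM_progMain
    · rwa [pow_one, hF] at this
    · intro b hb hb2
      simp only [List.mem_cons, List.not_mem_nil, or_false] at hb
      rcases hb with rfl | rfl | rfl
      · rw [hvar.1]; omega
      · exact absurd rfl hb2
      · rw [hvar.2.2]
  have hM : X ^ 3 + progMain.time (initState n k es).var ≤ X ^ (F + 5) := by
    have h1 : F ≤ X ^ F := (Nat.lt_two_pow_self).le.trans (Nat.pow_le_pow_left (by omega) F)
    have h2 : n ^ 2 * es.length ≤ X ^ 4 := by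
      calc n ^ 2 * es.length ≤ X ^ 2 * X ^ 2 := Nat.mul_le_mul hm2 (hle.trans hm2)
        _ = X ^ 4 := by ring
    calc X ^ 3 + progMain.time (initState n k es).var
        ≤ X ^ (F + 4) + X ^ F * X ^ 4 :=
          Nat.add_le_add (hpow (by omega)) (htime.trans (Nat.mul_le_mul h1 h2))
      _ = X ^ (F + 4) * 2 := by ring
      _ ≤ X ^ (F + 4) * X := Nat.mul_le_mul_left _ (by omega)
      _ = X ^ (F + 5) := by ring
  have hW : (X ^ (F + 5)) ^ progMain.deg ≤ X ^ c := by
    rw [← pow_mul]; exact hpow (by omega)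
  obtain ⟨⟨t, ht, hex⟩, -⟩ := exec_run progMain wf_progMain hW _ _ hbd (by omega) hM
  have hinit := exec_progInit (n := n) (k := k) (W := X ^ c) (es := es) (by omega) (by omega)
    (by omega) (by omega)
  have h2 : (Expr.get 0 (.const 2)).eval (State.input (encodeInstance n k es)) = es.length := rfl
  refine ⟨_, ?_, Exec.ifTrue (Nat.zero_le _) ⟨?_, ?_⟩ ?_ (.seq hinit hex)⟩
  · simp only [Expr.cost]; omega
  · show 2 ≤ _; omega
  · exact (le_of_eq h2).trans (by omega)
  · rw [h2]; exact hm

end WordRAM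

theorem kernel_size_le (k : ℕ) :
    4 * k + 2 * k * (k + 1) * (2 * k + 1) ≤ 9 * k ^ 4 + 9 * k + 1 := by
  rcases Nat.eq_zero_or_pos k with rfl | hk
  · simp
  · obtain ⟨j, rfl⟩ : ∃ j, k = j + 1 := ⟨k - 1, by omega⟩
    nlinarith [Nat.zero_le (j ^ 4), Nat.zero_le (j ^ 3), Nat.zero_le (j ^ 2)]

theorem mainTheorem3 :
    ∃ (P : WordRAM.Prog) (c C d : ℕ),
      ∀ (n k : ℕ) (G : SimpleGraph (Fin n)) (es : List (Fin n × Fin n)), IsEdgeList G es →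
        ∃ (s : WordRAM.State) (t : ℕ) (n' k' : ℕ) (G' : SimpleGraph (Fin n'))
          (es' : List (Fin n' × Fin n')),
          -- the program halts on `(G, k)`, using words of `O(log (n + k))` bits
          WordRAM.Exec ((n + k + 2) ^ c) P (.input (encodeInstance n k es)) s t ∧
          -- after `O(n² m)` steps
          t ≤ C * (n ^ 2 * G.edgeSet.ncard + 1) ∧
          -- with output an instance `(G', k')`
          IsEdgeList G' es' ∧ s.Outputs (encodeInstance n' k' es') ∧
          -- equivalent to `(G, k)`
          (MonopolarYes G k ↔ MonopolarYes G' k') ∧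
          -- whose parameter, number of vertices and total size are bounded in terms of `k`
          k' ≤ k ∧
          n' ≤ max 2 (9 * k ^ 4 + 9 * k + 1) ∧
          bitLength (encodeInstance n' k' es') ≤ d * (k + 1) ^ d := by
  generalize hc : (WordRAM.progMain.factor + 5) * WordRAM.progMain.deg + 3 = c
  generalize hF : WordRAM.progMain.factor = F
  obtain ⟨d, hd⟩ : ∃ d : ℕ, 20000 ≤ d := ⟨_, le_rfl⟩
  refine ⟨WordRAM.kernelization, c, F + 18, d, fun n k G es hes => ?_⟩
  suffices h : ∃ (s : WordRAM.State) (t : ℕ), WordRAM.Exec ((n + k + 2) ^ c)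
      WordRAM.kernelization (.input (encodeInstance n k es)) s t ∧
      t ≤ (F + 18) * (n ^ 2 * G.edgeSet.ncard + 1) ∧
      WordRAM.IsKernelOutput (Instance.ofFin k G) s by
    obtain ⟨s, t, hex, ht, n', k', G', es', he, ho, hiff, hk, hn⟩ := h
    have hn' : n' ≤ max 2 (9 * k ^ 4 + 9 * k + 1) :=
      hn.trans (max_le_max le_rfl (kernel_size_le k))
    refine ⟨s, t, n', k', G', es', hex, ht, he, ho,
      (Instance.exists_colouring_ofFin_iff G).symm.trans hiff, hk, hn', ?_⟩
    have hk : k' ≤ k := hk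
    set Y := (k + 1) ^ 4 with hY
    have hkY : k + 1 ≤ Y := Nat.le_self_pow (by omega) _
    have hk4 : k ^ 4 ≤ Y := Nat.pow_le_pow_left (by omega) 4
    have hnY : n' ≤ 19 * Y := hn'.trans (max_le (by omega) (by omega))
    have hl : es'.length ≤ 361 * Y ^ 2 := he.length_le.trans
      ((Nat.pow_le_pow_left hnY 2).trans_eq (by ring))
    have hY1 : 1 ≤ Y := by omega
    have hY2 : Y ≤ Y ^ 3 := Nat.le_self_pow (by omega) _
    have hY3 : Y ^ 2 ≤ Y ^ 3 := Nat.pow_le_pow_right hY1 (by omega)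
    calc bitLength (encodeInstance n' k' es')
        ≤ (n' + 1) + (k' + 1) + (es'.length + 1) + es'.length * (2 * (n' + 1)) := bitLength_le
      _ ≤ 20 * Y + Y + (361 * Y ^ 2 + 1) + 361 * Y ^ 2 * (2 * (20 * Y)) := by
          gcongr <;> omega
      _ = 21 * Y + 361 * Y ^ 2 + 14440 * Y ^ 3 + 1 := by ring
      _ ≤ 20000 * Y ^ 3 := by omega
      _ = 20000 * (k + 1) ^ 12 := by rw [hY]; ring
      _ ≤ d * (k + 1) ^ d :=
          Nat.mul_le_mul hd (Nat.pow_le_pow_right (by omega) (by omega))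
  rw [← hes.length_eq]
  rcases Nat.eq_zero_or_pos es.length with hm | hm
  · refine ⟨_, _, .ifFalse (t := 1) (Nat.zero_le _) ⟨?_, ?_⟩ ?_ (.skip _), ?_, ?_⟩
    · have h1 : 1 ≤ c := by omega
      exact le_trans (by simp) ((Nat.pow_le_pow_left (show 2 ≤ n + k + 2 by omega) 1).trans
        (Nat.pow_le_pow_right (by omega) h1))
    · exact (le_of_eq hm).trans (Nat.zero_le _)
    · exact not_lt_of_ge (le_of_eq hm)
    · exact le_trans (by simp only [WordRAM.Expr.cost]; omega)
        (Nat.le_mul_of_pos_right (F + 18) (Nat.succ_pos _))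
    · refine ⟨0, 0, ⊥, [], ⟨by simp, by simp⟩, WordRAM.outputs_iff.2 ?_, iff_of_true ?_ ?_,
        Nat.zero_le _, Nat.zero_le _⟩
      · simp [WordRAM.State.input]
      · refine ⟨0, fun _ _ => Nat.zero_le _, fun u _ v _ huv => ?_, fun _ _ _ _ _ h => absurd rfl h⟩
        obtain ⟨x, y, hxy, -, -⟩ := SimpleGraph.map_adj _ _ _ _ |>.1 huv
        have := (hes.adj_iff x y).1 hxy
        simp [List.length_eq_zero_iff.1 hm] at this
      · rw [monopolarYes_iff_exists_colouring]
        exact ⟨0, fun _ _ => Nat.zero_le _, fun u => u.elim0, fun u => u.elim0⟩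
  · have hn : 2 ≤ n := by
      have hadj : G.Adj es[0].1 es[0].2 := (hes.adj_iff _ _).2 (Or.inl (List.getElem_mem hm))
      have h1 := es[0].1.isLt
      have h2 := es[0].2.isLt
      have h3 : (es[0].1 : ℕ) ≠ es[0].2 := fun h => hadj.ne (Fin.ext h)
      omega
    obtain ⟨t, ht, hex⟩ := WordRAM.exec_kernelization (k := k) hn hm hes.length_le hc.le
    rw [hF] at ht
    refine ⟨_, t, hex, ht.trans ?_, (WordRAM.ready_initState hes).run_progMain⟩
    nlinarith [Nat.zero_le (n ^ 2 * es.length)]
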